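/- Let $p$ be a prime, let $\overline{\mathbf Q}_p$ be an algebraic closure of $\mathbf Q_p$, let $C$ be its $p$-adic completion, with ring of integers $\mathcal O_C$, and let $\mathcal O_C^\flat=\varprojlim_{x\mapsto x^p}\mathcal O_C/p$ be the tilt of $\mathcal O_C$ and $C^\flat=\mathrm{Frac}(\mathcal O_C^\flat)$. Fix a compatible system $(1,\zeta_p,\zeta_{p^2},\dots)$ of primitive $p$-power roots of unity; it defines $\varepsilon\in\mathcal O_C^\flat$. Put $\varpi=\varepsilon-1$ and let $[\varpi]$ be its Teichmüller lift. Let $K\subset\overline{\mathbf Q}_p$ be a finite extension of $\mathbf Q_p$ and $H_K=\mathrm{Gal}(\overline{\mathbf Q}_p/K(\mu_{p^\infty}))$. Let $\Lambda$ be the $\mathbf Z_p$-subalgebra of $W(\mathcal O_C^\flat)$ generated by $[\varpi]$. For $r\in\mathbf Q_{>0}$ with $1/r\in\mathbf Z[1/p]$, let $\widetilde{\mathbf A}^{(0,r],\circ}$ be the set of $x=\sum_{k\ge 0}[x_k]p^k\in W(C^\flat)$ such that $x_k\varpi^{k/r}\in\mathcal O_C^\flat$ for all $k$ and $x_k\varpi^{k/r}\to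 0$ as $k\to\infty$. For a $\mathbf Z_p$-module $A$ and $a\ge 0$ define $$W_a(\mathcal O_C^\flat)_A=\varprojlim_i\,(W_a(\mathcal O_C^\flat)\otimes_{\mathbf Z_p}A)/[\varpi]^i,\qquad \widetilde{\mathbf A}_A=\varprojlim_a\bigl(W_a(\mathcal O_C^\flat)_A[1/[\varpi]]\bigr),$$ $$\widetilde{\mathbf A}^{(0,\infty)}_A=\bigl(\varprojlim_a W_a(\mathcal O_C^\flat)_A\bigr)[1/[\varpi]],\qquad \widetilde{\mathbf A}^{(0,r]}_A=\bigl(\varprojlim_i(\widetilde{\mathbf A}^{(0,r],\circ}\otimes_{\mathbf Z_p}A)/[\varpi]^i\bigr)[1/[\varpi]].$$ The quotients modulo $[\varpi]^i$ are discrete, inverse limits carry the inverse limit topology, and localizations $M[1/[\varpi]]=\varinjlim(M\xrightarrow{[\varpi]}M\xrightarrow{[\varpi]}\cdots)$ the direct limit topology. The group $H_K$ acts on all these $\Lambda$-modules through its action on $C$, trivially on $A$. Denote by $\widetilde{\mathbf A}_{K,A}$, $\widetilde{\mathbf A}^{(0,r]}_{K,A}$, $\widetilde{\mathbf A}^{(0,\infty)}_{K,A}$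 the submodules of $H_K$-invariants of $\widetilde{\mathbf A}_{A}$, $\widetilde{\mathbf A}^{(0,r]}_{A}$, $\widetilde{\mathbf A}^{(0,\infty)}_{A}$, with the subspace topology. There are natural maps $j_r:\widetilde{\mathbf A}^{(0,r]}_A\to\widetilde{\mathbf A}_A$ and $j_\infty:\widetilde{\mathbf A}^{(0,\infty)}_A\to\widetilde{\mathbf A}_A$. The map $j_\infty$ is induced by the projections $\varprojlim_bW_b(\mathcal O_C^\flat)_A\to W_a(\mathcal O_C^\flat)_A$. The map $j_r$ is induced by the inclusion $\widetilde{\mathbf A}^{(0,r],\circ}\subset W(C^\flat)$: for an integer $m\ge 1/r$ (we take for $m$ the numerator of $1/r$), its component at $a$ is induced by $x\mapsto[\varpi]^{-am}\cdot\bigl([\varpi]^{am}x \bmod p^a\bigr)$, where $[\varpi]^{am}x\bmod p^a$ lies in $W_a(\mathcal O_C^\flat)$. **Proposition.** Let $A$ be a $p$-adically complete and separated $\mathbf Z_p$-module, $N\ge 0$ an integer, and $r\in\mathbf Q_{>0}$ with $1/r\in\mathbf Z[1/p]$. There are isomorphisms of topological $\Lambda$-modules $$\widetilde{\mathbf A}_{K,A}/p^N\widetilde{\mathbf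 A}_{K,A}\ \xrightarrow[\ e_1\ ]{\sim}\ \widetilde{\mathbf A}_{K,A/p^N}\ \xrightarrow[\ e_2\ ]{\sim}\ \widetilde{\mathbf A}^{(0,r]}_{K,A/p^N}\ \xrightarrow[\ e_3\ ]{\sim}\ \widetilde{\mathbf A}^{(0,\infty)}_{K,A/p^N},$$ where the source of $e_1$ has the quotient topology, and these are the natural ones: $e_1$ is induced by the map $\widetilde{\mathbf A}_A\to\widetilde{\mathbf A}_{A/p^N}$ coming from $A\to A/p^N$, and, for the coefficients $A/p^N$, one has $j_r(e_2(y))=y$ for all $y$ and $j_\infty(e_3(w))=j_r(w)$ for all $w$. -/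

import Mathlib

noncomputable section
open scoped TensorProduct
namespace PerfectPeriods
variable (p : ℕ) [hp : Fact p.Prime]

theorem mem_OC_iff (x : ℂ_[p]) : x ∈ 𝓞_ℂ_[p] ↔ ‖x‖ ≤ 1 := by
  rw [PadicComplex.norm_eq_norm, Valuation.norm_def, PadicComplex.RankOne.hom_eq_embedding,
    Valuation.embedding_restrict]
  exact Iff.rfl

instance not_isUnit_p : Fact (¬ IsUnit (p : 𝓞_ℂ_[p])) := ⟨fun h => by
  have h1 := (PadicComplexInt.integers p).one_of_isUnit h
  rw [map_natCast, PadicComplex.valuation_p] at h1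
  have h2 := hp.out.one_lt
  have h3 : ((p : NNReal)) ≠ 0 := by exact_mod_cast hp.out.ne_zero
  rw [div_eq_one_iff_eq h3] at h1
  have : 1 = p := by exact_mod_cast h1
  omega⟩

/-- `O_C♭`, the tilt of the ring of integers of `C = ℂ_[p]`: the limit of `O_C / p` along
`x ↦ x ^ p`. -/
abbrev OCflat : Type := PreTilt 𝓞_ℂ_[p] p

instance : IsDomain (OCflat p) :=
  PreTilt.isDomain ℂ_[p] (PadicComplex.valued p).v 𝓞_ℂ_[p] (PadicComplexInt.integers p) p

/-- `C♭ = Frac O_C♭`. -/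
abbrev Cflat : Type := FractionRing (OCflat p)

instance : CharP (Cflat p) p :=
  charP_of_injective_algebraMap (IsFractionRing.injective (OCflat p) (Cflat p)) p

instance : PerfectRing (Cflat p) p := PerfectRing.ofSurjective _ p fun x => by
  obtain ⟨a, b, hb, rfl⟩ := IsFractionRing.div_surjective (A := OCflat p) x
  refine ⟨algebraMap _ _ ((frobeniusEquiv (OCflat p) p).symm a) /
    algebraMap _ _ ((frobeniusEquiv (OCflat p) p).symm b), ?_⟩
  rw [frobenius_def, div_pow, ← map_pow (algebraMap _ _), ← map_pow (algebraMap _ _),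
    frobeniusEquiv_symm_pow_p, frobeniusEquiv_symm_pow_p]

/-- `A_inf = W(O_C♭)`. -/
abbrev Ainf : Type := WittVector p (OCflat p)
/-- `Ã = W(C♭)`. -/
abbrev Atilde : Type := WittVector p (Cflat p)

instance : Algebra (Ainf p) (Atilde p) :=
  (WittVector.map (algebraMap (OCflat p) (Cflat p))).toAlgebra
/-- The structure map `ℤ_p = W(𝔽_p) → W(O_C♭)`. -/
instance : Algebra ℤ_[p] (Ainf p) :=
  ((WittVector.map (ZMod.castHom (dvd_refl p) (OCflat p))).comp
    (WittVector.equiv p).symm.toRingHom).toAlgebra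
instance : Algebra ℤ_[p] (Atilde p) :=
  ((algebraMap (Ainf p) (Atilde p)).comp (algebraMap ℤ_[p] (Ainf p))).toAlgebra
instance : IsScalarTower ℤ_[p] (Ainf p) (Atilde p) := IsScalarTower.of_algebraMap_eq fun _ => rfl

theorem coeff_teichmuller_mul {R : Type*} [CommRing R] [CharP R p] (a : R) (x : WittVector p R)
    (k : ℕ) : (WittVector.teichmuller p a * x).coeff k = a ^ p ^ k * x.coeff k := by
  induction k generalizing a x with
  | zero => simp [WittVector.mul_coeff_zero]
  | succ k ih =>
    have hd : ∀ (b : R) (y : WittVector p R) (n : ℕ),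
        (WittVector.teichmuller p b).coeff n = 0 ∨ (WittVector.verschiebung y).coeff n = 0 := by
      rintro b y (_ | n)
      · exact Or.inr (WittVector.verschiebung_coeff_zero _)
      · exact Or.inl (WittVector.teichmuller_coeff_pos p b _ n.succ_pos)
    have hx : x = WittVector.teichmuller p (x.coeff 0) + WittVector.verschiebung (x.shift 1) := by
      ext (_ | n)
      · rw [WittVector.coeff_add_of_disjoint _ _ _ (hd _ _), WittVector.teichmuller_coeff_zero,
          WittVector.verschiebung_coeff_zero, add_zero]
      · rw [WittVector.coeff_add_of_disjoint _ _ _ (hd _ _),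
          WittVector.teichmuller_coeff_pos p _ _ n.succ_pos, zero_add,
          WittVector.verschiebung_coeff_succ, WittVector.shift_coeff, add_comm]
    have hF : WittVector.frobenius (WittVector.teichmuller p a) = WittVector.teichmuller p (a ^ p) := by
      rw [WittVector.frobenius_eq_map_frobenius, WittVector.map_teichmuller, frobenius_def]
    have hm : WittVector.teichmuller p a * x = WittVector.teichmuller p (a * x.coeff 0) +
        WittVector.verschiebung (WittVector.teichmuller p (a ^ p) * x.shift 1) := by
      conv_lhs => rw [hx]
      rw [mul_add, map_mul, mul_comm (WittVector.teichmuller p a) (WittVector.verschiebung _),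
        ← WittVector.verschiebung_mul_frobenius, hF, mul_comm (x.shift 1)]
    rw [hm, WittVector.coeff_add_of_disjoint _ _ _ (hd _ _),
      WittVector.teichmuller_coeff_pos p _ _ k.succ_pos, zero_add,
      WittVector.verschiebung_coeff_succ, ih, WittVector.shift_coeff, ← pow_mul, pow_succ',
      add_comm]

theorem norm_gal (σ : PadicAlgCl p ≃ₐ[ℚ_[p]] PadicAlgCl p) (x : PadicAlgCl p) : ‖σ x‖ = ‖x‖ :=
  (spectralNorm_eq_of_equiv σ x).symm

theorem continuous_gal (σ : PadicAlgCl p ≃ₐ[ℚ_[p]] PadicAlgCl p) :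
    Continuous (σ : PadicAlgCl p →+* PadicAlgCl p) :=
  (AddMonoidHomClass.isometry_of_norm (σ : PadicAlgCl p →+* PadicAlgCl p) (norm_gal p σ)).continuous

/-- The continuous extension to `C` of an automorphism of the algebraic closure of `ℚ_p`. -/
def galC (σ : PadicAlgCl p ≃ₐ[ℚ_[p]] PadicAlgCl p) : ℂ_[p] →+* ℂ_[p] :=
  UniformSpace.Completion.mapRingHom (σ : PadicAlgCl p →+* PadicAlgCl p) (continuous_gal p σ)

theorem norm_galC (σ : PadicAlgCl p ≃ₐ[ℚ_[p]] PadicAlgCl p) (x : ℂ_[p]) : ‖galC p σ x‖ = ‖x‖ := by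
  have hc : Continuous (galC p σ) := UniformSpace.Completion.continuous_map
  refine UniformSpace.Completion.induction_on x (isClosed_eq (hc.norm) continuous_norm) fun a => ?_
  rw [galC, UniformSpace.Completion.mapRingHom_coe, UniformSpace.Completion.norm_coe,
    UniformSpace.Completion.norm_coe]
  exact norm_gal p σ a

def galOC (σ : PadicAlgCl p ≃ₐ[ℚ_[p]] PadicAlgCl p) : 𝓞_ℂ_[p] →+* 𝓞_ℂ_[p] :=
  (galC p σ).restrict 𝓞_ℂ_[p] 𝓞_ℂ_[p] fun x hx => by
    rw [mem_OC_iff] at hx ⊢; rwa [norm_galC]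

/-- The action on `O_C♭`, induced by the action on `O_C / p`. -/
def galOCflat (σ : PadicAlgCl p ≃ₐ[ℚ_[p]] PadicAlgCl p) : OCflat p →+* OCflat p :=
  Perfection.map p (Ideal.quotientMap (Ideal.span {(p : 𝓞_ℂ_[p])}) (galOC p σ) (by
    rw [Ideal.span_singleton_le_iff_mem, Ideal.mem_comap, map_natCast]
    exact Ideal.mem_span_singleton_self _))

/-- A compatible system `(1, ζ_p, ζ_{p²}, …)` of primitive `p`-power roots of unity. -/
structure RootSystem where
  zeta : ℕ → PadicAlgCl p
  isPrimitiveRoot : ∀ n, IsPrimitiveRoot (zeta n) (p ^ n)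
  pow_succ_eq : ∀ n, zeta (n + 1) ^ p = zeta n

variable {p}
theorem RootSystem.norm_zeta (z : RootSystem p) (n : ℕ) : ‖z.zeta n‖ = 1 := by
  have h := (z.isPrimitiveRoot n).pow_eq_one
  have h2 : ‖z.zeta n‖ ^ p ^ n = 1 := by rw [← norm_pow, h, norm_one]
  exact (pow_eq_one_iff_of_nonneg (norm_nonneg _) (pow_ne_zero _ hp.out.ne_zero)).1 h2

def RootSystem.zetaInt (z : RootSystem p) (n : ℕ) : 𝓞_ℂ_[p] :=
  ⟨(z.zeta n : ℂ_[p]), by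
    rw [mem_OC_iff, UniformSpace.Completion.norm_coe, z.norm_zeta]⟩

theorem RootSystem.zetaInt_pow (z : RootSystem p) (n : ℕ) : z.zetaInt (n + 1) ^ p = z.zetaInt n := by
  apply Subtype.ext
  show ((z.zeta (n + 1) : PadicAlgCl p) : ℂ_[p]) ^ p = (z.zeta n : ℂ_[p])
  rw [← z.pow_succ_eq n]
  exact (map_pow (UniformSpace.Completion.coeRingHom (α := PadicAlgCl p)) _ _).symm

/-- `ε = (1, ζ_p, ζ_{p²}, …) ∈ O_C♭`. -/
def eps (z : RootSystem p) : OCflat p :=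
  ⟨fun n => Ideal.Quotient.mk _ (z.zetaInt n), fun n => by
    rw [← map_pow, z.zetaInt_pow]⟩

/-- `ϖ = ε - 1`. -/
def varpi (z : RootSystem p) : OCflat p := eps z - 1

/-- The Teichmüller lift `[ϖ]`. -/
def teichVarpi (z : RootSystem p) : Ainf p := WittVector.teichmuller p (varpi z)

/-- The `ℤ_p`-subalgebra of `A_inf` generated by the Teichmüller lift `[ϖ]`. All periods below
are modules over it. -/
def Lam (z : RootSystem p) : Type := Algebra.adjoin ℤ_[p] {teichVarpi z}

instance (z : RootSystem p) : CommRing (Lam z) :=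
  inferInstanceAs (CommRing (Algebra.adjoin ℤ_[p] {teichVarpi z}))
instance (z : RootSystem p) : Algebra ℤ_[p] (Lam z) :=
  inferInstanceAs (Algebra ℤ_[p] (Algebra.adjoin ℤ_[p] {teichVarpi z}))
instance (z : RootSystem p) : Algebra (Lam z) (Ainf p) :=
  inferInstanceAs (Algebra (Algebra.adjoin ℤ_[p] {teichVarpi z}) (Ainf p))
instance (z : RootSystem p) : IsScalarTower ℤ_[p] (Lam z) (Ainf p) :=
  IsScalarTower.of_algebraMap_eq fun _ => rfl
instance (z : RootSystem p) : Algebra (Lam z) (Atilde p) :=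
  ((algebraMap (Ainf p) (Atilde p)).comp (algebraMap (Lam z) (Ainf p))).toAlgebra
instance (z : RootSystem p) : IsScalarTower (Lam z) (Ainf p) (Atilde p) :=
  IsScalarTower.of_algebraMap_eq fun _ => rfl
instance (z : RootSystem p) : IsScalarTower ℤ_[p] (Lam z) (Atilde p) :=
  IsScalarTower.of_algebraMap_eq fun _ => rfl

/-- `[ϖ]` as an element of this subalgebra. -/
def lamVarpi (z : RootSystem p) : Lam z :=
  (⟨teichVarpi z, Algebra.subset_adjoin rfl⟩ : Algebra.adjoin ℤ_[p] {teichVarpi z})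

variable (p) in
/-- The rationals `r` with `1 / r ∈ ℤ[1/p]` and `r > 0`. -/
def Radius : Type := {r : ℚ // 0 < r ∧ ∃ m k : ℕ, r⁻¹ = (m : ℚ) / (p : ℚ) ^ k}

/-- The numerator of `1 / r`. -/
def Radius.num (r : Radius p) : ℕ := (r.1⁻¹).num.toNat
/-- The exponent `k` for which `1 / r = num / p ^ k` in lowest terms. -/
def Radius.exp (r : Radius p) : ℕ := padicValNat p (r.1⁻¹).den

theorem Radius.inv_eq (r : Radius p) : r.1⁻¹ = (r.num : ℚ) / (p : ℚ) ^ r.exp := by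
  obtain ⟨h0, m, k, h⟩ := r.2
  have hd : (r.1⁻¹).den ∣ p ^ k := by
    have := Rat.den_dvd (m : ℤ) ((p : ℤ) ^ k)
    rw [h]
    have h3 : ((m : ℤ) : ℚ) / (((p : ℤ) ^ k : ℤ) : ℚ) = (m : ℚ) / (p : ℚ) ^ k := by push_cast; rfl
    rw [Rat.divInt_eq_div, h3] at this
    exact_mod_cast this
  obtain ⟨j, -, hj⟩ := (Nat.dvd_prime_pow hp.out).1 hd
  have he : r.exp = j := by rw [Radius.exp, hj, padicValNat.prime_pow]
  have hn : ((r.num : ℕ) : ℤ) = (r.1⁻¹).num :=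
    Int.toNat_of_nonneg (Rat.num_nonneg.2 (inv_pos.2 h0).le)
  conv_lhs => rw [← Rat.num_div_den r.1⁻¹]
  rw [hj, he, ← hn]; push_cast; rfl

theorem Radius.num_pos (r : Radius p) : 0 < r.num := by
  have := Rat.num_pos.2 (inv_pos.2 r.2.1)
  unfold Radius.num; omega

/-- `ϖ ^ (1 / r)`. -/
def varpiRoot (z : RootSystem p) (r : Radius p) : OCflat p :=
  ((frobeniusEquiv (OCflat p) p).symm^[r.exp] (varpi z)) ^ r.num

theorem varpiRoot_pow (z : RootSystem p) (r : Radius p) :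
    varpiRoot z r ^ p ^ r.exp = varpi z ^ r.num := by
  rw [varpiRoot, ← pow_mul, mul_comm, pow_mul, iterate_frobeniusEquiv_symm_pow_p_pow]

theorem varpiRoot_dvd (z : RootSystem p) (r : Radius p) : varpiRoot z r ∣ varpi z ^ r.num := by
  rw [← varpiRoot_pow]; exact dvd_pow_self _ (pow_ne_zero _ hp.out.ne_zero)

theorem varpi_dvd (z : RootSystem p) (r : Radius p) : varpi z ∣ varpiRoot z r ^ p ^ r.exp := by
  rw [varpiRoot_pow]; exact dvd_pow_self _ r.num_pos.ne'

/-- The `k`-th Teichmüller coordinate `x_k` of `x = ∑ [x_k] p ^ k`, that is the `p ^ k`-th root of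
the `k`-th Witt coordinate. -/
def teichCoord (x : Atilde p) (k : ℕ) : Cflat p :=
  (frobeniusEquiv (Cflat p) p).symm^[k] (x.coeff k)

/-- `w ∈ b O_C♭`. -/
def DvdBy (b : OCflat p) (w : Cflat p) : Prop := ∃ c : OCflat p, w = algebraMap _ _ (b * c)

theorem teichCoord_pow (x : Atilde p) (k : ℕ) : teichCoord x k ^ p ^ k = x.coeff k :=
  iterate_frobeniusEquiv_symm_pow_p_pow _ _ _ _

theorem pow_p_pow_inj (k : ℕ) {x y : Cflat p} (h : x ^ p ^ k = y ^ p ^ k) : x = y := by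
  rw [← iterate_frobenius, ← iterate_frobenius] at h
  exact (frobenius_inj (Cflat p) p).iterate k h

theorem exists_truncate_iff (N : ℕ) (a b : OCflat p) (x : Atilde p) :
    (∃ u : Ainf p, ∀ k < N, (algebraMap (Ainf p) (Atilde p) (WittVector.teichmuller p a) * x).coeff k =
      (algebraMap (Ainf p) (Atilde p) (WittVector.teichmuller p b * u)).coeff k) ↔
    ∀ k < N, DvdBy b (teichCoord x k * algebraMap _ _ a) := by
  have e1 : ∀ k, (algebraMap (Ainf p) (Atilde p) (WittVector.teichmuller p a) * x).coeff k =
      (teichCoord x k * algebraMap _ _ a) ^ p ^ k := fun k => by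
    have : algebraMap (Ainf p) (Atilde p) (WittVector.teichmuller p a) =
      WittVector.teichmuller p (algebraMap _ _ a) := WittVector.map_teichmuller p _ _
    rw [this, coeff_teichmuller_mul, mul_pow, teichCoord_pow, mul_comm]
  have e2 : ∀ (u : Ainf p) k, (algebraMap (Ainf p) (Atilde p) (WittVector.teichmuller p b * u)).coeff k =
      algebraMap _ _ (b ^ p ^ k * u.coeff k) := fun u k => by
    rw [← coeff_teichmuller_mul]; rfl
  constructor
  · rintro ⟨u, hu⟩ k hk
    refine ⟨(frobeniusEquiv (OCflat p) p).symm^[k] (u.coeff k), pow_p_pow_inj k ?_⟩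
    rw [← e1, hu k hk, e2, ← map_pow, mul_pow, iterate_frobeniusEquiv_symm_pow_p_pow]
  · intro h
    choose! c hc using h
    refine ⟨WittVector.mk p fun k => c k ^ p ^ k, fun k hk => ?_⟩
    rw [e1, e2, hc k hk, ← map_pow, mul_pow, WittVector.coeff_mk]

theorem coeff_lt_iff_truncate {R : Type*} [CommRing R] (N : ℕ) (x y : WittVector p R) :
    (∀ k < N, x.coeff k = y.coeff k) ↔ WittVector.truncate N x = WittVector.truncate N y := by
  constructor
  · intro h
    ext i
    simpa using h i i.2
  · intro h k hk
    have := congrArg (fun w => w.coeff ⟨k, hk⟩) h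
    simpa using this

theorem dvdBy_add {N : ℕ} {a b : OCflat p} {x y : Atilde p}
    (hx : ∀ k < N, DvdBy b (teichCoord x k * algebraMap _ _ a))
    (hy : ∀ k < N, DvdBy b (teichCoord y k * algebraMap _ _ a)) :
    ∀ k < N, DvdBy b (teichCoord (x + y) k * algebraMap _ _ a) := by
  rw [← exists_truncate_iff] at hx hy ⊢
  obtain ⟨u, hu⟩ := hx
  obtain ⟨v, hv⟩ := hy
  refine ⟨u + v, ?_⟩
  rw [coeff_lt_iff_truncate] at hu hv ⊢
  rw [mul_add, mul_add, map_add, map_add, map_add, hu, hv]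

theorem dvdBy_smul {N : ℕ} {a b : OCflat p} {x : Atilde p} (w : Ainf p)
    (hx : ∀ k < N, DvdBy b (teichCoord x k * algebraMap _ _ a)) :
    ∀ k < N, DvdBy b (teichCoord (w • x) k * algebraMap _ _ a) := by
  rw [← exists_truncate_iff] at hx ⊢
  obtain ⟨u, hu⟩ := hx
  refine ⟨w * u, ?_⟩
  rw [coeff_lt_iff_truncate] at hu ⊢
  rw [Algebra.smul_def, mul_left_comm, map_mul, hu, ← map_mul, ← map_mul, mul_left_comm]

/-- The condition defining `Ã^{(0,r],◦}`: writing `x = ∑ [x_k] p ^ k`, the valuation of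
`x_k ϖ ^ (k / r)` is non-negative for all `k`, and tends to infinity with `k`. -/
def IsCirc (z : RootSystem p) (r : Radius p) (x : Atilde p) : Prop :=
  (∀ k, DvdBy 1 (teichCoord x k * algebraMap _ _ (varpiRoot z r ^ k))) ∧
  ∀ m, ∃ J, ∀ k ≥ J, DvdBy (varpi z ^ m) (teichCoord x k * algebraMap _ _ (varpiRoot z r ^ k))

theorem DvdBy.mul {b b' : OCflat p} {w : Cflat p} (h : DvdBy b w) (a : OCflat p)
    (hb : b' ∣ b * a) : DvdBy b' (w * algebraMap _ _ a) := by
  obtain ⟨c, rfl⟩ := h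
  obtain ⟨d, hd⟩ := hb
  refine ⟨d * c, ?_⟩
  rw [← map_mul, mul_right_comm, hd, mul_assoc]

theorem isCirc_iff (z : RootSystem p) (r : Radius p) (x : Atilde p) : IsCirc z r x ↔
    (∀ n, ∀ k < n + 1, DvdBy 1 (teichCoord x k * algebraMap _ _ (varpiRoot z r ^ n))) ∧
    ∀ m, ∃ J, ∀ n ≥ J, ∀ k < n + 1,
      DvdBy (varpi z ^ m) (teichCoord x k * algebraMap _ _ (varpiRoot z r ^ n)) := by
  have key : ∀ n k, k < n + 1 → teichCoord x k * algebraMap _ _ (varpiRoot z r ^ n) =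
      (teichCoord x k * algebraMap _ _ (varpiRoot z r ^ k)) *
        algebraMap _ _ (varpiRoot z r ^ (n - k)) := fun n k hk => by
    rw [mul_assoc, ← map_mul, ← pow_add]; congr 3; omega
  constructor
  · rintro ⟨h1, h2⟩
    refine ⟨fun n k hk => ?_, fun m => ?_⟩
    · rw [key n k hk]; exact (h1 k).mul _ (one_dvd _)
    · obtain ⟨J, hJ⟩ := h2 m
      refine ⟨J + p ^ r.exp * m, fun n hn k hk => ?_⟩
      rw [key n k hk]
      by_cases hkJ : J ≤ k
      · exact (hJ k hkJ).mul _ (dvd_mul_right _ _)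
      · refine (h1 k).mul _ ?_
        rw [one_mul]
        calc varpi z ^ m ∣ (varpiRoot z r ^ p ^ r.exp) ^ m := pow_dvd_pow_of_dvd (varpi_dvd z r) m
          _ = varpiRoot z r ^ (p ^ r.exp * m) := (pow_mul _ _ _).symm
          _ ∣ _ := pow_dvd_pow _ (by omega)
  · rintro ⟨h1, h2⟩
    refine ⟨fun k => h1 k k k.lt_succ_self, fun m => ?_⟩
    obtain ⟨J, hJ⟩ := h2 m
    exact ⟨J, fun k hk => hJ k hk k k.lt_succ_self⟩

theorem teichCoord_zero (k : ℕ) : teichCoord (0 : Atilde p) k = 0 := by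
  apply pow_p_pow_inj k
  rw [teichCoord_pow, WittVector.zero_coeff, zero_pow (pow_ne_zero _ hp.out.ne_zero)]

/-- `Ã^{(0,r],◦} ⊆ Ã`, as an `A_inf`-submodule. -/
def circBase (z : RootSystem p) (r : Radius p) : Submodule (Ainf p) (Atilde p) where
  carrier := {x | IsCirc z r x}
  zero_mem' := by
    have : ∀ (b a : OCflat p) k, DvdBy b (teichCoord (0 : Atilde p) k * algebraMap _ _ a) :=
      fun b a k => ⟨0, by rw [teichCoord_zero, zero_mul, mul_zero, map_zero]⟩
    exact ⟨fun k => this _ _ k, fun m => ⟨0, fun k _ => this _ _ k⟩⟩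
  add_mem' {x y} hx hy := by
    rw [Set.mem_ofPred_eq, isCirc_iff] at hx hy ⊢
    refine ⟨fun n => dvdBy_add (hx.1 n) (hy.1 n), fun m => ?_⟩
    obtain ⟨J, hJ⟩ := hx.2 m
    obtain ⟨J', hJ'⟩ := hy.2 m
    exact ⟨max J J', fun n hn => dvdBy_add (hJ n (le_of_max_le_left hn))
      (hJ' n (le_of_max_le_right hn))⟩
  smul_mem' w x hx := by
    rw [Set.mem_ofPred_eq, isCirc_iff] at hx ⊢
    refine ⟨fun n => dvdBy_smul w (hx.1 n), fun m => ?_⟩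
    obtain ⟨J, hJ⟩ := hx.2 m
    exact ⟨J, fun n hn => dvdBy_smul w (hJ n hn)⟩

variable (p) in
/-- The absolute Galois group of `ℚ_p`. -/
abbrev GQp : Type := PadicAlgCl p ≃ₐ[ℚ_[p]] PadicAlgCl p

theorem galC_coe (σ : GQp p) (a : PadicAlgCl p) : galC p σ (a : ℂ_[p]) = ((σ a : PadicAlgCl p) : ℂ_[p]) :=
  UniformSpace.Completion.mapRingHom_coe (continuous_gal p σ) a

theorem galC_inv (σ : GQp p) (x : ℂ_[p]) : galC p σ⁻¹ (galC p σ x) = x := by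
  have hc : ∀ τ : GQp p, Continuous (galC p τ) := fun τ => UniformSpace.Completion.continuous_map
  refine UniformSpace.Completion.induction_on x
    (isClosed_eq ((hc _).comp (hc _)) continuous_id) fun a => ?_
  rw [galC_coe, galC_coe, ← AlgEquiv.mul_apply, inv_mul_cancel]; rfl

theorem coeff_galOCflat (σ : GQp p) (n : ℕ) (x : OCflat p) (y : 𝓞_ℂ_[p])
    (h : PreTilt.coeff n x = Ideal.Quotient.mk _ y) :
    PreTilt.coeff n (galOCflat p σ x) = Ideal.Quotient.mk _ (galOC p σ y) := by
  have : PreTilt.coeff n (galOCflat p σ x) = Ideal.quotientMap (Ideal.span {(p : 𝓞_ℂ_[p])})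
    (galOC p σ) (by
    rw [Ideal.span_singleton_le_iff_mem, Ideal.mem_comap, map_natCast]
    exact Ideal.mem_span_singleton_self _) (PreTilt.coeff n x) := rfl
  rw [this, h, Ideal.quotientMap_mk]

theorem galOCflat_inv (σ : GQp p) (x : OCflat p) : galOCflat p σ⁻¹ (galOCflat p σ x) = x := by
  refine Perfection.ext fun n => ?_
  obtain ⟨y, hy⟩ := Ideal.Quotient.mk_surjective (PreTilt.coeff n x)
  refine (coeff_galOCflat σ⁻¹ n _ _ (coeff_galOCflat σ n x y hy.symm)).trans ?_
  refine Eq.trans ?_ hy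
  congr 1
  exact Subtype.ext (galC_inv σ y)

theorem galOCflat_injective (σ : GQp p) : Function.Injective (galOCflat p σ) :=
  Function.LeftInverse.injective (galOCflat_inv σ)

/-- The action on `C♭`. -/
def galCflat (σ : GQp p) : Cflat p →+* Cflat p :=
  IsFractionRing.lift (A := OCflat p) (g := (algebraMap (OCflat p) (Cflat p)).comp (galOCflat p σ))
    ((IsFractionRing.injective (OCflat p) (Cflat p)).comp (galOCflat_injective σ))

theorem galCflat_algebraMap (σ : GQp p) (x : OCflat p) :
    galCflat σ (algebraMap _ _ x) = algebraMap _ _ (galOCflat p σ x) :=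
  IsFractionRing.lift_algebraMap (A := OCflat p) _ x

/-- `K(μ_{p^∞})`. -/
def Kinf (K : IntermediateField ℚ_[p] (PadicAlgCl p)) : IntermediateField ℚ_[p] (PadicAlgCl p) :=
  K ⊔ IntermediateField.adjoin ℚ_[p] {x | ∃ n : ℕ, x ^ p ^ n = 1}

/-- `H_K`, the absolute Galois group of `K(μ_{p^∞})`. -/
def HK (K : IntermediateField ℚ_[p] (PadicAlgCl p)) : Subgroup (GQp p) :=
  (Kinf K).fixingSubgroup

variable {K : IntermediateField ℚ_[p] (PadicAlgCl p)}

theorem HK.apply_zeta (σ : HK K) (z : RootSystem p) (n : ℕ) : σ.1 (z.zeta n) = z.zeta n := by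
  have h : z.zeta n ∈ Kinf K := by
    refine (le_sup_right : _ ≤ Kinf K) (IntermediateField.subset_adjoin _ _ ⟨n, ?_⟩)
    exact (z.isPrimitiveRoot n).pow_eq_one
  exact (IntermediateField.mem_fixingSubgroup_iff _ _).1 σ.2 _ h

theorem HK.apply_varpi (σ : HK K) (z : RootSystem p) : galOCflat p σ.1 (varpi z) = varpi z := by
  rw [varpi, map_sub, map_one]
  congr 1
  refine Perfection.ext fun n => ?_
  refine (coeff_galOCflat σ.1 n _ (z.zetaInt n) rfl).trans ?_
  change _ = Ideal.Quotient.mk _ (z.zetaInt n)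
  congr 1
  refine Subtype.ext ((galC_coe σ.1 _).trans ?_)
  rw [HK.apply_zeta]; rfl

theorem HK.apply_varpiRoot (σ : HK K) (z : RootSystem p) (r : Radius p) :
    galOCflat p σ.1 (varpiRoot z r) = varpiRoot z r := by
  rw [varpiRoot, map_pow, RingHom.map_iterate_frobeniusEquiv_symm, HK.apply_varpi]

/-- The action on `A_inf = W(O_C♭)`. -/
def galAinf (σ : GQp p) : Ainf p →+* Ainf p := WittVector.map (galOCflat p σ)
/-- The action on `Ã = W(C♭)`. -/
def galAtilde (σ : GQp p) : Atilde p →+* Atilde p := WittVector.map (galCflat σ)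

theorem galAtilde_algebraMap (σ : GQp p) (x : Ainf p) :
    galAtilde σ (algebraMap _ _ x) = algebraMap _ _ (galAinf σ x) := by
  ext n
  exact galCflat_algebraMap σ _

theorem galAinf_algebraMap (σ : GQp p) (x : ℤ_[p]) :
    galAinf σ (algebraMap ℤ_[p] (Ainf p) x) = algebraMap ℤ_[p] (Ainf p) x := by
  ext n
  change galOCflat p σ (ZMod.castHom (dvd_refl p) (OCflat p) _) = ZMod.castHom (dvd_refl p) (OCflat p) _
  rw [← RingHom.comp_apply]
  congr 1
  exact Subsingleton.elim _ _

theorem HK.galAinf_lam (σ : HK K) (z : RootSystem p) (a : Lam z) :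
    galAinf σ.1 (algebraMap (Lam z) (Ainf p) a) = algebraMap (Lam z) (Ainf p) a := by
  obtain ⟨a, ha⟩ := a
  change galAinf σ.1 a = a
  induction ha using Algebra.adjoin_induction with
  | mem x hx =>
    rw [Set.mem_singleton_iff.1 hx, teichVarpi, galAinf, WittVector.map_teichmuller, HK.apply_varpi]
  | algebraMap r => exact galAinf_algebraMap _ r
  | add x y _ _ hx hy => rw [map_add, hx, hy]
  | mul x y _ _ hx hy => rw [map_mul, hx, hy]

/-- The action of `H_K` on `A_inf`; it is linear because `H_K` fixes `[ϖ]`. -/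
def HK.galAinfLin (z : RootSystem p) (σ : HK K) : Ainf p →ₗ[Lam z] Ainf p where
  toFun := galAinf σ.1
  map_add' := map_add _
  map_smul' a x := by
    rw [Algebra.smul_def, map_mul, HK.galAinf_lam, Algebra.smul_def]; rfl

theorem teichCoord_gal (σ : GQp p) (x : Atilde p) (k : ℕ) :
    teichCoord (galAtilde σ x) k = galCflat σ (teichCoord x k) := by
  apply pow_p_pow_inj k
  rw [teichCoord_pow, ← map_pow, teichCoord_pow]; rfl

theorem HK.dvdBy (σ : HK K) {b b' a a' : OCflat p} {x : Atilde p} {k : ℕ}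
    (hb : galOCflat p σ.1 b = b') (ha : galOCflat p σ.1 a = a')
    (h : DvdBy b (teichCoord x k * algebraMap _ _ a)) :
    DvdBy b' (teichCoord (galAtilde σ.1 x) k * algebraMap _ _ a') := by
  obtain ⟨c, hc⟩ := h
  refine ⟨galOCflat p σ.1 c, ?_⟩
  rw [teichCoord_gal, ← ha, ← hb, ← map_mul, ← galCflat_algebraMap, ← galCflat_algebraMap, ← hc, map_mul]

instance (z : RootSystem p) (r : Radius p) : Module (Lam z) (circBase z r) :=
  Submodule.module' (circBase z r)
instance (z : RootSystem p) (r : Radius p) : Module ℤ_[p] (circBase z r) :=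
  Submodule.module' (circBase z r)
instance (z : RootSystem p) (r : Radius p) : IsScalarTower ℤ_[p] (Lam z) (circBase z r) :=
  ⟨fun a b x => Subtype.ext (smul_assoc a b x.1)⟩

/-- The action of `H_K` on `Ã^{(0,r],◦}`. -/
def HK.galCircLin (z : RootSystem p) (r : Radius p) (σ : HK K) :
    circBase z r →ₗ[Lam z] circBase z r where
  toFun x := ⟨galAtilde σ.1 x, by
    have hr : ∀ k, galOCflat p σ.1 (varpiRoot z r ^ k) = varpiRoot z r ^ k := fun k => by
      rw [map_pow, HK.apply_varpiRoot]
    refine ⟨fun k => HK.dvdBy σ (map_one _) (hr k) (x.2.1 k), fun m => ?_⟩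
    obtain ⟨J, hJ⟩ := x.2.2 m
    exact ⟨J, fun k hk => HK.dvdBy σ (by rw [map_pow, HK.apply_varpi]) (hr k) (hJ k hk)⟩⟩
  map_add' x y := Subtype.ext (map_add _ _ _)
  map_smul' a x := Subtype.ext (by
    change galAtilde σ.1 (algebraMap _ _ (algebraMap (Lam z) (Ainf p) a) * x.1) =
      algebraMap _ _ (algebraMap (Lam z) (Ainf p) a) * galAtilde σ.1 x.1
    rw [map_mul, galAtilde_algebraMap, HK.galAinf_lam])

theorem galAinf_span_le (σ : GQp p) (a : ℕ) :
    Ideal.span {(p : Ainf p) ^ a} ≤ (Ideal.span {(p : Ainf p) ^ a}).comap (galAinf σ) := by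
  rw [Ideal.span_singleton_le_iff_mem, Ideal.mem_comap, map_pow, map_natCast]
  exact Ideal.mem_span_singleton_self _

variable (p) in
/-- `W_a(O_C♭) = W(O_C♭) / p ^ a`. -/
abbrev Wa (a : ℕ) : Type := Ainf p ⧸ Ideal.span {(p : Ainf p) ^ a}

instance (z : RootSystem p) (a : ℕ) : Module (Lam z) (Wa p a) :=
  Submodule.Quotient.module' _
instance (a : ℕ) : Module ℤ_[p] (Wa p a) :=
  Submodule.Quotient.module' _
instance (z : RootSystem p) (a : ℕ) : IsScalarTower ℤ_[p] (Lam z) (Wa p a) :=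
  Submodule.Quotient.isScalarTower _ _

/-- The action of `H_K` on `W_a(O_C♭)`. -/
def HK.galWaLin (z : RootSystem p) (a : ℕ) (σ : HK K) : Wa p a →ₗ[Lam z] Wa p a where
  toFun := Ideal.quotientMap _ (galAinf σ.1) (galAinf_span_le σ.1 a)
  map_add' := map_add _
  map_smul' c x := by
    obtain ⟨x, rfl⟩ := Ideal.Quotient.mk_surjective x
    exact congrArg (Ideal.Quotient.mk _) ((HK.galAinfLin z σ).map_smul c x)

/-- The projection `W_{a+1}(O_C♭) → W_a(O_C♭)`. -/
def waTrans (z : RootSystem p) (a : ℕ) : Wa p (a + 1) →ₗ[Lam z] Wa p a :=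
  (Submodule.factor (Ideal.span_singleton_le_span_singleton.2
    (pow_dvd_pow (p : Ainf p) a.le_succ))).restrictScalars _

theorem waTrans_gal (z : RootSystem p) (a : ℕ) (σ : HK K) :
    HK.galWaLin z a σ ∘ₗ waTrans z a = waTrans z a ∘ₗ HK.galWaLin z (a + 1) σ := by
  refine LinearMap.ext fun x => ?_
  obtain ⟨x, rfl⟩ := Ideal.Quotient.mk_surjective x
  change Ideal.quotientMap _ (galAinf σ.1) (galAinf_span_le σ.1 a) (Ideal.Quotient.mk _ x) =
    (Ideal.Quotient.mk _ (galAinf σ.1 x) : Wa p a)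
  rw [Ideal.quotientMap_mk]

section Localization

variable {R : Type*} [CommRing R] (t : R)

/-- The localization `M[1/t]`. -/
def Loc (M : Type*) [AddCommGroup M] [Module R M] : Type _ :=
  LocalizedModule (Submonoid.powers t) M

variable (M M' M'' : Type*) [AddCommGroup M] [Module R M] [AddCommGroup M'] [Module R M']
  [AddCommGroup M''] [Module R M'']

instance : AddCommGroup (Loc t M) :=
  inferInstanceAs (AddCommGroup (LocalizedModule (Submonoid.powers t) M))

instance : Module R (Loc t M) :=
  inferInstanceAs (Module R (LocalizedModule (Submonoid.powers t) M))

variable {M M' M''}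

/-- The fraction `m / t ^ n`. -/
def Loc.frac (n : ℕ) (m : M) : Loc t M :=
  LocalizedModule.mk m (⟨t ^ n, n, rfl⟩ : Submonoid.powers t)

/-- The direct limit topology on `M[1/t] = colim (M → M → ⋯)`, with multiplication by `t` as
transition maps. -/
instance [TopologicalSpace M] : TopologicalSpace (Loc t M) :=
  ⨆ n : ℕ, TopologicalSpace.coinduced (Loc.frac t n) inferInstance

def Loc.map (f : M →ₗ[R] M') : Loc t M →ₗ[R] Loc t M' :=
  IsLocalizedModule.map (Submonoid.powers t) (LocalizedModule.mkLinearMap _ M)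
    (LocalizedModule.mkLinearMap _ M') f

/-- Division by `t ^ n` on `M[1/t]`. -/
def Loc.divPow (n : ℕ) : Loc t M →ₗ[R] Loc t M :=
  LocalizedModule.divBy (⟨t ^ n, n, rfl⟩ : Submonoid.powers t)

theorem Loc.exists_frac (x : Loc t M) : ∃ n m, x = Loc.frac t n m := by
  obtain ⟨m, ⟨_, n, rfl⟩, h⟩ : ∃ m s, x = LocalizedModule.mk m s := by
    induction x using LocalizedModule.induction_on with
    | h m s => exact ⟨m, s, rfl⟩
  exact ⟨n, m, h⟩

theorem Loc.map_frac (f : M →ₗ[R] M') (n : ℕ) (m : M) :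
    Loc.map t f (Loc.frac t n m) = Loc.frac t n (f m) :=
  IsLocalizedModule.map_LocalizedModules (Submonoid.powers t) f m _

theorem Loc.divPow_frac (n k : ℕ) (m : M) :
    Loc.divPow t k (Loc.frac t n m) = Loc.frac t (n + k) m := by
  refine (LocalizedModule.divBy_apply _ _).trans ?_
  rw [Loc.frac, LocalizedModule.liftOn_mk]
  congr 1
  exact Subtype.ext (pow_add t n k).symm

theorem Loc.frac_smul (n k : ℕ) (m : M) : Loc.frac t (n + k) (t ^ k • m) = Loc.frac t n m := by
  refine LocalizedModule.mk_eq.2 ⟨1, ?_⟩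
  simp only [one_smul, Submonoid.smul_def, smul_smul, pow_add]

theorem Loc.map_map (g : M' →ₗ[R] M'') (f : M →ₗ[R] M') (x : Loc t M) :
    Loc.map t g (Loc.map t f x) = Loc.map t (g ∘ₗ f) x := by
  obtain ⟨n, m, rfl⟩ := Loc.exists_frac t x
  simp only [Loc.map_frac, LinearMap.comp_apply]

theorem Loc.map_comp_map (g : M' →ₗ[R] M'') (f : M →ₗ[R] M') :
    Loc.map t g ∘ₗ Loc.map t f = Loc.map t (g ∘ₗ f) :=
  LinearMap.ext fun x => Loc.map_map t g f x

end Localization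

section InverseLimit

variable {R : Type*} [CommRing R] {N N' : ℕ → Type*} [∀ a, AddCommGroup (N a)]
  [∀ a, Module R (N a)] [∀ a, AddCommGroup (N' a)] [∀ a, Module R (N' a)]

/-- The inverse limit of a tower `⋯ → N 2 → N 1 → N 0`. As a submodule of the product, it carries
the inverse limit topology. -/
def InvLim (q : ∀ a, N (a + 1) →ₗ[R] N a) : Submodule R (∀ a, N a) where
  carrier := {x | ∀ a, q a (x (a + 1)) = x a}
  zero_mem' a := by simp
  add_mem' hx hy a := by simp [hx a, hy a]
  smul_mem' c x hx a := by simp [hx a]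

def InvLim.proj (q : ∀ a, N (a + 1) →ₗ[R] N a) (a : ℕ) : InvLim q →ₗ[R] N a :=
  LinearMap.proj a ∘ₗ (InvLim q).subtype

def InvLim.map {q : ∀ a, N (a + 1) →ₗ[R] N a} {q' : ∀ a, N' (a + 1) →ₗ[R] N' a}
    (g : ∀ a, N a →ₗ[R] N' a) (h : ∀ a, g a ∘ₗ q a = q' a ∘ₗ g (a + 1)) :
    InvLim q →ₗ[R] InvLim q' where
  toFun x := ⟨fun a => g a (x.1 a), fun a => by
    rw [← LinearMap.comp_apply, ← h, LinearMap.comp_apply, x.2 a]⟩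
  map_add' x y := Subtype.ext (funext fun a => map_add _ _ _)
  map_smul' c x := Subtype.ext (funext fun a => map_smul _ _ _)

def InvLim.lift {q : ∀ a, N (a + 1) →ₗ[R] N a} {M : Type*} [AddCommGroup M] [Module R M]
    (g : ∀ a, M →ₗ[R] N a) (h : ∀ a, q a ∘ₗ g (a + 1) = g a) : M →ₗ[R] InvLim q :=
  (LinearMap.pi g).codRestrict _ fun x a => LinearMap.congr_fun (h a) x

theorem InvLim.comp_proj (q : ∀ a, N (a + 1) →ₗ[R] N a) (a : ℕ) :
    q a ∘ₗ InvLim.proj q (a + 1) = InvLim.proj q a :=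
  LinearMap.ext fun x => x.2 a

end InverseLimit

section Invariants

variable {R M G : Type*} [CommRing R] [AddCommGroup M] [Module R M]

/-- The elements fixed by a family of operators. -/
def invariants (act : G → M →ₗ[R] M) : Submodule R M where
  carrier := {x | ∀ g, act g x = x}
  zero_mem' g := map_zero _
  add_mem' hx hy g := by rw [map_add, hx g, hy g]
  smul_mem' c x hx g := by rw [map_smul, hx g]

end Invariants

section ComplTensor

variable {Z R : Type*} [CommRing Z] [CommRing R] [Algebra Z R] (t : R)
variable (M : Type*) [AddCommGroup M] [Module R M] [Module Z M] [IsScalarTower Z R M]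
variable (M' : Type*) [AddCommGroup M'] [Module R M'] [Module Z M'] [IsScalarTower Z R M']
variable (M'' : Type*) [AddCommGroup M''] [Module R M''] [Module Z M''] [IsScalarTower Z R M'']
variable (A A' A'' : Type*) [AddCommGroup A] [Module Z A] [AddCommGroup A'] [Module Z A']
  [AddCommGroup A''] [Module Z A'']

variable (Z) in
/-- The `t`-adic completion of `M ⊗ A`, i.e. `lim_i (M ⊗_Z A) / t ^ i`. -/
def ComplTensor : Type _ := AdicCompletion (Ideal.span {t}) (M ⊗[Z] A)

instance : AddCommGroup (ComplTensor Z t M A) :=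
  inferInstanceAs (AddCommGroup (AdicCompletion (Ideal.span {t}) (M ⊗[Z] A)))

instance : Module (R) (ComplTensor Z t M A) :=
  inferInstanceAs (Module (R) (AdicCompletion (Ideal.span {t}) (M ⊗[Z] A)))

/-- The inverse limit topology, with `(M ⊗_Z A) / t ^ i` discrete. -/
instance : TopologicalSpace (ComplTensor Z t M A) :=
  ⨅ i : ℕ, TopologicalSpace.induced
    (AdicCompletion.eval (Ideal.span {t}) (M ⊗[Z] A) i) ⊥

variable {M M' M'' A A' A''}

/-- Functoriality of the completed tensor product. -/
def ComplTensor.map (u : M →ₗ[R] M') (f : A →ₗ[Z] A') :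
    ComplTensor Z t M A →ₗ[R] ComplTensor Z t M' A' :=
  (AdicCompletion.map (Ideal.span {t})
    (TensorProduct.AlgebraTensorModule.map u f)).restrictScalars (R)

theorem ComplTensor.map_comp_map (u' : M' →ₗ[R] M'') (u : M →ₗ[R] M')
    (f' : A' →ₗ[Z] A'') (f : A →ₗ[Z] A') :
    ComplTensor.map t u' f' ∘ₗ ComplTensor.map t u f =
      ComplTensor.map t (u' ∘ₗ u) (f' ∘ₗ f) := by
  have h := TensorProduct.AlgebraTensorModule.map_comp u' u f' f
  refine LinearMap.ext fun x => ?_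
  refine (AdicCompletion.map_comp_apply (Ideal.span {t}) _ _ x).trans ?_
  exact congrArg (fun g => AdicCompletion.map (Ideal.span {t}) g x) h.symm

theorem ComplTensor.map_smul_left (c : R) (u : M →ₗ[R] M') (f : A →ₗ[Z] A')
    (x : ComplTensor Z t M A) : ComplTensor.map t (c • u) f x = c • ComplTensor.map t u f x := by
  refine AdicCompletion.ext fun n => ?_
  obtain ⟨y, hy⟩ := Submodule.mkQ_surjective _ (x.val n)
  change LinearMap.reduceModIdeal _ (TensorProduct.AlgebraTensorModule.map (c • u) f) (x.val n) =
    c • LinearMap.reduceModIdeal _ (TensorProduct.AlgebraTensorModule.map u f) (x.val n)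
  rw [← hy, TensorProduct.AlgebraTensorModule.map_smul_left]
  rfl

end ComplTensor

section ModNat

variable (n : ℕ) (R M : Type*) [CommRing R] [AddCommGroup M] [Module R M]

/-- `M / n M`. -/
abbrev ModNat : Type _ := M ⧸ (Ideal.span {(n : R)} • ⊤ : Submodule R M)

end ModNat

section Rings

variable (z : RootSystem p) (r : Radius p)
variable (A A' : Type*) [AddCommGroup A] [Module ℤ_[p] A] [AddCommGroup A'] [Module ℤ_[p] A']

/-- `W_a(O_C♭)_A = lim_i (W_a(O_C♭) ⊗ A) / [ϖ] ^ i`. -/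
abbrev WaA (a : ℕ) : Type _ := ComplTensor ℤ_[p] (lamVarpi z) (Wa p a) A

def waATrans (a : ℕ) : WaA z A (a + 1) →ₗ[Lam z] WaA z A a :=
  ComplTensor.map (lamVarpi z) (waTrans z a) LinearMap.id

theorem waATrans_comm {A A' : Type*} [AddCommGroup A] [Module ℤ_[p] A] [AddCommGroup A']
    [Module ℤ_[p] A'] (u : ∀ a, Wa p a →ₗ[Lam z] Wa p a)
    (hu : ∀ a, u a ∘ₗ waTrans z a = waTrans z a ∘ₗ u (a + 1)) (f : A →ₗ[ℤ_[p]] A') (a : ℕ) :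
    ComplTensor.map (lamVarpi z) (u a) f ∘ₗ waATrans z A a =
      waATrans z A' a ∘ₗ ComplTensor.map (lamVarpi z) (u (a + 1)) f := by
  rw [waATrans, waATrans, ComplTensor.map_comp_map, ComplTensor.map_comp_map, hu,
    LinearMap.comp_id, LinearMap.id_comp]

/-- `W_a(O_C♭)_A[1/[ϖ]]`. -/
abbrev LocWaA (a : ℕ) : Type _ := Loc (lamVarpi z) (WaA z A a)

def tildeTrans (a : ℕ) : LocWaA z A (a + 1) →ₗ[Lam z] LocWaA z A a :=
  Loc.map (lamVarpi z) (waATrans z A a)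

/-- `Ã^{(0,∞),◦}_A = lim_a W_a(O_C♭)_A`. -/
def PlusA : Type _ := InvLim (N := WaA z A) (waATrans z A)

instance : AddCommGroup (PlusA z A) := inferInstanceAs (AddCommGroup (InvLim (N := WaA z A) (waATrans z A)))
instance : Module (Lam z) (PlusA z A) := inferInstanceAs (Module (Lam z) (InvLim (N := WaA z A) (waATrans z A)))
instance : TopologicalSpace (PlusA z A) :=
  inferInstanceAs (TopologicalSpace (InvLim (N := WaA z A) (waATrans z A)))

/-- `Ã^{(0,∞)}_A = Ã^{(0,∞),◦}_A[1/[ϖ]]`. -/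
def TildeInf : Type _ := Loc (lamVarpi z) (PlusA z A)

instance : AddCommGroup (TildeInf z A) :=
  inferInstanceAs (AddCommGroup (Loc (lamVarpi z) (PlusA z A)))
instance : Module (Lam z) (TildeInf z A) :=
  inferInstanceAs (Module (Lam z) (Loc (lamVarpi z) (PlusA z A)))
instance : TopologicalSpace (TildeInf z A) :=
  inferInstanceAs (TopologicalSpace (Loc (lamVarpi z) (PlusA z A)))

/-- `Ã_A = lim_a W_a(O_C♭)_A[1/[ϖ]]`. -/
def Tilde : Type _ := InvLim (N := LocWaA z A) (tildeTrans z A)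

instance : AddCommGroup (Tilde z A) := inferInstanceAs (AddCommGroup (InvLim (N := LocWaA z A) (tildeTrans z A)))
instance : Module (Lam z) (Tilde z A) :=
  inferInstanceAs (Module (Lam z) (InvLim (N := LocWaA z A) (tildeTrans z A)))
instance : TopologicalSpace (Tilde z A) :=
  inferInstanceAs (TopologicalSpace (InvLim (N := LocWaA z A) (tildeTrans z A)))

/-- `Ã^{(0,r],◦}_A = lim_i (Ã^{(0,r],◦} ⊗ A) / [ϖ] ^ i`. -/
abbrev CircA : Type _ := ComplTensor ℤ_[p] (lamVarpi z) (circBase z r) A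

/-- `Ã^{(0,r]}_A = Ã^{(0,r],◦}_A[1/[ϖ]]`. -/
def TildeR : Type _ := Loc (lamVarpi z) (CircA z r A)

instance : AddCommGroup (TildeR z r A) :=
  inferInstanceAs (AddCommGroup (Loc (lamVarpi z) (CircA z r A)))
instance : Module (Lam z) (TildeR z r A) :=
  inferInstanceAs (Module (Lam z) (Loc (lamVarpi z) (CircA z r A)))
instance : TopologicalSpace (TildeR z r A) :=
  inferInstanceAs (TopologicalSpace (Loc (lamVarpi z) (CircA z r A)))

variable {A A'}
def Tilde.map (u : ∀ a, Wa p a →ₗ[Lam z] Wa p a)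
    (hu : ∀ a, u a ∘ₗ waTrans z a = waTrans z a ∘ₗ u (a + 1)) (f : A →ₗ[ℤ_[p]] A') :
    Tilde z A →ₗ[Lam z] Tilde z A' :=
  InvLim.map (N := LocWaA z A) (N' := LocWaA z A') (q := tildeTrans z A) (q' := tildeTrans z A')
    (fun a => Loc.map (lamVarpi z) (ComplTensor.map (lamVarpi z) (u a) f)) fun a => by
      rw [tildeTrans, tildeTrans, Loc.map_comp_map, Loc.map_comp_map, waATrans_comm z u hu]

/-- The map `Ã_A → Ã_A'` induced by `A → A'`. -/
def Tilde.reduce (f : A →ₗ[ℤ_[p]] A') : Tilde z A →ₗ[Lam z] Tilde z A' :=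
  Tilde.map z (fun _ => LinearMap.id)
    (fun a => (LinearMap.id_comp (waTrans z a)).trans (LinearMap.comp_id (waTrans z a)).symm) f

variable (A)
/-- The action of `H_K` on `Ã_A`, trivial on `A`. -/
def Tilde.gal (σ : HK K) : Tilde z A →ₗ[Lam z] Tilde z A :=
  Tilde.map z (fun a => HK.galWaLin z a σ) (fun a => waTrans_gal z a σ) LinearMap.id

def PlusA.gal (σ : HK K) : PlusA z A →ₗ[Lam z] PlusA z A :=
  InvLim.map (N := WaA z A) (N' := WaA z A) (q := waATrans z A) (q' := waATrans z A)
    (fun a => ComplTensor.map (lamVarpi z) (HK.galWaLin z a σ) LinearMap.id)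
    (waATrans_comm z (fun a => HK.galWaLin z a σ) (fun a => waTrans_gal z a σ) LinearMap.id)

/-- The action of `H_K` on `Ã^{(0,∞)}_A`, trivial on `A`. -/
def TildeInf.gal (σ : HK K) : TildeInf z A →ₗ[Lam z] TildeInf z A :=
  Loc.map (lamVarpi z) (PlusA.gal z A σ)

/-- The action of `H_K` on `Ã^{(0,r]}_A`, trivial on `A`. -/
def TildeR.gal (σ : HK K) : TildeR z r A →ₗ[Lam z] TildeR z r A :=
  Loc.map (lamVarpi z) (ComplTensor.map (lamVarpi z) (HK.galCircLin z r σ) LinearMap.id)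

variable (K)
/-- `Ã_{K,A}`, the `H_K`-invariants of `Ã_A`. -/
def TildeK : Type _ := invariants (G := HK K) (Tilde.gal z A)

instance : AddCommGroup (TildeK K z A) :=
  inferInstanceAs (AddCommGroup (invariants (G := HK K) (Tilde.gal z A)))
instance : Module (Lam z) (TildeK K z A) :=
  inferInstanceAs (Module (Lam z) (invariants (G := HK K) (Tilde.gal z A)))
instance : TopologicalSpace (TildeK K z A) :=
  inferInstanceAs (TopologicalSpace (invariants (G := HK K) (Tilde.gal z A)))

def TildeK.incl : TildeK K z A →ₗ[Lam z] Tilde z A :=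
  (invariants (G := HK K) (Tilde.gal z A)).subtype

/-- `Ã^{(0,∞)}_{K,A}`, the `H_K`-invariants of `Ã^{(0,∞)}_A`. -/
def TildeInfK : Type _ := invariants (G := HK K) (TildeInf.gal z A)

instance : AddCommGroup (TildeInfK K z A) :=
  inferInstanceAs (AddCommGroup (invariants (G := HK K) (TildeInf.gal z A)))
instance : Module (Lam z) (TildeInfK K z A) :=
  inferInstanceAs (Module (Lam z) (invariants (G := HK K) (TildeInf.gal z A)))
instance : TopologicalSpace (TildeInfK K z A) :=
  inferInstanceAs (TopologicalSpace (invariants (G := HK K) (TildeInf.gal z A)))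

def TildeInfK.incl : TildeInfK K z A →ₗ[Lam z] TildeInf z A :=
  (invariants (G := HK K) (TildeInf.gal z A)).subtype

/-- `Ã^{(0,r]}_{K,A}`, the `H_K`-invariants of `Ã^{(0,r]}_A`. -/
def TildeRK : Type _ := invariants (G := HK K) (TildeR.gal z r A)

instance : AddCommGroup (TildeRK K z r A) :=
  inferInstanceAs (AddCommGroup (invariants (G := HK K) (TildeR.gal z r A)))
instance : Module (Lam z) (TildeRK K z r A) :=
  inferInstanceAs (Module (Lam z) (invariants (G := HK K) (TildeR.gal z r A)))
instance : TopologicalSpace (TildeRK K z r A) :=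
  inferInstanceAs (TopologicalSpace (invariants (G := HK K) (TildeR.gal z r A)))

def TildeRK.incl : TildeRK K z r A →ₗ[Lam z] TildeR z r A :=
  (invariants (G := HK K) (TildeR.gal z r A)).subtype

variable {K}

def TildeInf.proj (a : ℕ) : TildeInf z A →ₗ[Lam z] LocWaA z A a :=
  Loc.map (lamVarpi z) (InvLim.proj (N := WaA z A) (waATrans z A) a)

theorem TildeInf.comp_proj (a : ℕ) :
    tildeTrans z A a ∘ₗ TildeInf.proj z A (a + 1) = TildeInf.proj z A a :=
  (Loc.map_comp_map (lamVarpi z) (waATrans z A a)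
    (InvLim.proj (N := WaA z A) (waATrans z A) (a + 1))).trans
    (congrArg (Loc.map (lamVarpi z)) (InvLim.comp_proj (N := WaA z A) (waATrans z A) a))

/-- The natural map `Ã^{(0,∞)}_A → Ã_A`, induced by the projections of
`lim_a W_a(O_C♭)_A` to `W_a(O_C♭)_A`. -/
def TildeInf.toTilde : TildeInf z A →ₗ[Lam z] Tilde z A :=
  InvLim.lift (N := LocWaA z A) (TildeInf.proj z A) (TildeInf.comp_proj z A)

/-- `u ∈ A_inf` is congruent modulo `p ^ a` to `[ϖ] ^ (a m) x`, where `m` is the numerator of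
`1 / r`. -/
def IsIntLift (a : ℕ) (x : Atilde p) (u : Ainf p) : Prop :=
  ∀ k < a, (algebraMap (Ainf p) (Atilde p) (teichVarpi z ^ (a * r.num)) * x).coeff k =
    (algebraMap (Ainf p) (Atilde p) u).coeff k

variable {z r}
theorem exists_isIntLift (a : ℕ) (x : circBase z r) : ∃ u, IsIntLift z r a x u := by
  have h := (exists_truncate_iff a (varpi z ^ (a * r.num)) 1 x.1).2 fun k hk => by
    have hd : varpiRoot z r ^ k ∣ varpi z ^ (a * r.num) := by
      refine (pow_dvd_pow_of_dvd (varpiRoot_dvd z r) k).trans ?_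
      rw [← pow_mul, mul_comm]
      exact pow_dvd_pow _ (Nat.mul_le_mul_right _ hk.le)
    obtain ⟨d, hd⟩ := hd
    rw [hd, map_mul, ← mul_assoc]
    exact (x.2.1 k).mul _ (one_dvd _)
  obtain ⟨u, hu⟩ := h
  refine ⟨u, fun k hk => ?_⟩
  rw [teichVarpi, ← map_pow, hu k hk, map_one, one_mul]

theorem IsIntLift.mk_eq {a : ℕ} {x : Atilde p} {u v : Ainf p} (hu : IsIntLift z r a x u)
    (hv : IsIntLift z r a x v) :
    (Ideal.Quotient.mk _ u : Wa p a) = Ideal.Quotient.mk _ v := by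
  rw [Ideal.Quotient.eq, WittVector.mem_span_p_pow_iff_le_coeff_eq_zero,
    ← WittVector.le_coeff_eq_iff_le_sub_coeff_eq_zero]
  intro k hk
  exact IsFractionRing.injective (OCflat p) (Cflat p) ((hu k hk).symm.trans (hv k hk))

theorem IsIntLift.add {a : ℕ} {x y : Atilde p} {u v : Ainf p} (hu : IsIntLift z r a x u)
    (hv : IsIntLift z r a y v) : IsIntLift z r a (x + y) (u + v) := by
  rw [IsIntLift, coeff_lt_iff_truncate] at hu hv ⊢
  rw [mul_add, map_add, map_add, map_add, hu, hv]

theorem IsIntLift.smul {a : ℕ} {x : Atilde p} {u : Ainf p} (c : Ainf p)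
    (hu : IsIntLift z r a x u) : IsIntLift z r a (algebraMap _ _ c * x) (c * u) := by
  rw [IsIntLift, coeff_lt_iff_truncate] at hu ⊢
  rw [mul_left_comm, map_mul (WittVector.truncate a), hu, ← map_mul, ← map_mul]

variable (z r)
/-- The map `x ↦ [ϖ] ^ (a m) x mod p ^ a` from `Ã^{(0,r],◦}` to `W_a(O_C♭)`, where `m` is the
numerator of `1 / r`; the product is integral modulo `p ^ a` since `a m ≥ a / r`. -/
def circToWa (a : ℕ) : circBase z r →ₗ[Lam z] Wa p a where
  toFun x := Ideal.Quotient.mk _ (exists_isIntLift a x).choose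
  map_add' x y := by
    rw [← map_add]
    exact (exists_isIntLift a (x + y)).choose_spec.mk_eq
      ((exists_isIntLift a x).choose_spec.add (exists_isIntLift a y).choose_spec)
  map_smul' c x := (exists_isIntLift a (c • x)).choose_spec.mk_eq
    ((exists_isIntLift a x).choose_spec.smul (algebraMap (Lam z) (Ainf p) c))

theorem waTrans_comp_circToWa (a : ℕ) :
    waTrans z a ∘ₗ circToWa z r (a + 1) = lamVarpi z ^ r.num • circToWa z r a := by
  ext x
  have h1 := (exists_isIntLift (a + 1) x).choose_spec
  have h2 := (exists_isIntLift a x).choose_spec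
  set u := (exists_isIntLift (a + 1) x).choose
  set v := (exists_isIntLift a x).choose
  change (Ideal.Quotient.mk _ u : Wa p a) = Ideal.Quotient.mk _ ((teichVarpi z ^ r.num) * v)
  have h3 := h2.smul (teichVarpi z ^ r.num)
  refine IsIntLift.mk_eq (z := z) (r := r)
    (x := algebraMap _ _ (teichVarpi z ^ r.num) * x.1) ?_ h3
  intro k hk
  rw [← h1 k (by omega), ← mul_assoc, ← map_mul, ← pow_add, Nat.succ_mul]

/-- The map `Ã^{(0,r]}_A → W_a(O_C♭)_A[1/[ϖ]]` extending `x ↦ ([ϖ] ^ (a m) x mod p ^ a) / [ϖ] ^ (a m)`. -/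
def TildeR.proj (a : ℕ) : TildeR z r A →ₗ[Lam z] LocWaA z A a :=
  Loc.divPow (lamVarpi z) (a * r.num) ∘ₗ
    Loc.map (lamVarpi z) (ComplTensor.map (lamVarpi z) (circToWa z r a) LinearMap.id)

theorem TildeR.proj_frac (a n : ℕ) (m : CircA z r A) :
    TildeR.proj z r A a (Loc.frac (lamVarpi z) n m) =
      Loc.frac (lamVarpi z) (n + a * r.num) (ComplTensor.map (lamVarpi z) (circToWa z r a) LinearMap.id m) :=
  (congrArg (Loc.divPow (lamVarpi z) (a * r.num))
    (Loc.map_frac (lamVarpi z) (ComplTensor.map (lamVarpi z) (circToWa z r a) LinearMap.id) n m)).trans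
    (Loc.divPow_frac _ _ _ _)

theorem TildeR.comp_proj (a : ℕ) :
    tildeTrans z A a ∘ₗ TildeR.proj z r A (a + 1) = TildeR.proj z r A a := by
  refine LinearMap.ext fun x => ?_
  obtain ⟨n, m, rfl⟩ := Loc.exists_frac (lamVarpi z) x
  have h : waATrans z A a (ComplTensor.map (lamVarpi z) (circToWa z r (a + 1)) LinearMap.id m) =
      lamVarpi z ^ r.num • ComplTensor.map (lamVarpi z) (circToWa z r a) LinearMap.id m := by
    rw [waATrans, ← LinearMap.comp_apply, ComplTensor.map_comp_map, waTrans_comp_circToWa,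
      LinearMap.comp_id, ComplTensor.map_smul_left]
  refine (congrArg (tildeTrans z A a) (TildeR.proj_frac z r A (a + 1) n m)).trans
    (Eq.trans ?_ (TildeR.proj_frac z r A a n m).symm)
  rw [tildeTrans, Loc.map_frac, h, Nat.succ_mul, ← add_assoc, Loc.frac_smul]

/-- The natural map `Ã^{(0,r]}_A → Ã_A`, induced by the inclusion of `Ã^{(0,r],◦}` in `Ã`. -/
def TildeR.toTilde : TildeR z r A →ₗ[Lam z] Tilde z A :=
  InvLim.lift (N := LocWaA z A) (TildeR.proj z r A) (TildeR.comp_proj z r A)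

end Rings

end PerfectPeriods

end

open PerfectPeriods

/-!
No Galois cohomology enters, because `H_K` acts trivially on the coefficients. By Kulikov's theorem
(`nonempty_basicSystem`) the module `A` has a family `(e_i)` that decomposes every `A / p ^ a` as
the direct sum of the cyclic modules `ℤ / p ^ min(a, n_i)` generated by the `e_i`. It follows that
`W_a(O_C♭) ⊗ A` is the direct sum of the rings `W_{min(a, n_i)}(O_C♭)`. These rings are
`[ϖ]`-adically complete, so that an element of `W_a(O_C♭)_A[1/[ϖ]]` is the same thing as a family of
coordinates `w_i ∈ W_{min(a, n_i)}(C♭)` with a common denominator, tending to zero for the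
`[ϖ]`-adic topology (`coord_ext`, `exists_coord_eq`, `isNull_coord`). In the limit over `a`, an
element of `Ã_A` is given by Witt vectors `w_i ∈ W_{n_i}(C♭)`, and it is invariant under `H_K` if
and only if all `w_i` are.

The map `e₁` is then studied on coordinates. The images of the `e_i` form a basic system of
`A / p ^ N`, with `n_i` replaced by `min(N, n_i)`. To lift an element, extend the Witt components of
its coordinates by zero, which preserves invariance and smallness, so that the map
`Ã_{K,A} → Ã_{K,A/p^N}` is surjective and open (`exists_lift`, `TildeK.isOpenMap_reduce`). An
element which vanishes with coefficients `A / p ^ N` has coordinates divisible by `p ^ N`, and the quotients are again the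
coordinates of an invariant element (`exists_eq_nsmul`). So the kernel is `p ^ N Ã_{K,A}`, and `e₁`
is an isomorphism of topological modules (`TildeK.reduceEquiv`).

For `e₂` and `e₃` let `A` be killed by `p ^ N`. The limits over `a` that define `Ã_A` and
`Ã^{(0,∞)}_A` are then attained at `a = N`, which makes `j_∞` a homeomorphism. For `j_r`, write `m`
for the numerator of `1 / r`; the maps `Ã^{(0,r],◦} ⊗ A → W_N(O_C♭) ⊗ A` given by
`x ↦ [ϖ] ^ (N m) x` and its counterpart induced by `A_inf ⊆ Ã^{(0,r],◦}` are inverse to each other up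
to a power of `[ϖ]`, because division by `p ^ N` in `Ã^{(0,r],◦}` costs at most `[ϖ] ^ (N m)`
(`mem_circBase_of_mul_p_pow`). After completion and inversion of `[ϖ]` they become homeomorphisms
(`Loc.isHomeomorph_map_complTensor`). Both `j_r` and `j_∞` commute with `H_K`, so they induce
homeomorphisms on invariants (`tildeRKEquiv`, `tildeInfKEquiv`), from which `e₂` and `e₃` are
composed.
-/

noncomputable section
open scoped TensorProduct
namespace PerfectPeriods

/-! ### Adic topologies and inverting `t` -/

section AdicTopology

variable {R : Type*} [CommRing R] {t : R}
variable {M M' L L' : Type*} [AddCommGroup M] [Module R M] [AddCommGroup M'] [Module R M']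
  [AddCommGroup L] [Module R L] [AddCommGroup L'] [Module R L']

theorem mem_span_pow_smul_top (t : R) (j : ℕ) (x : M) :
    x ∈ (Ideal.span {t} ^ j • ⊤ : Submodule R M) ↔ ∃ m, x = t ^ j • m := by
  rw [Ideal.span_singleton_pow, Submodule.ideal_span_singleton_smul,
    Submodule.mem_smul_pointwise_iff_exists]
  exact ⟨fun ⟨m, _, h⟩ => ⟨m, h.symm⟩, fun ⟨m, h⟩ => ⟨m, trivial, h.symm⟩⟩

/-- The topology of `L` is the group topology in which the subgroups `ι (t ^ j M)` form a basis of
neighbourhoods of `0`. With `ι` the identity this is the `t`-adic topology. -/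
def AdicVia (t : R) (ι : M →ₗ[R] L) [TopologicalSpace L] : Prop :=
  ∀ U : Set L, IsOpen U ↔ ∀ x ∈ U, ∃ j : ℕ, ∀ m : M, x + ι (t ^ j • m) ∈ U

theorem AdicVia.continuous [TopologicalSpace L] [TopologicalSpace L'] {ι : M →ₗ[R] L}
    {ι' : M' →ₗ[R] L'} (h : AdicVia t ι) (h' : AdicVia t ι') (F : L →ₗ[R] L') (c : ℕ)
    (hF : ∀ m, ∃ m', F (ι (t ^ c • m)) = ι' m') : Continuous F := by
  refine continuous_def.2 fun U hU => (h _).2 fun x hx => ?_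
  obtain ⟨j, hj⟩ := (h' U).1 hU _ hx
  refine ⟨j + c, fun m => ?_⟩
  obtain ⟨m', hm'⟩ := hF m
  have : F (x + ι (t ^ (j + c) • m)) = F x + ι' (t ^ j • m') := by
    rw [map_add, pow_add, mul_smul, ι.map_smul, F.map_smul, hm', ι'.map_smul]
  rw [Set.mem_preimage, this]
  exact hj m'

theorem AdicVia.isHomeomorph [TopologicalSpace L] [TopologicalSpace L'] {ι : M →ₗ[R] L}
    {ι' : M' →ₗ[R] L'} (h : AdicVia t ι) (h' : AdicVia t ι') (F : L →ₗ[R] L')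
    (hb : Function.Bijective F) (c : ℕ) (hF : ∀ m, ∃ m', F (ι (t ^ c • m)) = ι' m')
    (hF' : ∀ m', ∃ m, F (ι m) = ι' (t ^ c • m')) : IsHomeomorph F := by
  let e := LinearEquiv.ofBijective F hb
  have h2 : Continuous e.symm := h'.continuous h e.symm.toLinearMap c fun m' => by
    obtain ⟨m, hm⟩ := hF' m'
    exact ⟨m, e.symm_apply_eq.2 hm.symm⟩
  exact (Homeomorph.mk e.toEquiv (h.continuous h' F c hF) h2).isHomeomorph

variable (t) in
/-- The map `m ↦ m / t ^ n`, as a linear map. -/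
def Loc.fracLin (n : ℕ) : M →ₗ[R] Loc t M :=
  Loc.divPow t n ∘ₗ LocalizedModule.mkLinearMap (Submonoid.powers t) M

theorem Loc.fracLin_apply (n : ℕ) (m : M) : Loc.fracLin t n m = Loc.frac t n m := by
  have h : LocalizedModule.mkLinearMap (Submonoid.powers t) M m = Loc.frac t 0 m := by
    rw [LocalizedModule.mkLinearMap_apply, Loc.frac]
    congr 1
    exact Subtype.ext (pow_zero t).symm
  refine (congrArg (Loc.divPow t n) h).trans ?_
  rw [Loc.divPow_frac, zero_add]

theorem Loc.frac_eq_zero {n : ℕ} {m : M} : Loc.frac t n m = 0 ↔ ∃ k : ℕ, t ^ k • m = 0 := by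
  let s : Submonoid.powers t := ⟨t ^ n, n, rfl⟩
  change (LocalizedModule.mk m s : LocalizedModule (Submonoid.powers t) M) = 0 ↔ _
  rw [← LocalizedModule.zero_mk (1 : Submonoid.powers t), LocalizedModule.mk_eq]
  constructor
  · rintro ⟨⟨_, k, rfl⟩, h⟩
    exact ⟨k, by simpa [Submonoid.smul_def] using h⟩
  · rintro ⟨k, h⟩
    exact ⟨⟨_, k, rfl⟩, by simpa [Submonoid.smul_def] using h⟩

theorem Loc.map_fracLin (f : M →ₗ[R] M') (n : ℕ) (m : M) :
    Loc.map t f (Loc.fracLin t n m) = Loc.fracLin t n (f m) := by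
  rw [Loc.fracLin_apply, Loc.fracLin_apply, Loc.map_frac]

theorem Loc.fracLin_pow_smul (n k : ℕ) (m : M) :
    Loc.fracLin t (n + k) (t ^ k • m) = Loc.fracLin t n m := by
  rw [Loc.fracLin_apply, Loc.fracLin_apply, Loc.frac_smul]

/-- The direct limit topology on `M[1/t]`, for the `t`-adic topology on `M`, has the images of
the `t ^ j M` as a basis of neighbourhoods of `0`. -/
theorem AdicVia.loc [TopologicalSpace M] (h : AdicVia t (LinearMap.id : M →ₗ[R] M)) :
    AdicVia t (Loc.fracLin t 0 : M →ₗ[R] Loc t M) := by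
  intro U
  have e : IsOpen U ↔ ∀ n, IsOpen (Loc.frac t n ⁻¹' U) := by
    refine isOpen_iSup_iff.trans ?_
    simp only [isOpen_coinduced]
  rw [e]
  have key : ∀ (n j : ℕ) (x m : M), Loc.frac t n (x + t ^ (j + n) • m) =
      Loc.frac t n x + Loc.fracLin t 0 (t ^ j • m) := fun n j x m => by
    have h := Loc.fracLin_pow_smul (t := t) 0 n (t ^ j • m)
    rw [zero_add, smul_smul, ← pow_add, add_comm n j] at h
    rw [← Loc.fracLin_apply, ← Loc.fracLin_apply, map_add, h]
  constructor
  · intro hU x hx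
    obtain ⟨n, m, rfl⟩ := Loc.exists_frac t x
    obtain ⟨j, hj⟩ := (h _).1 (hU n) m hx
    refine ⟨j, fun m' => ?_⟩
    rw [← key]
    have := hj (t ^ n • m')
    rwa [smul_smul, ← pow_add, LinearMap.id_apply] at this
  · intro hU n
    refine (h _).2 fun x hx => ?_
    obtain ⟨j, hj⟩ := hU _ hx
    refine ⟨j + n, fun m => ?_⟩
    rw [Set.mem_preimage, LinearMap.id_apply, key]
    exact hj m

/-- A map which is an isomorphism up to a power of `t` becomes an isomorphism of topological
modules after inverting `t`. -/
theorem Loc.isHomeomorph_map [TopologicalSpace M] [TopologicalSpace M']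
    (h : AdicVia t (LinearMap.id : M →ₗ[R] M)) (h' : AdicVia t (LinearMap.id : M' →ₗ[R] M'))
    (f : M →ₗ[R] M') (g : M' →ₗ[R] M) (c : ℕ) (hgf : ∀ x, g (f x) = t ^ c • x)
    (hfg : ∀ y, f (g y) = t ^ c • y) : IsHomeomorph (Loc.map t f) := by
  refine h.loc.isHomeomorph h'.loc _ ⟨?_, ?_⟩ c (fun m => ⟨f (t ^ c • m), Loc.map_fracLin f 0 _⟩)
    (fun m' => ⟨g m', by rw [Loc.map_fracLin, hfg]⟩)
  · refine (injective_iff_map_eq_zero _).2 fun x hx => ?_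
    obtain ⟨n, m, rfl⟩ := Loc.exists_frac t x
    rw [Loc.map_frac, Loc.frac_eq_zero] at hx
    obtain ⟨k, hk⟩ := hx
    refine Loc.frac_eq_zero.2 ⟨k + c, ?_⟩
    rw [pow_add, mul_smul, ← hgf, ← map_smul, hk, map_zero]
  · intro y
    obtain ⟨n, m, rfl⟩ := Loc.exists_frac t y
    exact ⟨Loc.frac t (n + c) (g m), by rw [Loc.map_frac, hfg, Loc.frac_smul]⟩

theorem Loc.continuous_map [TopologicalSpace M] [TopologicalSpace M']
    (h : AdicVia t (LinearMap.id : M →ₗ[R] M)) (h' : AdicVia t (LinearMap.id : M' →ₗ[R] M'))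
    (f : M →ₗ[R] M') : Continuous (Loc.map t f) :=
  h.loc.continuous h'.loc _ 0 fun m => ⟨f (t ^ 0 • m), Loc.map_fracLin f 0 _⟩

theorem AdicVia.of_isHomeomorph [TopologicalSpace M] [TopologicalSpace M']
    (h : AdicVia t (LinearMap.id : M →ₗ[R] M)) (f : M' →ₗ[R] M) (hf : IsHomeomorph f) :
    AdicVia t (LinearMap.id : M' →ₗ[R] M') := by
  intro U
  have hU : IsOpen U ↔ IsOpen (f '' U) :=
    ⟨fun h => hf.isOpenMap _ h, fun h => by
      have := h.preimage hf.continuous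
      rwa [Set.preimage_image_eq _ hf.injective] at this⟩
  rw [hU, h, Set.forall_mem_image]
  refine forall₂_congr fun x _ => exists_congr fun j => ?_
  constructor
  · intro h m
    obtain ⟨y, hy, e⟩ := h (f m)
    rw [LinearMap.id_apply, ← map_smul, ← map_add] at e
    rwa [LinearMap.id_apply, ← hf.injective e]
  · intro h m
    obtain ⟨m, rfl⟩ := hf.surjective m
    exact ⟨_, h m, by simp⟩

end AdicTopology

/-! ### Inverse limits of sequences -/

section InverseLimit

/-- An inverse limit of spaces whose transition maps are homeomorphisms from the index `n` on is
determined by its `n`-th term: the maps `s a` give the inverse of the projection. -/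
theorem exists_tower_section (n : ℕ) : ∀ {X : ℕ → Type*} [∀ a, TopologicalSpace (X a)]
    (q : ∀ a, X (a + 1) → X a) (_ : ∀ a, Continuous (q a)) (_ : ∀ a ≥ n, IsHomeomorph (q a)),
    ∃ s : ∀ a, X n → X a, (∀ a, Continuous (s a)) ∧ (∀ a x, q a (s (a + 1) x) = s a x) ∧
      (∀ x, s n x = x) ∧ ∀ x : ∀ a, X a, (∀ a, q a (x (a + 1)) = x a) → ∀ a, s a (x n) = x a := by
  induction n with
  | zero =>
    intro X _ q hc h
    let e : ∀ a, X (a + 1) ≃ₜ X a := fun a => (h a a.zero_le).homeomorph (q a)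
    have he : ∀ a x, e a x = q a x := fun a x => rfl
    refine ⟨fun a => Nat.rec id (fun a s => (e a).symm ∘ s) a, fun a => ?_, fun a x => ?_,
      fun x => rfl, fun x hx a => ?_⟩
    · induction a with
      | zero => exact continuous_id
      | succ a ih => exact (e a).symm.continuous.comp ih
    · rw [← he]
      exact (e a).apply_symm_apply _
    · induction a with
      | zero => rfl
      | succ a ih =>
        refine ((e a).symm_apply_eq).2 ?_
        rw [he, hx]
        exact ih
  | succ n ih =>
    intro X _ q hc h
    obtain ⟨s, h1, h2, h3, h4⟩ := ih (X := fun a => X (a + 1)) (fun a => q (a + 1))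
      (fun a => hc _) (fun a ha => h _ (by omega))
    refine ⟨fun a => Nat.casesOn a (q 0 ∘ s 0) s, fun a => ?_, fun a x => ?_, h3, fun x hx a => ?_⟩
    · cases a with
      | zero => exact (hc 0).comp (h1 0)
      | succ a => exact h1 a
    · cases a with
      | zero => rfl
      | succ a => exact h2 a x
    · cases a with
      | zero => exact (congrArg (q 0) (h4 (fun a => x (a + 1)) (fun a => hx _) 0)).trans (hx 0)
      | succ a => exact h4 (fun a => x (a + 1)) (fun a => hx _) a

variable {R : Type*} [CommRing R] {X : ℕ → Type*} [∀ a, AddCommGroup (X a)] [∀ a, Module R (X a)]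
  [∀ a, TopologicalSpace (X a)]

theorem InvLim.isHomeomorph_proj (q : ∀ a, X (a + 1) →ₗ[R] X a) (n : ℕ)
    (hc : ∀ a, Continuous (q a)) (h : ∀ a ≥ n, IsHomeomorph (q a)) :
    IsHomeomorph (InvLim.proj q n) := by
  obtain ⟨s, h1, h2, h3, h4⟩ := exists_tower_section n (fun a => q a) hc h
  let e : InvLim q ≃ₜ X n :=
    { toFun := InvLim.proj q n
      invFun := fun x => ⟨fun a => s a x, fun a => h2 a x⟩
      left_inv := fun x => Subtype.ext (funext fun a => h4 x.1 x.2 a)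
      right_inv := h3
      continuous_toFun := (continuous_apply n).comp continuous_subtype_val
      continuous_invFun := Continuous.subtype_mk (continuous_pi h1) _ }
  exact e.isHomeomorph

end InverseLimit

/-! ### Completed tensor products -/

section Completion

variable {Z R : Type*} [CommRing Z] [CommRing R] [Algebra Z R] {t : R}
variable {M : Type*} [AddCommGroup M] [Module R M] [Module Z M] [IsScalarTower Z R M]
variable {A : Type*} [AddCommGroup A] [Module Z A]

theorem AdicCompletion.eval_eq_zero_iff (t : R) (M : Type*) [AddCommGroup M] [Module R M] (j : ℕ)
    (x : AdicCompletion (Ideal.span {t}) M) :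
    AdicCompletion.eval (Ideal.span {t}) M j x = 0 ↔ ∃ y, x = t ^ j • y := by
  rw [← LinearMap.mem_ker, ← AdicCompletion.pow_smul_top_eq_ker_eval ⟨{t}, by simp⟩,
    mem_span_pow_smul_top]

theorem AdicCompletion.eval_eq_zero_of_le {R M : Type*} [CommRing R] [AddCommGroup M] [Module R M]
    {I : Ideal R} {i j : ℕ} (hij : i ≤ j)
    {x : AdicCompletion I M} (h : AdicCompletion.eval I M j x = 0) :
    AdicCompletion.eval I M i x = 0 := by
  have := AdicCompletion.transitionMap_comp_eval_apply I M hij x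
  exact this.symm.trans ((congrArg _ h).trans (map_zero _))

/-- Reduction modulo `t ^ j` on a completed tensor product. -/
def ComplTensor.eval (j : ℕ) :
    ComplTensor Z t M A →ₗ[R] (M ⊗[Z] A) ⧸ (Ideal.span {t} ^ j • ⊤ : Submodule R (M ⊗[Z] A)) :=
  AdicCompletion.eval (Ideal.span {t}) (M ⊗[Z] A) j

theorem ComplTensor.eval_eq_zero_iff {j : ℕ} {x : ComplTensor Z t M A} :
    ComplTensor.eval j x = 0 ↔ ∃ y, x = t ^ j • y :=
  AdicCompletion.eval_eq_zero_iff t _ j x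

theorem ComplTensor.eval_eq_zero_of_le {i j : ℕ} (hij : i ≤ j) {x : ComplTensor Z t M A}
    (h : ComplTensor.eval j x = 0) : ComplTensor.eval i x = 0 :=
  AdicCompletion.eval_eq_zero_of_le hij h

/-- The topology of a completed tensor product is the `t`-adic one. -/
theorem ComplTensor.adicVia :
    AdicVia t (LinearMap.id : ComplTensor Z t M A →ₗ[R] ComplTensor Z t M A) := by
  intro U
  have hn : ∀ x : ComplTensor Z t M A, U ∈ nhds x ↔
      ∃ j : ℕ, ∀ m : ComplTensor Z t M A, x + t ^ j • m ∈ U := by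
    intro x
    have e : nhds x = ⨅ i : ℕ, Filter.principal
        {y : ComplTensor Z t M A | ComplTensor.eval i y = ComplTensor.eval i x} := by
      refine nhds_iInf.trans (iInf_congr fun i => ?_)
      let : TopologicalSpace ((M ⊗[Z] A) ⧸ (Ideal.span {t} ^ i • ⊤ : Submodule R (M ⊗[Z] A))) := ⊥
      have : DiscreteTopology ((M ⊗[Z] A) ⧸
        (Ideal.span {t} ^ i • ⊤ : Submodule R (M ⊗[Z] A))) := ⟨rfl⟩
      refine (nhds_induced (ComplTensor.eval i) x).trans ?_
      rw [nhds_discrete, Filter.comap_pure]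
      rfl
    rw [e, Filter.mem_iInf_of_directed]
    · refine exists_congr fun j => ?_
      rw [Filter.mem_principal]
      constructor
      · intro h m
        refine h ?_
        rw [Set.mem_ofPred_eq, map_add, ComplTensor.eval_eq_zero_iff.2 ⟨m, rfl⟩, add_zero]
      · intro h y hy
        have h0 : ComplTensor.eval j (y - x) = 0 := by rw [map_sub, sub_eq_zero]; exact hy
        obtain ⟨m, hm⟩ := ComplTensor.eval_eq_zero_iff.1 h0
        have := h m
        rwa [← hm, add_sub_cancel] at this
    · refine directed_of_isDirected_le fun i j hij => ?_
      rw [ge_iff_le, Filter.le_principal_iff, Filter.mem_principal]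
      intro y hy
      rw [Set.mem_ofPred_eq, ← sub_eq_zero, ← map_sub] at hy ⊢
      exact ComplTensor.eval_eq_zero_of_le hij hy
  rw [isOpen_iff_mem_nhds]
  exact forall₂_congr fun x _ => hn x

end Completion

/-! ### Coordinates on a completion -/

section Coordinates

variable {R : Type*} [CommRing R] {t : R}
variable {M M' P P' : Type*} [AddCommGroup M] [Module R M] [AddCommGroup M'] [Module R M']
  [AddCommGroup P] [Module R P] [AddCommGroup P'] [Module R P']

/-- The extension to the `t`-adic completion of a linear map to a `t`-adically complete module. -/
def complExtend (t : R) [IsAdicComplete (Ideal.span {t}) P] (c : M →ₗ[R] P) :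
    AdicCompletion (Ideal.span {t}) M →ₗ[R] P :=
  (AdicCompletion.ofLinearEquiv (Ideal.span {t}) P).symm.toLinearMap ∘ₗ
    (AdicCompletion.map (Ideal.span {t}) c).restrictScalars R

theorem of_complExtend [IsAdicComplete (Ideal.span {t}) P] (c : M →ₗ[R] P)
    (x : AdicCompletion (Ideal.span {t}) M) :
    AdicCompletion.of (Ideal.span {t}) P (complExtend t c x) =
      AdicCompletion.map (Ideal.span {t}) c x :=
  AdicCompletion.of_ofLinearEquiv_symm _ _

theorem complExtend_map [IsAdicComplete (Ideal.span {t}) P] [IsAdicComplete (Ideal.span {t}) P']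
    {c : M →ₗ[R] P} {c' : M' →ₗ[R] P'} {g : M →ₗ[R] M'} {h : P →ₗ[R] P'}
    (hc : c' ∘ₗ g = h ∘ₗ c) (x : AdicCompletion (Ideal.span {t}) M) :
    complExtend t c' (AdicCompletion.map (Ideal.span {t}) g x) = h (complExtend t c x) := by
  apply AdicCompletion.of_injective (Ideal.span {t}) P'
  rw [of_complExtend, AdicCompletion.map_comp_apply, hc, ← AdicCompletion.map_of, of_complExtend,
    AdicCompletion.map_comp_apply]

theorem complExtend_sub_mem [IsAdicComplete (Ideal.span {t}) P] (c : M →ₗ[R] P) {j : ℕ}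
    {x : AdicCompletion (Ideal.span {t}) M} {y : M}
    (h : AdicCompletion.eval (Ideal.span {t}) M j x = Submodule.mkQ _ y) :
    complExtend t c x - c y ∈ (Ideal.span {t} ^ j • ⊤ : Submodule R P) := by
  rw [← Submodule.Quotient.eq]
  have := congrArg (AdicCompletion.eval (Ideal.span {t}) P j) (of_complExtend c x)
  rw [AdicCompletion.eval_of, AdicCompletion.eval_apply, AdicCompletion.map_val_apply] at this
  rw [AdicCompletion.eval_apply] at h
  rw [h] at this
  exact this

variable {I : Type*} {Q : I → Type*} [∀ i, AddCommGroup (Q i)] [∀ i, Module R (Q i)]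
  [∀ i, IsAdicComplete (Ideal.span {t}) (Q i)] (c : ∀ i, M →ₗ[R] Q i)

/-- If `c` detects divisibility by the powers of `t` in `M`, its extension
detects divisibility by the powers of `t` in the completion. -/
theorem eval_eq_zero_of_complExtend
    (hc : ∀ j x, (∀ i, c i x ∈ (Ideal.span {t} ^ j • ⊤ : Submodule R (Q i))) →
      x ∈ (Ideal.span {t} ^ j • ⊤ : Submodule R M)) {j : ℕ}
    {x : AdicCompletion (Ideal.span {t}) M}
    (h : ∀ i, complExtend t (c i) x ∈ (Ideal.span {t} ^ j • ⊤ : Submodule R (Q i))) :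
    AdicCompletion.eval (Ideal.span {t}) M j x = 0 := by
  obtain ⟨y, hy⟩ := Submodule.mkQ_surjective _ (AdicCompletion.eval (Ideal.span {t}) M j x)
  rw [← hy]
  refine (Submodule.Quotient.mk_eq_zero _).2 (hc j y fun i => ?_)
  have := (Submodule.sub_mem_iff_right _ (h i)).1 (complExtend_sub_mem (c i) hy.symm)
  exact this

/-- If all but finitely many coordinates of each element of `M` vanish, the coordinates of an
element of the completion tend to zero. -/
theorem finite_complExtend (hf : ∀ x, {i | c i x ≠ 0}.Finite)
    (x : AdicCompletion (Ideal.span {t}) M) (j : ℕ) :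
    {i | complExtend t (c i) x ∉ (Ideal.span {t} ^ j • ⊤ : Submodule R (Q i))}.Finite := by
  obtain ⟨y, hy⟩ := Submodule.mkQ_surjective _ (AdicCompletion.eval (Ideal.span {t}) M j x)
  refine (hf y).subset fun i hi h0 => hi ?_
  have := complExtend_sub_mem (c i) hy.symm
  rwa [h0, sub_zero] at this

/-- Every family of coordinates tending to zero `t`-adically is that of an element of the
completion. -/
theorem exists_complExtend_eq
    (hc : ∀ j x, (∀ i, c i x ∈ (Ideal.span {t} ^ j • ⊤ : Submodule R (Q i))) →
      x ∈ (Ideal.span {t} ^ j • ⊤ : Submodule R M))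
    (hs : ∀ i (y : Q i), ∃ x, c i x = y ∧ ∀ i', i' ≠ i → c i' x = 0) (y : ∀ i, Q i)
    (hy : ∀ j, {i | y i ∉ (Ideal.span {t} ^ j • ⊤ : Submodule R (Q i))}.Finite) :
    ∃ x : AdicCompletion (Ideal.span {t}) M, ∀ i, complExtend t (c i) x = y i := by
  classical
  choose l hl hl' using hs
  -- the partial sums over the coordinates that do not vanish modulo `t ^ j`
  let f : ℕ → M := fun j => ∑ i ∈ (hy j).toFinset, l i (y i)
  have hf : ∀ j i, y i - c i (f j) ∈ (Ideal.span {t} ^ j • ⊤ : Submodule R (Q i)) := fun j i => by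
    have : c i (f j) = if i ∈ (hy j).toFinset then y i else 0 := by
      rw [map_sum]
      split_ifs with hi
      · rw [Finset.sum_eq_single i (fun i' _ h => hl' i' _ i h.symm) fun h => absurd hi h, hl]
      · exact Finset.sum_eq_zero fun i' hi' => hl' i' _ i fun e => hi (e ▸ hi')
    rw [this]
    split_ifs with h
    · rw [sub_self]; exact zero_mem _
    · rw [sub_zero]
      by_contra h2
      exact h (by simpa using h2)
  have hle : ∀ j i, (Ideal.span {t} ^ (j + 1) • ⊤ : Submodule R (Q i)) ≤ Ideal.span {t} ^ j • ⊤ :=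
    fun j i => Submodule.smul_mono_left (Ideal.pow_le_pow_right j.le_succ)
  have hcauchy : ∀ j, f j ≡ f (j + 1) [SMOD (Ideal.span {t} ^ j • ⊤ : Submodule R M)] := fun j => by
    rw [SModEq.sub_mem]
    refine hc _ _ fun i => ?_
    rw [map_sub]
    have := sub_mem (hle j i (hf (j + 1) i)) (hf j i)
    rwa [sub_sub_sub_cancel_left] at this
  let x : AdicCompletion (Ideal.span {t}) M :=
    AdicCompletion.mk (Ideal.span {t}) M (AdicCompletion.AdicCauchySequence.mk _ _ f hcauchy)
  have hx : ∀ j, AdicCompletion.eval (Ideal.span {t}) M j x = Submodule.mkQ _ (f j) := fun j => rfl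
  refine ⟨x, fun i => ?_⟩
  rw [IsHausdorff.eq_iff_smodEq (I := Ideal.span {t})]
  intro j
  rw [SModEq.sub_mem]
  have := sub_mem (complExtend_sub_mem (c i) (hx j)) (hf j i)
  rwa [sub_sub_sub_cancel_right] at this

end Coordinates

/-! ### Basic systems -/

section BasicSystem

variable (p : ℕ) [hp : Fact p.Prime]

universe u

/-- A basic system of a `ℤ_p`-module `A`: a family `e` which, for each `k`, induces a
decomposition of `A / p ^ k` as a direct sum of cyclic modules `ℤ / p ^ (m k i)`, with
`m k i = min k n_i` for some `n_i ≤ ∞`. The last two fields say that the kernel of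
`⨁ ℤ_p → A / p ^ k` is `⨁ p ^ (m k i) ℤ_p`, and that this map is surjective. -/
structure BasicSystem (A : Type u) [AddCommGroup A] [Module ℤ_[p] A] where
  I : Type u
  e : I → A
  m : ℕ → I → ℕ
  m_min : ∀ a b i, m (min a b) i = min a (m b i)
  mem_iff : ∀ (k : ℕ) (f : I →₀ ℤ_[p]),
    (∃ c, Finsupp.linearCombination ℤ_[p] e f = (p : ℤ_[p]) ^ k • c) ↔
      ∀ i, (p : ℤ_[p]) ^ m k i ∣ f i
  exists_eq : ∀ (k : ℕ) (a : A), ∃ (f : I →₀ ℤ_[p]) (c : A),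
    a = Finsupp.linearCombination ℤ_[p] e f + (p : ℤ_[p]) ^ k • c

variable {p} {A : Type u} [AddCommGroup A] [Module ℤ_[p] A]

variable (p) in
/-- A subset of `A` is `p`-independent if the submodule it spans is the direct sum of the cyclic
modules spanned by its elements, and is pure in `A`. -/
def PIndep (S : Set A) : Prop :=
  ∀ f : A →₀ ℤ_[p], (f.support : Set A) ⊆ S → ∀ k : ℕ,
    (∃ c, Finsupp.linearCombination ℤ_[p] id f = (p : ℤ_[p]) ^ k • c) →
      ∀ s, (p : ℤ_[p]) ^ k ∣ f s ∨ f s • s = 0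

theorem mem_span_iff_exists_finsupp {S : Set A} {b : A} : b ∈ Submodule.span ℤ_[p] S ↔
    ∃ f : A →₀ ℤ_[p], (f.support : Set A) ⊆ S ∧ Finsupp.linearCombination ℤ_[p] id f = b := by
  have := Finsupp.mem_span_image_iff_linearCombination ℤ_[p] (v := (id : A → A)) (s := S) (x := b)
  rwa [Set.image_id] at this

/-- The span of a `p`-independent set is a pure submodule. -/
theorem PIndep.exists_pow_smul {S : Set A} (hS : PIndep p S) {b : A}
    (hb : b ∈ Submodule.span ℤ_[p] S) {k : ℕ} {c : A} (h : b = (p : ℤ_[p]) ^ k • c) :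
    ∃ b' ∈ Submodule.span ℤ_[p] S, b = (p : ℤ_[p]) ^ k • b' := by
  obtain ⟨f, hf, rfl⟩ := mem_span_iff_exists_finsupp.1 hb
  have hg : ∀ s, ∃ g : ℤ_[p], f s • s = (p : ℤ_[p]) ^ k • (g • s) := fun s => by
    rcases hS f hf k ⟨c, h⟩ s with ⟨g, hg⟩ | h0
    · exact ⟨g, by rw [hg, mul_smul]⟩
    · exact ⟨0, by rw [h0, zero_smul, smul_zero]⟩
  choose g hg using hg
  refine ⟨∑ s ∈ f.support, g s • s, Submodule.sum_mem _ fun s hs =>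
    Submodule.smul_mem _ _ (Submodule.subset_span (hf hs)), ?_⟩
  rw [Finsupp.linearCombination_apply, Finsupp.sum, Finset.smul_sum]
  exact Finset.sum_congr rfl fun s _ => hg s

theorem exists_maximal_pIndep : ∃ S : Set A, Maximal (PIndep p) S := by
  have hF : Order.IsOfFiniteCharacter {S : Set A | PIndep p S} := by
    intro x
    constructor
    · intro h y hy _ f hf
      exact h f (hf.trans hy)
    · intro h f hf
      exact h _ hf f.support.finite_toSet f subset_rfl
  obtain ⟨S, -, hS⟩ := hF.exists_maximal (x := ∅) (by
    intro f hf k _ s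
    left
    have : f s = 0 := by
      by_contra h
      exact hf (Finsupp.mem_support_iff.2 h)
    rw [this]
    exact dvd_zero _)
  exact ⟨S, hS⟩

theorem exists_unit_mul_pow {x : ℤ_[p]} (hx : x ≠ 0) :
    ∃ (u : ℤ_[p]ˣ) (j : ℕ), x = u * (p : ℤ_[p]) ^ j :=
  ⟨_, _, PadicInt.unitCoeff_spec hx⟩

/-- A maximal `p`-independent set spans a dense submodule. Otherwise some `a` lies outside
`D = B + p A`, where `B` is the span; take it of the least possible order modulo `B`, and, `B`
being pure, of the same order in `A`. Then `a` could be added to the set. -/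
theorem exists_eq_add_of_maximal_pIndep {S : Set A} (hS : Maximal (PIndep p) S) (a : A) :
    ∃ b ∈ Submodule.span ℤ_[p] S, ∃ c, a = b + (p : ℤ_[p]) • c := by
  let D : Submodule ℤ_[p] A :=
    Submodule.span ℤ_[p] S ⊔ LinearMap.range (LinearMap.lsmul ℤ_[p] A (p : ℤ_[p]))
  have hBD : Submodule.span ℤ_[p] S ≤ D := le_sup_left
  have hpD : ∀ {c : A} {k : ℕ}, 0 < k → (p : ℤ_[p]) ^ k • c ∈ D := fun {c k} hk => by
    obtain ⟨k, rfl⟩ := Nat.exists_eq_succ_of_ne_zero hk.ne'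
    refine (le_sup_right : _ ≤ D) ⟨(p : ℤ_[p]) ^ k • c, ?_⟩
    rw [LinearMap.lsmul_apply, smul_smul, ← pow_succ']
  suffices h : a ∈ D by
    obtain ⟨b, hb, _, ⟨c, rfl⟩, rfl⟩ := Submodule.mem_sup.1 h
    exact ⟨b, hb, c, rfl⟩
  by_contra ha
  obtain ⟨a, ha, hmin⟩ : ∃ a ∉ D, ∀ c ∉ D, ∀ j : ℕ,
      (p : ℤ_[p]) ^ j • c ∈ Submodule.span ℤ_[p] S → (p : ℤ_[p]) ^ j • a = 0 := by
    by_cases h : ∃ n : ℕ, ∃ a ∉ D, (p : ℤ_[p]) ^ n • a ∈ Submodule.span ℤ_[p] S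
    · classical
      obtain ⟨a, ha, hn⟩ := Nat.find_spec h
      obtain ⟨b, hb, e⟩ := hS.1.exists_pow_smul hn rfl
      refine ⟨a - b, fun h' => ha ((sub_add_cancel a b) ▸ add_mem h' (hBD hb)), fun c hc j hj => ?_⟩
      obtain ⟨i, rfl⟩ := Nat.exists_eq_add_of_le (Nat.find_min' h ⟨c, hc, hj⟩)
      rw [add_comm, pow_add, mul_smul, smul_sub, e, sub_self, smul_zero]
    · exact ⟨a, ha, fun c hc j hj => absurd ⟨j, c, hc, hj⟩ h⟩
  have hins : PIndep p (insert a S) := by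
    classical
    intro f hf k ⟨c, hc⟩ s
    have haS : a ∉ S := fun h => ha (hBD (Submodule.subset_span h))
    have hg : ((f.erase a).support : Set A) ⊆ S := by
      intro x hx
      rw [Finsupp.support_erase, Finset.coe_erase] at hx
      exact (hf hx.1).resolve_left hx.2
    have hgs : ∀ s, s ≠ a → (f.erase a) s = f s := fun s hs => Finsupp.erase_ne hs
    set g := f.erase a with hgdef
    have hb := mem_span_iff_exists_finsupp.2 ⟨g, hg, rfl⟩
    have e : f a • a + Finsupp.linearCombination ℤ_[p] id g = (p : ℤ_[p]) ^ k • c := by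
      conv_rhs => rw [← hc, ← Finsupp.single_add_erase a f]
      rw [map_add, Finsupp.linearCombination_single]
      rfl
    -- it is enough to treat the coefficient of `a`
    suffices h : (p : ℤ_[p]) ^ k ∣ f a ∨ f a • a = 0 by
      by_cases hs : s = a
      · rwa [hs]
      · rw [← hgs s hs]
        refine hS.1 g hg k ?_ s
        rcases h with ⟨d, hd⟩ | h
        · refine ⟨c - d • a, ?_⟩
          rw [smul_sub, ← e, hd, mul_smul, add_sub_cancel_left]
        · exact ⟨c, by rw [← e, h, zero_add]⟩
    by_cases h0 : f a = 0
    · exact Or.inl (h0 ▸ dvd_zero _)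
    obtain ⟨u, j, hu⟩ := exists_unit_mul_pow h0
    rcases le_or_gt k j with hkj | hjk
    · exact Or.inl (hu ▸ (pow_dvd_pow _ hkj).mul_left _)
    right
    obtain ⟨i, rfl⟩ := Nat.exists_eq_add_of_lt hjk
    obtain ⟨b', hb', eb⟩ := hS.1.exists_pow_smul (k := j) hb
      (c := (p : ℤ_[p]) ^ (i + 1) • c - (u : ℤ_[p]) • a) (by
        rw [smul_sub, smul_smul, smul_smul, ← pow_add, ← add_assoc, ← e, hu,
          mul_comm (u : ℤ_[p]), add_sub_cancel_left])
    have hj := hmin ((u : ℤ_[p]) • a + b' - (p : ℤ_[p]) ^ (i + 1) • c) (fun h => ha (by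
      have h1 := add_mem (sub_mem h (hBD hb')) (hpD (c := c) i.succ_pos)
      have h2 : (u : ℤ_[p]) • a + b' - (p : ℤ_[p]) ^ (i + 1) • c - b' +
        (p : ℤ_[p]) ^ (i + 1) • c = (u : ℤ_[p]) • a := by abel
      rw [Nat.succ_eq_add_one, h2] at h1
      have := D.smul_mem (u⁻¹ : ℤ_[p]ˣ) h1
      rwa [smul_smul, Units.inv_mul, one_smul] at this)) j (by
        rw [smul_sub, smul_add, ← eb, smul_smul, smul_smul, ← pow_add, ← add_assoc, ← e, hu,
          mul_comm (u : ℤ_[p]), sub_self]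
        exact zero_mem _)
    rw [hu, mul_smul, hj, smul_zero]
  exact ha (hBD (Submodule.subset_span (hS.2 hins (Set.subset_insert a S) (Set.mem_insert a S))))

/-- Kulikov's theorem: every `ℤ_p`-module has a basic system. -/
theorem nonempty_basicSystem : Nonempty (BasicSystem p A) := by
  classical
  obtain ⟨S, hS⟩ := exists_maximal_pIndep (p := p) (A := A)
  -- `m k s = min k n`, where `p ^ n` is the order of `s`
  let m : ℕ → A → ℕ := fun k s =>
    if h : ∃ n : ℕ, (p : ℤ_[p]) ^ n • s = 0 then min k (Nat.find h) else k
  have hm : ∀ (k : ℕ) (s : A) (x : ℤ_[p]), ((p : ℤ_[p]) ^ k ∣ x ∨ x • s = 0) ↔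
      (p : ℤ_[p]) ^ m k s ∣ x := fun k s x => by
    by_cases hx : x = 0
    · simp [hx]
    obtain ⟨u, j, hu⟩ := exists_unit_mul_pow hx
    have h1 : x • s = 0 ↔ (p : ℤ_[p]) ^ j • s = 0 := by
      rw [hu, mul_smul]
      exact smul_eq_zero_iff_eq u
    have h2 : ∀ l : ℕ, (p : ℤ_[p]) ^ l ∣ x ↔ l ≤ j := fun l => by
      rw [hu, Units.dvd_mul_left, pow_dvd_pow_iff PadicInt.prime_p.ne_zero
        PadicInt.prime_p.not_isUnit]
    rw [h1, h2, h2]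
    by_cases h : ∃ n : ℕ, (p : ℤ_[p]) ^ n • s = 0
    · have : m k s = min k (Nat.find h) := dif_pos h
      rw [this, min_le_iff, Nat.find_le_iff]
      refine or_congr Iff.rfl ⟨fun h => ⟨j, le_rfl, h⟩, fun ⟨n, hn, h⟩ => ?_⟩
      obtain ⟨i, rfl⟩ := Nat.exists_eq_add_of_le hn
      rw [add_comm, pow_add, mul_smul, h, smul_zero]
    · have : m k s = k := dif_neg h
      rw [this]
      exact or_iff_left fun h' => h ⟨j, h'⟩
  refine ⟨⟨S, Subtype.val, fun k s => m k s, fun a b i => ?_, fun k f => ?_, fun k a => ?_⟩⟩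
  · simp only [m]
    split_ifs
    · rw [min_assoc]
    · rfl
  · let g : A →₀ ℤ_[p] := f.embDomain (Function.Embedding.subtype _)
    have hg : Finsupp.linearCombination ℤ_[p] id g =
        Finsupp.linearCombination ℤ_[p] (Subtype.val : S → A) f :=
      Finsupp.linearCombination_embDomain _ _ _
    have hgf : ∀ i : S, g i = f i := fun i => Finsupp.embDomain_apply_self _ _ _
    rw [← hg]
    constructor
    · intro h i
      rw [← hm, ← hgf]
      refine hS.1 g ?_ k h i
      intro s hs
      rw [Finsupp.support_embDomain] at hs
      obtain ⟨s, -, rfl⟩ := Finset.mem_map.1 hs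
      exact s.2
    · intro h
      have : ∀ i : S, ∃ c : A, f i • (i : A) = (p : ℤ_[p]) ^ k • c := fun i => by
        rcases (hm k i (f i)).2 (h i) with ⟨d, hd⟩ | h
        · exact ⟨d • (i : A), by rw [hd, mul_smul]⟩
        · exact ⟨0, by rw [h, smul_zero]⟩
      choose c hc using this
      refine ⟨∑ i ∈ f.support, c i, ?_⟩
      rw [hg, Finsupp.linearCombination_apply, Finsupp.sum, Finset.smul_sum]
      exact Finset.sum_congr rfl fun i _ => hc i
  · suffices h : ∃ b ∈ Submodule.span ℤ_[p] S, ∃ c, a = b + (p : ℤ_[p]) ^ k • c by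
      obtain ⟨b, hb, c, h⟩ := h
      obtain ⟨f, hf⟩ := (Finsupp.mem_span_iff_linearCombination ℤ_[p] S b).1 hb
      exact ⟨f, c, by rw [h, hf]⟩
    induction k generalizing a with
    | zero => exact ⟨0, zero_mem _, a, by simp⟩
    | succ k ih =>
      obtain ⟨b, hb, c, h⟩ := ih a
      obtain ⟨b', hb', c', h'⟩ := exists_eq_add_of_maximal_pIndep hS c
      refine ⟨b + (p : ℤ_[p]) ^ k • b', add_mem hb (Submodule.smul_mem _ _ hb'), c', ?_⟩
      rw [h, h', smul_add, smul_smul, ← pow_succ, add_assoc]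

/-- Reduction modulo `p ^ N` of a basic system. -/
def BasicSystem.modNat (B : BasicSystem p A) (N : ℕ) :
    BasicSystem p (ModNat (p ^ N) ℤ_[p] A) where
  I := B.I
  e i := Submodule.mkQ _ (B.e i)
  m k i := B.m (min k N) i
  m_min a b i := by rw [min_assoc, B.m_min]
  mem_iff k f := by
    rw [← B.mem_iff]
    have e : ∀ x : A, (∃ c : ModNat (p ^ N) ℤ_[p] A, Submodule.mkQ _ x = (p : ℤ_[p]) ^ k • c) ↔
        ∃ c, x = (p : ℤ_[p]) ^ (min k N) • c := fun x => by
      have hN : ∀ y : A, y ∈ (Ideal.span {((p ^ N : ℕ) : ℤ_[p])} • ⊤ : Submodule ℤ_[p] A) ↔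
          ∃ c, y = (p : ℤ_[p]) ^ N • c := fun y => by
        have := mem_span_pow_smul_top ((p ^ N : ℕ) : ℤ_[p]) 1 y
        simpa using this
      constructor
      · rintro ⟨c, hc⟩
        obtain ⟨c, rfl⟩ := Submodule.mkQ_surjective _ c
        rw [← map_smul, ← sub_eq_zero, ← map_sub] at hc
        obtain ⟨d, hd⟩ := (hN _).1 ((Submodule.Quotient.mk_eq_zero _).1 hc)
        refine ⟨(p : ℤ_[p]) ^ (k - min k N) • c + (p : ℤ_[p]) ^ (N - min k N) • d, ?_⟩
        rw [smul_add, smul_smul, smul_smul, ← pow_add, ← pow_add, Nat.add_sub_cancel' (by simp),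
          Nat.add_sub_cancel' (by simp), ← hd, add_sub_cancel]
      · rintro ⟨c, rfl⟩
        rcases le_total k N with h | h
        · rw [min_eq_left h]
          exact ⟨_, map_smul _ _ _⟩
        · rw [min_eq_right h]
          exact ⟨0, by rw [smul_zero]; exact (Submodule.Quotient.mk_eq_zero _).2 ((hN _).2 ⟨c, rfl⟩)⟩
    rw [← e, Finsupp.apply_linearCombination]
    rfl
  exists_eq k a := by
    obtain ⟨a, rfl⟩ := Submodule.mkQ_surjective _ a
    obtain ⟨f, c, h⟩ := B.exists_eq k a
    refine ⟨f, Submodule.mkQ _ c, ?_⟩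
    conv_lhs => rw [h, map_add, map_smul, Finsupp.apply_linearCombination]
    rfl

end BasicSystem

/-! ### Completeness of the truncated Witt vectors -/

section Witt

variable {p : ℕ} [hp : Fact p.Prime]

theorem norm_natCast_p_lt_one : ‖(p : ℂ_[p])‖ < 1 := by
  have h1 : ‖(p : ℂ_[p])‖ ≤ 1 := (mem_OC_iff p _).1 (natCast_mem _ p)
  refine h1.lt_of_ne fun h => (not_isUnit_p p).out ?_
  have h0 : (p : ℂ_[p]) ≠ 0 := fun h0 => by rw [h0, norm_zero] at h; exact zero_ne_one h
  refine IsUnit.of_mul_eq_one ⟨(p : ℂ_[p])⁻¹, (mem_OC_iff p _).2 (by rw [norm_inv, h, inv_one])⟩ ?_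
  exact Subtype.ext (mul_inv_cancel₀ h0)

/-- If `ϖ` were zero, every `ζ_{p^n}` would be `1` modulo `p`, hence `ζ_p`, which is the `p ^ n`-th
power of `ζ_{p^{n+1}}`, would be `1` modulo `p ^ (n + 1)` for all `n`. -/
theorem varpi_ne_zero (z : RootSystem p) : varpi z ≠ 0 := by
  intro h
  have h1 : ∀ n, (p : 𝓞_ℂ_[p]) ∣ z.zetaInt n - 1 := fun n => by
    rw [← Ideal.mem_span_singleton, ← Ideal.Quotient.eq]
    have := congrArg (PreTilt.coeff n) (sub_eq_zero.1 h)
    rw [map_one] at this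
    rw [map_one]
    exact this
  have h2 : ∀ n, z.zetaInt (1 + n) ^ p ^ n = z.zetaInt 1 := fun n => by
    induction n with
    | zero => simp
    | succ n ih => rw [pow_succ', pow_mul, ← add_assoc, z.zetaInt_pow, ih]
  have h3 : ∀ n : ℕ, ‖(z.zetaInt 1 - 1 : 𝓞_ℂ_[p]).1‖ ≤ ‖(p : ℂ_[p])‖ ^ (n + 1) := fun n => by
    obtain ⟨c, hc⟩ := dvd_sub_pow_of_dvd_sub (h1 (1 + n)) n
    rw [h2, one_pow] at hc
    rw [hc]
    change ‖(p : ℂ_[p]) ^ (n + 1) * c.1‖ ≤ _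
    rw [norm_mul, norm_pow]
    exact mul_le_of_le_one_right (by positivity) ((mem_OC_iff p _).1 c.2)
  have h4 : ‖(z.zetaInt 1 - 1 : 𝓞_ℂ_[p]).1‖ ≤ 0 :=
    ge_of_tendsto' ((tendsto_pow_atTop_nhds_zero_of_lt_one (norm_nonneg _)
      norm_natCast_p_lt_one).comp (Filter.tendsto_add_atTop_nat 1)) h3
  have h5 : z.zetaInt 1 = 1 := sub_eq_zero.1 (Subtype.ext (norm_le_zero_iff.1 h4))
  have h6 : ((z.zeta 1 : PadicAlgCl p) : ℂ_[p]) = ((1 : PadicAlgCl p) : ℂ_[p]) :=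
    congrArg Subtype.val h5
  have h7 : z.zeta 1 = 1 := UniformSpace.Completion.coe_injective _ h6
  have h8 := (z.isPrimitiveRoot 1).unique (h7 ▸ IsPrimitiveRoot.one)
  rw [pow_one] at h8
  exact hp.out.one_lt.ne' h8

theorem ocflat_ext {x y : OCflat p} (h : ∀ n, PreTilt.coeff n x = PreTilt.coeff n y) : x = y :=
  Perfection.ext h

theorem coeff_varpi_pow (z : RootSystem p) (n : ℕ) : PreTilt.coeff n (varpi z) ^ p ^ n = 0 := by
  have h0 : PreTilt.coeff 0 (varpi z) = 0 := by
    have h1 : z.zeta 0 = 1 := by simpa using (z.isPrimitiveRoot 0).pow_eq_one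
    have h2 : z.zetaInt 0 = 1 := Subtype.ext (by
      change ((z.zeta 0 : PadicAlgCl p) : ℂ_[p]) = _
      rw [h1]; rfl)
    rw [varpi, map_sub, map_one, sub_eq_zero]
    change Ideal.Quotient.mk _ (z.zetaInt 0) = _
    rw [h2, map_one]
  induction n with
  | zero => rw [h0]; simp
  | succ n ih =>
    have : PreTilt.coeff (n + 1) (varpi z) ^ p = PreTilt.coeff n (varpi z) := (varpi z).2 n
    rw [pow_succ', pow_mul, this, ih]

/-- Sums `∑ t ^ k d_{j+k}` converge in `A_inf`, since `t = [ϖ]` is nilpotent in each of the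
rings `W(O_C / p)`, of which `A_inf` is the limit. -/
theorem exists_series (z : RootSystem p) (d : ℕ → Ainf p) :
    ∃ s : ℕ → Ainf p, ∀ j, s j = d j + teichVarpi z * s (j + 1) := by
  let φ : ∀ n : ℕ, Ainf p →+* WittVector p (𝓞_ℂ_[p] ⧸ Ideal.span {(p : 𝓞_ℂ_[p])}) :=
    fun n => WittVector.map (PreTilt.coeff n)
  have hφ : ∀ {x y : Ainf p}, (∀ n, φ n x = φ n y) → x = y := fun {x y} h => by
    ext l
    refine ocflat_ext fun n => ?_
    exact congrArg (fun w => w.coeff l) (h n)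
  have ht : ∀ n k, p ^ n ≤ k → φ n (teichVarpi z) ^ k = 0 := fun n k hk => by
    have e : φ n (teichVarpi z) = WittVector.teichmuller p (PreTilt.coeff n (varpi z)) :=
      WittVector.map_teichmuller p _ _
    rw [e, ← map_pow, pow_eq_zero_of_le hk (coeff_varpi_pow z n), WittVector.teichmuller_zero]
  let S : ℕ → ℕ → Ainf p := fun j K => ∑ k ∈ Finset.range K, teichVarpi z ^ k * d (j + k)
  have hS : ∀ n j K, p ^ n ≤ K → φ n (S j K) = φ n (S j (p ^ n)) := fun n j K hK => by
    obtain ⟨i, rfl⟩ := Nat.exists_eq_add_of_le hK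
    rw [map_sum, map_sum, Finset.sum_range_add, add_eq_left]
    refine Finset.sum_eq_zero fun k _ => ?_
    rw [map_mul, map_pow, ht n _ (by omega), zero_mul]
  let s : ℕ → Ainf p := fun j => WittVector.mk p fun l =>
    ⟨fun n => (φ n (S j (p ^ n))).coeff l, fun n => by
      change (φ (n + 1) (S j (p ^ (n + 1)))).coeff l ^ p = (φ n (S j (p ^ n))).coeff l
      rw [← hS n j (p ^ (n + 1)) (Nat.pow_le_pow_right hp.out.pos n.le_succ)]
      exact ((S j (p ^ (n + 1))).coeff l).2 n⟩
  have hs : ∀ n j K, p ^ n ≤ K → φ n (s j) = φ n (S j K) := fun n j K hK => by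
    rw [hS n j K hK]
    ext l
    rfl
  refine ⟨s, fun j => hφ fun n => ?_⟩
  have hr : S j (p ^ n + 1) = d j + teichVarpi z * S (j + 1) (p ^ n) := by
    change ∑ k ∈ Finset.range (p ^ n + 1), _ = _ + _ * ∑ k ∈ Finset.range (p ^ n), _
    rw [Finset.sum_range_succ', Finset.mul_sum, add_comm]
    congr 1
    · simp
    · refine Finset.sum_congr rfl fun k _ => ?_
      rw [pow_succ', mul_assoc, add_right_comm, add_assoc]
  rw [hs n j (p ^ n + 1) (by omega), hr, map_add, map_mul, map_add, map_mul,
    hs n (j + 1) (p ^ n) le_rfl]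

theorem mk_wa_eq_zero {m : ℕ} {u : Ainf p} :
    (Ideal.Quotient.mk _ u : Wa p m) = 0 ↔ ∀ k < m, u.coeff k = 0 := by
  rw [Ideal.Quotient.eq_zero_iff_mem, WittVector.mem_span_p_pow_iff_le_coeff_eq_zero]

theorem lam_smul_mk (z : RootSystem p) (m j : ℕ) (u : Ainf p) :
    (lamVarpi z ^ j) • (Ideal.Quotient.mk _ u : Wa p m) =
      Ideal.Quotient.mk _ (teichVarpi z ^ j * u) := rfl

/-- The ring `W_m(O_C♭)` is complete and separated for the `[ϖ]`-adic topology. -/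
instance (z : RootSystem p) (m : ℕ) : IsAdicComplete (Ideal.span {lamVarpi z}) (Wa p m) where
  haus' x hx := by
    obtain ⟨u, rfl⟩ := Ideal.Quotient.mk_surjective x
    refine mk_wa_eq_zero.2 fun k hk => ocflat_ext fun n => ?_
    have := hx (p ^ n)
    rw [SModEq.zero, mem_span_pow_smul_top] at this
    obtain ⟨v, hv⟩ := this
    obtain ⟨v, rfl⟩ := Ideal.Quotient.mk_surjective v
    rw [lam_smul_mk, Ideal.Quotient.eq, WittVector.mem_span_p_pow_iff_le_coeff_eq_zero,
      ← WittVector.le_coeff_eq_iff_le_sub_coeff_eq_zero] at hv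
    rw [hv k hk, teichVarpi, ← map_pow, coeff_teichmuller_mul, ← pow_mul, map_mul, map_pow,
      pow_mul, coeff_varpi_pow, zero_pow (pow_ne_zero _ hp.out.ne_zero), zero_mul, map_zero]
  prec' f hf := by
    have hd : ∀ j, ∃ d : Ainf p,
        f (j + 1) = f j + lamVarpi z ^ j • (Ideal.Quotient.mk _ d : Wa p m) := by
      intro j
      have := (hf j.le_succ).symm
      rw [SModEq.sub_mem, mem_span_pow_smul_top] at this
      obtain ⟨d, hd⟩ := this
      obtain ⟨d, rfl⟩ := Ideal.Quotient.mk_surjective d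
      exact ⟨d, by rw [← hd, add_sub_cancel]⟩
    choose d hd using hd
    obtain ⟨s, hs⟩ := exists_series z d
    refine ⟨f 0 + Ideal.Quotient.mk _ (s 0), fun j => SModEq.symm ?_⟩
    rw [SModEq.sub_mem, mem_span_pow_smul_top]
    refine ⟨Ideal.Quotient.mk _ (s j), ?_⟩
    rw [sub_eq_iff_eq_add']
    induction j with
    | zero => rw [pow_zero, one_smul]
    | succ j ih =>
      have e : teichVarpi z ^ j * s j =
          teichVarpi z ^ j * d j + teichVarpi z ^ (j + 1) * s (j + 1) := by
        rw [hs j, mul_add, pow_succ, mul_assoc]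
      rw [ih, hd, lam_smul_mk, lam_smul_mk, lam_smul_mk, e, map_add, add_assoc]

variable (p) in
/-- `W(C♭) / p ^ m`. -/
abbrev AtildeMod (m : ℕ) : Type := Atilde p ⧸ Ideal.span {(p : Atilde p) ^ m}

instance (z : RootSystem p) (m : ℕ) : Module (Lam z) (AtildeMod p m) :=
  Submodule.Quotient.module' _

theorem mk_atilde_eq {m : ℕ} {x y : Atilde p} :
    (Ideal.Quotient.mk _ x : AtildeMod p m) = Ideal.Quotient.mk _ y ↔
      ∀ k < m, x.coeff k = y.coeff k := by
  rw [Ideal.Quotient.eq, WittVector.mem_span_p_pow_iff_le_coeff_eq_zero,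
    ← WittVector.le_coeff_eq_iff_le_sub_coeff_eq_zero]

/-- The inclusion of `W_m(O_C♭)` in `W_m(C♭)`. -/
def waIncl (z : RootSystem p) (m : ℕ) : Wa p m →ₗ[Lam z] AtildeMod p m where
  toFun := Ideal.quotientMap _ (algebraMap (Ainf p) (Atilde p)) (by
    rw [Ideal.span_singleton_le_iff_mem, Ideal.mem_comap, map_pow, map_natCast]
    exact Ideal.mem_span_singleton_self _)
  map_add' := map_add _
  map_smul' c x := by
    obtain ⟨x, rfl⟩ := Ideal.Quotient.mk_surjective x
    exact congrArg (Ideal.Quotient.mk _)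
      (map_smul (IsScalarTower.toAlgHom (Lam z) (Ainf p) (Atilde p)) c x)

theorem waIncl_mk (z : RootSystem p) (m : ℕ) (u : Ainf p) :
    waIncl z m (Ideal.Quotient.mk _ u) = Ideal.Quotient.mk _ (algebraMap (Ainf p) (Atilde p) u) :=
  rfl

theorem waIncl_injective (z : RootSystem p) (m : ℕ) : Function.Injective (waIncl z m) := by
  refine (injective_iff_map_eq_zero _).2 fun x hx => ?_
  obtain ⟨u, rfl⟩ := Ideal.Quotient.mk_surjective x
  rw [waIncl_mk, ← map_zero (Ideal.Quotient.mk _), mk_atilde_eq] at hx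
  refine mk_wa_eq_zero.2 fun k hk => ?_
  have := hx k hk
  rw [WittVector.zero_coeff] at this
  exact (map_eq_zero_iff _ (IsFractionRing.injective (OCflat p) (Cflat p))).1 this

theorem lam_smul_mk_atilde (z : RootSystem p) (m j : ℕ) (x : Atilde p) :
    (lamVarpi z ^ j) • (Ideal.Quotient.mk _ x : AtildeMod p m) =
      Ideal.Quotient.mk _ (algebraMap (Ainf p) (Atilde p) (teichVarpi z ^ j) * x) := rfl

theorem algebraMap_teichVarpi_pow (z : RootSystem p) (j : ℕ) :
    algebraMap (Ainf p) (Atilde p) (teichVarpi z ^ j) =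
      WittVector.teichmuller p (algebraMap (OCflat p) (Cflat p) (varpi z ^ j)) := by
  rw [teichVarpi, ← map_pow]
  exact WittVector.map_teichmuller p _ _

theorem isUnit_algebraMap_teichVarpi_pow (z : RootSystem p) (j : ℕ) :
    IsUnit (algebraMap (Ainf p) (Atilde p) (teichVarpi z ^ j)) := by
  rw [algebraMap_teichVarpi_pow]
  refine IsUnit.map (WittVector.teichmuller p) (isUnit_iff_ne_zero.2 ?_)
  rw [Ne, map_eq_zero_iff _ (IsFractionRing.injective (OCflat p) (Cflat p))]
  exact pow_ne_zero _ (varpi_ne_zero z)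

/-- `[ϖ]` acts invertibly on `W_m(C♭)`. -/
theorem isUnit_end_atildeMod (z : RootSystem p) (m : ℕ) (x : Submonoid.powers (lamVarpi z)) :
    IsUnit (algebraMap (Lam z) (Module.End (Lam z) (AtildeMod p m)) x) := by
  obtain ⟨_, j, rfl⟩ := x
  obtain ⟨v, hv⟩ := (isUnit_algebraMap_teichVarpi_pow z j).exists_left_inv
  rw [Module.End.isUnit_iff]
  constructor
  · refine (injective_iff_map_eq_zero _).2 fun x hx => ?_
    obtain ⟨x, rfl⟩ := Ideal.Quotient.mk_surjective x
    rw [Module.algebraMap_end_apply] at hx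
    change (lamVarpi z ^ j) • (Ideal.Quotient.mk _ x : AtildeMod p m) = 0 at hx
    rw [lam_smul_mk_atilde] at hx
    have := congrArg (fun y => Ideal.Quotient.mk _ v * y) hx
    simp only [mul_zero, ← map_mul, ← mul_assoc, hv, one_mul] at this
    exact this
  · intro y
    obtain ⟨y, rfl⟩ := Ideal.Quotient.mk_surjective y
    refine ⟨Ideal.Quotient.mk _ (v * y), ?_⟩
    rw [Module.algebraMap_end_apply]
    change (lamVarpi z ^ j) • (Ideal.Quotient.mk _ (v * y) : AtildeMod p m) = _
    rw [lam_smul_mk_atilde, ← mul_assoc, mul_comm _ v, hv, one_mul]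

end Witt

/-! ### Topological isomorphisms after completion and inversion of `t` -/

section Generic

variable {R : Type*} [CommRing R] {t : R} {X Y : Type*} [AddCommGroup X] [Module R X]
  [AddCommGroup Y] [Module R Y]

theorem AdicCompletion.map_map_eq_smul {I : Ideal R} (φ : X →ₗ[R] Y) (ψ : Y →ₗ[R] X) (c : R)
    (h : ∀ x, ψ (φ x) = c • x) (x : AdicCompletion I X) :
    AdicCompletion.map I ψ (AdicCompletion.map I φ x) = c • x := by
  have e : ψ ∘ₗ φ = c • LinearMap.id := LinearMap.ext h
  rw [AdicCompletion.map_comp_apply, e]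
  refine AdicCompletion.ext fun n => ?_
  obtain ⟨y, hy⟩ := Submodule.mkQ_surjective _ (x.val n)
  change LinearMap.reduceModIdeal _ (c • LinearMap.id) (x.val n) = c • (x.val n)
  rw [← hy]
  rfl

theorem IsHomeomorph.of_comp_left {X Y Z : Type*} [TopologicalSpace X] [TopologicalSpace Y]
    [TopologicalSpace Z] {f : Y → Z} {g : X → Y} (hf : IsHomeomorph f)
    (h : IsHomeomorph fun x => f (g x)) : IsHomeomorph g := by
  have e : g = (hf.homeomorph f).symm ∘ fun x => f (g x) :=
    funext fun x => ((hf.homeomorph f).symm_apply_apply (g x)).symm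
  rw [e]
  exact (hf.homeomorph f).symm.isHomeomorph.comp h

theorem Loc.bijective_divPow (n : ℕ) :
    Function.Bijective (Loc.divPow t n : Loc t X →ₗ[R] Loc t X) := by
  have h : ∀ x : Loc t X, t ^ n • Loc.divPow t n x = x := fun x => by
    obtain ⟨k, m, rfl⟩ := Loc.exists_frac t x
    rw [Loc.divPow_frac, ← Loc.fracLin_apply, ← map_smul, Loc.fracLin_pow_smul, Loc.fracLin_apply]
  refine ⟨Function.LeftInverse.injective h, fun x => ⟨t ^ n • x, ?_⟩⟩
  rw [map_smul, h]

theorem Loc.isHomeomorph_divPow [TopologicalSpace X]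
    (h : AdicVia t (LinearMap.id : X →ₗ[R] X)) (n : ℕ) :
    IsHomeomorph (Loc.divPow t n : Loc t X →ₗ[R] Loc t X) := by
  have e : ∀ m : X, Loc.divPow t n (Loc.fracLin t 0 (t ^ n • m)) = Loc.fracLin t 0 m := fun m => by
    have := Loc.fracLin_pow_smul (t := t) 0 n m
    rw [← this, Loc.fracLin_apply, Loc.fracLin_apply, Loc.divPow_frac]
  exact h.loc.isHomeomorph h.loc _ (Loc.bijective_divPow n) n (fun m => ⟨m, e m⟩)
    fun m => ⟨t ^ n • t ^ n • m, e _⟩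

theorem Loc.isHomeomorph_map_of_isHomeomorph [TopologicalSpace X] [TopologicalSpace Y]
    (h : AdicVia t (LinearMap.id : Y →ₗ[R] Y)) (f : X →ₗ[R] Y) (hf : IsHomeomorph f) :
    IsHomeomorph (Loc.map t f) := by
  let e := LinearEquiv.ofBijective f hf.bijective
  refine Loc.isHomeomorph_map (h.of_isHomeomorph f hf) h f e.symm.toLinearMap 0 (fun x => ?_)
    fun y => ?_
  · rw [pow_zero, one_smul]; exact e.symm_apply_apply x
  · rw [pow_zero, one_smul]; exact e.apply_symm_apply y

/-- An equivariant isomorphism of topological modules restricts to the invariants. -/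
def invariantsEquiv {G : Type*} [TopologicalSpace X] [TopologicalSpace Y] {act : G → X →ₗ[R] X}
    {act' : G → Y →ₗ[R] Y} (f : X →ₗ[R] Y) (hf : IsHomeomorph f)
    (h : ∀ g x, f (act g x) = act' g (f x)) : invariants act ≃L[R] invariants act' :=
  let e := LinearEquiv.ofBijective f hf.bijective
  have hc : Continuous e.symm := by
    have h2 : (e.symm : Y → X) = (hf.homeomorph f).symm :=
      funext fun y => e.symm_apply_eq.2 ((hf.homeomorph f).apply_symm_apply y).symm
    rw [h2]
    exact (hf.homeomorph f).symm.continuous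
  have he : ∀ y g, act g (e.symm y) = e.symm (act' g y) := fun y g => by
    rw [e.eq_symm_apply]
    exact (h g _).trans (congrArg _ (e.apply_symm_apply y))
  { toFun := fun x => ⟨f x.1, fun g => by rw [← h, x.2 g]⟩
    invFun := fun y => ⟨e.symm y.1, fun g => by rw [he, y.2 g]⟩
    map_add' := fun x y => Subtype.ext (map_add _ _ _)
    map_smul' := fun c x => Subtype.ext (map_smul _ _ _)
    left_inv := fun x => Subtype.ext (e.symm_apply_apply x.1)
    right_inv := fun y => Subtype.ext (e.apply_symm_apply y.1)
    continuous_toFun := (hf.continuous.comp continuous_subtype_val).subtype_mk _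
    continuous_invFun := (hc.comp continuous_subtype_val).subtype_mk _ }

end Generic

section Tensor

variable {Z R : Type*} [CommRing Z] [CommRing R] [Algebra Z R] {t : R}
variable {M M' L : Type*} [AddCommGroup M] [Module R M] [Module Z M] [IsScalarTower Z R M]
  [AddCommGroup M'] [Module R M'] [Module Z M'] [IsScalarTower Z R M']
  [AddCommGroup L] [Module R L] [Module Z L] [IsScalarTower Z R L]
  {A : Type*} [AddCommGroup A] [Module Z A]

/-- If `s` kills `A`, a surjection with kernel in `s M` becomes bijective after tensoring
with `A`. -/
theorem bijective_map_tensor (f : M →ₗ[R] M') (hf : Function.Surjective f) {s : Z}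
    (hs : ∀ x, f x = 0 → ∃ y, x = s • y) (hA : ∀ a : A, s • a = 0) :
    Function.Bijective
      (TensorProduct.AlgebraTensorModule.map f (LinearMap.id : A →ₗ[Z] A)) := by
  let g : M →ₗ[Z] M' := f.restrictScalars Z
  have hex := rTensor_exact A (f := (LinearMap.ker g).subtype) (g := g)
    (LinearMap.exact_subtype_ker_map g) hf
  have h0 : (LinearMap.ker g).subtype.rTensor A = 0 := TensorProduct.ext' fun x a => by
    obtain ⟨y, hy⟩ := hs x.1 x.2
    rw [LinearMap.rTensor_tmul, Submodule.subtype_apply, hy, TensorProduct.smul_tmul, hA,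
      TensorProduct.tmul_zero, LinearMap.zero_apply]
  have hi : Function.Injective (g.rTensor A) := by
    refine (injective_iff_map_eq_zero _).2 fun x hx => ?_
    obtain ⟨y, rfl⟩ := (hex x).1 hx
    rw [h0, LinearMap.zero_apply]
  have e : ∀ x, TensorProduct.AlgebraTensorModule.map f (LinearMap.id : A →ₗ[Z] A) x =
      g.rTensor A x := fun x => rfl
  have hsur : Function.Surjective (g.rTensor A) := LinearMap.rTensor_surjective A hf
  exact ⟨fun x y h => hi (by rwa [e, e] at h), fun y => hsur y⟩

theorem ComplTensor.continuous_map (u : M →ₗ[R] M') :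
    Continuous (ComplTensor.map t u (LinearMap.id : A →ₗ[Z] A)) :=
  ComplTensor.adicVia.continuous ComplTensor.adicVia _ 0 fun m =>
    ⟨ComplTensor.map t u LinearMap.id (t ^ 0 • m), rfl⟩

theorem ComplTensor.isHomeomorph_map (u : M →ₗ[R] M') (hu : Function.Bijective
      (TensorProduct.AlgebraTensorModule.map u (LinearMap.id : A →ₗ[Z] A))) :
    IsHomeomorph (ComplTensor.map t u (LinearMap.id : A →ₗ[Z] A)) := by
  let e := LinearEquiv.ofBijective _ hu
  have h1 := AdicCompletion.map_map_eq_smul (I := Ideal.span {t}) e.toLinearMap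
    e.symm.toLinearMap 1 fun x => by rw [one_smul]; exact e.symm_apply_apply x
  have h2 := AdicCompletion.map_map_eq_smul (I := Ideal.span {t}) e.symm.toLinearMap
    e.toLinearMap 1 fun x => by rw [one_smul]; exact e.apply_symm_apply x
  have hb : Function.Bijective (ComplTensor.map t u (LinearMap.id : A →ₗ[Z] A)) :=
    ⟨Function.LeftInverse.injective fun x => (h1 x).trans (one_smul _ _),
      Function.RightInverse.surjective fun x => (h2 x).trans (one_smul _ _)⟩
  exact ComplTensor.adicVia.isHomeomorph ComplTensor.adicVia _ hb 0
    (fun m => ⟨ComplTensor.map t u LinearMap.id (t ^ 0 • m), rfl⟩) fun m => hb.2 _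

/-- Let `q : L → M'` become bijective after tensoring with `A`, and `i : L → M` a map such
that `u ∘ i = t ^ c q` and that, after tensoring with `A`, `i ∘ q⁻¹ ∘ u` is multiplication by
`t ^ c` up to elements killed by `t ^ c`. Then `u` becomes an isomorphism of topological modules
after completion and inversion of `t`. -/
theorem Loc.isHomeomorph_map_complTensor (u : M →ₗ[R] M') (i : L →ₗ[R] M) (q : L →ₗ[R] M')
    (hq : Function.Bijective
      (TensorProduct.AlgebraTensorModule.map q (LinearMap.id : A →ₗ[Z] A))) (c : ℕ) {s : Z}
    (hA : ∀ a : A, s • a = 0) (hui : u ∘ₗ i = t ^ c • q)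
    (hiu : ∀ x, ∃ l w, u x = q l ∧ t ^ c • i l = t ^ c • t ^ c • x + s • w) :
    IsHomeomorph (Loc.map t (ComplTensor.map t u (LinearMap.id : A →ₗ[Z] A))) := by
  let e := LinearEquiv.ofBijective _ hq
  let φ := TensorProduct.AlgebraTensorModule.map u (LinearMap.id : A →ₗ[Z] A)
  let ι := TensorProduct.AlgebraTensorModule.map i (LinearMap.id : A →ₗ[Z] A)
  let ψ := t ^ c • (ι ∘ₗ e.symm.toLinearMap)
  have h1 : ∀ y, φ (ψ y) = t ^ (c + c) • y := fun y => by
    obtain ⟨w, rfl⟩ := e.surjective y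
    have h : φ (ι w) = t ^ c • e w := by
      have := TensorProduct.AlgebraTensorModule.map_comp u i (LinearMap.id : A →ₗ[Z] A)
        LinearMap.id
      rw [hui, LinearMap.comp_id, TensorProduct.AlgebraTensorModule.map_smul_left] at this
      exact (LinearMap.congr_fun this w).symm
    change φ (t ^ c • ι (e.symm (e w))) = _
    rw [e.symm_apply_apply, map_smul, h, smul_smul, pow_add]
  have h2 : ∀ x, ψ (φ x) = t ^ (c + c) • x := fun x => by
    change t ^ c • ι (e.symm (φ x)) = _
    induction x using TensorProduct.induction_on with
    | zero => simp
    | add x y hx hy => rw [map_add, map_add, map_add, smul_add, hx, hy, smul_add]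
    | tmul x a =>
      obtain ⟨l, w, hl, hw⟩ := hiu x
      have e1 : φ (x ⊗ₜ a) = e (l ⊗ₜ a) := by
        change u x ⊗ₜ[Z] a = q l ⊗ₜ[Z] a
        rw [hl]
      rw [e1, e.symm_apply_apply]
      change t ^ c • (i l ⊗ₜ[Z] a) = _
      rw [TensorProduct.smul_tmul', hw, TensorProduct.add_tmul, TensorProduct.smul_tmul s w, hA,
        TensorProduct.tmul_zero, add_zero, pow_add, mul_smul, TensorProduct.smul_tmul',
        TensorProduct.smul_tmul']
  let Ψ : ComplTensor Z t M' A →ₗ[R] ComplTensor Z t M A :=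
    (AdicCompletion.map (Ideal.span {t}) ψ).restrictScalars R
  exact Loc.isHomeomorph_map ComplTensor.adicVia ComplTensor.adicVia _ Ψ (c + c)
    (AdicCompletion.map_map_eq_smul φ ψ _ h2) (AdicCompletion.map_map_eq_smul ψ φ _ h1)

end Tensor

/-! ### Coefficients killed by a power of `p` -/

section Torsion

variable {p : ℕ} [hp : Fact p.Prime] (z : RootSystem p) (r : Radius p)
variable {A : Type*} [AddCommGroup A] [Module ℤ_[p] A] {N : ℕ}

/-- The projection of `A_inf` to `W_a(O_C♭)`. -/
def waMk (a : ℕ) : Ainf p →ₗ[Lam z] Wa p a := (Submodule.mkQ _).restrictScalars (Lam z)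

theorem waMk_apply (a : ℕ) (u : Ainf p) : waMk z a u = Ideal.Quotient.mk _ u := rfl

theorem padicInt_pow_smul_ainf (a : ℕ) (u : Ainf p) :
    (p : ℤ_[p]) ^ a • u = (p : Ainf p) ^ a * u := by
  rw [Algebra.smul_def, map_pow, map_natCast]

theorem bijective_waMk_tensor (hA : ∀ x : A, (p : ℤ_[p]) ^ N • x = 0) {a : ℕ} (ha : N ≤ a) :
    Function.Bijective
      (TensorProduct.AlgebraTensorModule.map (waMk z a) (LinearMap.id : A →ₗ[ℤ_[p]] A)) := by
  refine bijective_map_tensor (waMk z a) Ideal.Quotient.mk_surjective (s := (p : ℤ_[p]) ^ a)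
    (fun u hu => ?_) fun x => ?_
  · rw [waMk_apply, Ideal.Quotient.eq_zero_iff_mem, Ideal.mem_span_singleton] at hu
    obtain ⟨c, rfl⟩ := hu
    exact ⟨c, (padicInt_pow_smul_ainf a c).symm⟩
  · obtain ⟨i, rfl⟩ := Nat.exists_eq_add_of_le' ha
    rw [pow_add, mul_smul, hA, smul_zero]

theorem bijective_waTrans_tensor (hA : ∀ x : A, (p : ℤ_[p]) ^ N • x = 0) {a : ℕ} (ha : N ≤ a) :
    Function.Bijective
      (TensorProduct.AlgebraTensorModule.map (waTrans z a) (LinearMap.id : A →ₗ[ℤ_[p]] A)) := by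
  have h1 := bijective_waMk_tensor z hA ha
  have h2 := bijective_waMk_tensor z hA (ha.trans a.le_succ)
  refine (Function.Bijective.of_comp_iff _ h2).1 ?_
  have e := TensorProduct.AlgebraTensorModule.map_comp (waTrans z a) (waMk z (a + 1))
    (LinearMap.id : A →ₗ[ℤ_[p]] A) LinearMap.id
  have e2 : waTrans z a ∘ₗ waMk z (a + 1) = waMk z a := rfl
  rw [e2, LinearMap.comp_id] at e
  rw [e] at h1
  exact h1

theorem isHomeomorph_waATrans (hA : ∀ x : A, (p : ℤ_[p]) ^ N • x = 0) {a : ℕ} (ha : N ≤ a) :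
    IsHomeomorph (waATrans z A a) := by
  exact ComplTensor.isHomeomorph_map _ (bijective_waTrans_tensor z hA ha)

theorem continuous_waATrans (a : ℕ) : Continuous (waATrans z A a) :=
  ComplTensor.continuous_map _

theorem continuous_tildeTrans (a : ℕ) : Continuous (tildeTrans z A a) :=
  Loc.continuous_map ComplTensor.adicVia ComplTensor.adicVia _

/-- The projection of `Ã_A` to `W_a(O_C♭)_A[1/[ϖ]]`. -/
def Tilde.proj (a : ℕ) : Tilde z A →ₗ[Lam z] LocWaA z A a :=
  InvLim.proj (N := LocWaA z A) (tildeTrans z A) a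

/-- For coefficients `A` killed by `p ^ N`, the limit defining `Ã_A` is attained at `N`. -/
theorem Tilde.isHomeomorph_proj (hA : ∀ x : A, (p : ℤ_[p]) ^ N • x = 0) :
    IsHomeomorph (Tilde.proj z (A := A) N) :=
  InvLim.isHomeomorph_proj (X := LocWaA z A) (tildeTrans z A) N (continuous_tildeTrans z)
    fun _ ha => Loc.isHomeomorph_map_of_isHomeomorph ComplTensor.adicVia _
      (isHomeomorph_waATrans z hA ha)

theorem TildeInf.isHomeomorph_proj (hA : ∀ x : A, (p : ℤ_[p]) ^ N • x = 0) :
    IsHomeomorph (TildeInf.proj z A N) :=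
  Loc.isHomeomorph_map_of_isHomeomorph (X := PlusA z A) ComplTensor.adicVia _
    (InvLim.isHomeomorph_proj (X := WaA z A) (waATrans z A) N (continuous_waATrans z)
      fun _ ha => isHomeomorph_waATrans z hA ha)

theorem one_mem_circBase : (1 : Atilde p) ∈ circBase z r := by
  have h0 : teichCoord (1 : Atilde p) 0 = 1 := pow_p_pow_inj 0 (by
    rw [teichCoord_pow, WittVector.one_coeff_zero, one_pow])
  have hk : ∀ k, 1 ≤ k → teichCoord (1 : Atilde p) k = 0 := fun k hk => pow_p_pow_inj k (by
    rw [teichCoord_pow, WittVector.one_coeff_eq_of_pos _ _ _ hk,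
      zero_pow (pow_ne_zero _ hp.out.ne_zero)])
  refine ⟨fun k => ?_, fun m => ⟨1, fun k h => ⟨0, by rw [hk k h, zero_mul, mul_zero, map_zero]⟩⟩⟩
  rcases k.eq_zero_or_pos with rfl | h
  · exact ⟨1, by rw [h0, pow_zero, map_one, mul_one, mul_one, map_one]⟩
  · exact ⟨0, by rw [hk k h, zero_mul, mul_zero, map_zero]⟩

/-- The inclusion of `A_inf` in `Ã^{(0,r],◦}`. -/
def inclCirc : Ainf p →ₗ[Lam z] circBase z r :=
  (LinearMap.toSpanSingleton (Ainf p) (circBase z r) ⟨1, one_mem_circBase z r⟩).restrictScalars _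

theorem inclCirc_val (u : Ainf p) : (inclCirc z r u).1 = algebraMap _ _ u := by
  change algebraMap (Ainf p) (Atilde p) u * 1 = _
  rw [mul_one]

variable {z r}
theorem circToWa_eq {a : ℕ} {x : circBase z r} {u : Ainf p} (h : IsIntLift z r a x.1 u) :
    circToWa z r a x = waMk z a u :=
  (exists_isIntLift a x).choose_spec.mk_eq h

variable (z r)
theorem circToWa_comp_inclCirc (a : ℕ) :
    circToWa z r a ∘ₗ inclCirc z r = lamVarpi z ^ (a * r.num) • waMk z a := by
  refine LinearMap.ext fun u => ?_
  refine (circToWa_eq (u := teichVarpi z ^ (a * r.num) * u) fun k _ => ?_).trans rfl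
  rw [inclCirc_val, map_mul]

theorem teichCoord_mul_p_pow (w : Atilde p) (n k : ℕ) :
    teichCoord (w * (p : Atilde p) ^ n) (k + n) = teichCoord w k := by
  apply pow_p_pow_inj (k + n)
  rw [teichCoord_pow, pow_add, pow_mul, teichCoord_pow, WittVector.mul_pow_charP_coeff_succ]

theorem teichCoord_teichVarpi_mul (j : ℕ) (w : Atilde p) (k : ℕ) :
    teichCoord (algebraMap (Ainf p) (Atilde p) (teichVarpi z ^ j) * w) k =
      teichCoord w k * algebraMap _ _ (varpi z ^ j) := by
  apply pow_p_pow_inj k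
  rw [teichCoord_pow, algebraMap_teichVarpi_pow, coeff_teichmuller_mul, mul_pow, teichCoord_pow,
    mul_comm]

/-- Dividing by `p ^ N` an element of `Ã^{(0,r],◦}` costs at most `[ϖ] ^ (N m)`, where `m` is the
numerator of `1 / r`. -/
theorem mem_circBase_of_mul_p_pow {w : Atilde p} (h : w * (p : Atilde p) ^ N ∈ circBase z r) :
    algebraMap (Ainf p) (Atilde p) (teichVarpi z ^ (N * r.num)) * w ∈ circBase z r := by
  have e : ∀ k, teichCoord (algebraMap (Ainf p) (Atilde p) (teichVarpi z ^ (N * r.num)) * w) k *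
      algebraMap _ _ (varpiRoot z r ^ k) = teichCoord (w * (p : Atilde p) ^ N) (k + N) *
      algebraMap _ _ (varpi z ^ (N * r.num) * varpiRoot z r ^ k) := fun k => by
    rw [teichCoord_teichVarpi_mul, teichCoord_mul_p_pow, map_mul, mul_assoc]
  obtain ⟨d, hd⟩ := pow_dvd_pow_of_dvd (varpiRoot_dvd z r) N
  have e2 : ∀ k, varpi z ^ (N * r.num) * varpiRoot z r ^ k = varpiRoot z r ^ (k + N) * d := by
    intro k
    rw [mul_comm N, pow_mul, hd, pow_add]
    ring
  refine ⟨fun k => ?_, fun m => ?_⟩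
  · rw [e, e2, map_mul, ← mul_assoc]
    exact (h.1 (k + N)).mul _ (one_dvd _)
  · obtain ⟨J, hJ⟩ := h.2 m
    refine ⟨J, fun k hk => ?_⟩
    rw [e, e2, map_mul, ← mul_assoc]
    exact (hJ (k + N) (by omega)).mul _ (dvd_mul_right _ _)

/-- If `u` lifts `[ϖ] ^ (N m) x` modulo `p ^ N`, it differs from it by `p ^ N` times an element
that lies in `Ã^{(0,r],◦}` after multiplication by `[ϖ] ^ (N m)`. -/
theorem exists_circ_sub_eq (x : circBase z r) {u : Ainf p} (h : IsIntLift z r N x.1 u) :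
    ∃ w : circBase z r, lamVarpi z ^ (N * r.num) • inclCirc z r u =
      lamVarpi z ^ (N * r.num) • lamVarpi z ^ (N * r.num) • x + (p : ℤ_[p]) ^ N • w := by
  let T := algebraMap (Ainf p) (Atilde p) (teichVarpi z ^ (N * r.num))
  have h1 := mk_atilde_eq.2 fun k hk => (h k hk).symm
  rw [Ideal.Quotient.eq, Ideal.mem_span_singleton] at h1
  obtain ⟨w, hw⟩ := h1
  have h2 : w * (p : Atilde p) ^ N ∈ circBase z r := by
    rw [mul_comm, ← hw, ← inclCirc_val z r]
    exact sub_mem (inclCirc z r u).2 (lamVarpi z ^ (N * r.num) • x).2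
  refine ⟨⟨_, mem_circBase_of_mul_p_pow z r h2⟩, Subtype.ext ?_⟩
  change T * (inclCirc z r u).1 = T * (T * x.1) +
    algebraMap (Ainf p) (Atilde p) (algebraMap ℤ_[p] (Ainf p) ((p : ℤ_[p]) ^ N)) * (T * w)
  rw [map_pow, map_natCast, map_pow, map_natCast, inclCirc_val,
    mul_left_comm (_ ^ N), ← hw, mul_sub, add_sub_cancel]

variable (A) in
theorem TildeR.isHomeomorph_proj (hA : ∀ x : A, (p : ℤ_[p]) ^ N • x = 0) :
    IsHomeomorph (TildeR.proj z r A N) := by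
  have h := Loc.isHomeomorph_map_complTensor (circToWa z r N) (inclCirc z r) (waMk z N)
    (bijective_waMk_tensor z hA le_rfl) (N * r.num) hA (circToWa_comp_inclCirc z r N) fun x => by
      obtain ⟨u, hu⟩ := exists_isIntLift N x
      obtain ⟨w, hw⟩ := exists_circ_sub_eq z r x hu
      exact ⟨u, w, circToWa_eq hu, hw⟩
  exact (Loc.isHomeomorph_divPow ComplTensor.adicVia _).comp h

variable (A) in
theorem TildeR.isHomeomorph_toTilde (hA : ∀ x : A, (p : ℤ_[p]) ^ N • x = 0) :
    IsHomeomorph (TildeR.toTilde z r A) :=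
  IsHomeomorph.of_comp_left (Tilde.isHomeomorph_proj z hA) (TildeR.isHomeomorph_proj z r A hA)

variable (A) in
theorem TildeInf.isHomeomorph_toTilde (hA : ∀ x : A, (p : ℤ_[p]) ^ N • x = 0) :
    IsHomeomorph (TildeInf.toTilde z A) :=
  IsHomeomorph.of_comp_left (Tilde.isHomeomorph_proj z hA) (TildeInf.isHomeomorph_proj z hA)

variable {K : IntermediateField ℚ_[p] (PadicAlgCl p)}

theorem circToWa_gal (σ : HK K) (a : ℕ) :
    circToWa z r a ∘ₗ HK.galCircLin z r σ = HK.galWaLin z a σ ∘ₗ circToWa z r a := by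
  refine LinearMap.ext fun x => ?_
  obtain ⟨u, hu⟩ := exists_isIntLift a x
  refine (circToWa_eq (u := galAinf σ.1 u) fun k hk => ?_).trans
    (congrArg (HK.galWaLin z a σ) (circToWa_eq hu)).symm
  have h := congrArg (galCflat σ.1) (hu k hk)
  have e : algebraMap (Ainf p) (Atilde p) (teichVarpi z ^ (a * r.num)) =
      galAtilde σ.1 (algebraMap (Ainf p) (Atilde p) (teichVarpi z ^ (a * r.num))) := by
    have h0 : galAinf σ.1 (teichVarpi z) = teichVarpi z := HK.galAinf_lam σ z (lamVarpi z)
    rw [galAtilde_algebraMap, map_pow (galAinf σ.1), h0]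
  rw [← galAtilde_algebraMap, e]
  change (_ * galAtilde σ.1 x.1).coeff k = _
  rw [← map_mul]
  exact h

variable (A)
theorem TildeR.toTilde_gal (σ : HK K) (x : TildeR z r A) :
    TildeR.toTilde z r A (TildeR.gal z r A σ x) = Tilde.gal z A σ (TildeR.toTilde z r A x) := by
  refine Subtype.ext (funext fun a => ?_)
  change TildeR.proj z r A a (TildeR.gal z r A σ x) =
    Loc.map (lamVarpi z) (ComplTensor.map (lamVarpi z) (HK.galWaLin z a σ) LinearMap.id)
      (TildeR.proj z r A a x)
  obtain ⟨n, m, rfl⟩ := Loc.exists_frac (lamVarpi z) x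
  have e : TildeR.gal z r A σ (Loc.frac (lamVarpi z) n m) = Loc.frac (lamVarpi z) n
      (ComplTensor.map (lamVarpi z) (HK.galCircLin z r σ) LinearMap.id m) := Loc.map_frac _ _ _ _
  rw [e, TildeR.proj_frac, TildeR.proj_frac, Loc.map_frac]
  congr 1
  rw [← LinearMap.comp_apply, ← LinearMap.comp_apply, ComplTensor.map_comp_map,
    ComplTensor.map_comp_map, circToWa_gal]

theorem TildeInf.toTilde_gal (σ : HK K) (x : TildeInf z A) :
    TildeInf.toTilde z A (TildeInf.gal z A σ x) = Tilde.gal z A σ (TildeInf.toTilde z A x) := by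
  refine Subtype.ext (funext fun a => ?_)
  refine (Loc.map_map _ _ _ x).trans (Eq.trans ?_ (Loc.map_map _ _ _ x).symm)
  rfl

variable {A}
variable (K)
/-- The isomorphism `Ã^{(0,r]}_{K,A} ≃ Ã_{K,A}` for torsion coefficients of bounded exponent. -/
def tildeRKEquiv (hA : ∀ x : A, (p : ℤ_[p]) ^ N • x = 0) :
    TildeRK K z r A ≃L[Lam z] TildeK K z A :=
  invariantsEquiv (TildeR.toTilde z r A) (TildeR.isHomeomorph_toTilde z r A hA)
    fun σ x => TildeR.toTilde_gal z r A σ x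

/-- The isomorphism `Ã^{(0,∞)}_{K,A} ≃ Ã_{K,A}` for torsion coefficients of bounded exponent. -/
def tildeInfKEquiv (hA : ∀ x : A, (p : ℤ_[p]) ^ N • x = 0) :
    TildeInfK K z A ≃L[Lam z] TildeK K z A :=
  invariantsEquiv (TildeInf.toTilde z A) (TildeInf.isHomeomorph_toTilde z A hA)
    fun σ x => TildeInf.toTilde_gal z A σ x

theorem incl_tildeRKEquiv (hA : ∀ x : A, (p : ℤ_[p]) ^ N • x = 0) (x : TildeRK K z r A) :
    TildeK.incl K z A (tildeRKEquiv z r K hA x) = TildeR.toTilde z r A (TildeRK.incl K z r A x) :=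
  rfl

theorem incl_tildeInfKEquiv (hA : ∀ x : A, (p : ℤ_[p]) ^ N • x = 0) (x : TildeInfK K z A) :
    TildeK.incl K z A (tildeInfKEquiv z K hA x) = TildeInf.toTilde z A (TildeInfK.incl K z A x) :=
  rfl

end Torsion

/-! ### Coordinates on the modules of finite level -/

section LocLift

variable {R : Type*} [CommRing R] {t : R} {M P : Type*} [AddCommGroup M] [Module R M]
  [AddCommGroup P] [Module R P]

/-- The extension to `M[1/t]` of a linear map to a module on which `t` acts invertibly. -/
def Loc.lift (g : M →ₗ[R] P)
    (h : ∀ x : Submonoid.powers t, IsUnit (algebraMap R (Module.End R P) x)) : Loc t M →ₗ[R] P :=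
  LocalizedModule.lift (Submonoid.powers t) g h

theorem Loc.pow_smul_lift (g : M →ₗ[R] P)
    (h : ∀ x : Submonoid.powers t, IsUnit (algebraMap R (Module.End R P) x)) (n : ℕ) (m : M) :
    t ^ n • Loc.lift g h (Loc.frac t n m) = g m := by
  have h1 : t ^ n • Loc.frac t n m = LocalizedModule.mkLinearMap (Submonoid.powers t) M m := by
    have h2 := Loc.fracLin_pow_smul (t := t) 0 n m
    rw [zero_add, map_smul, Loc.fracLin_apply, Loc.fracLin_apply] at h2
    rw [h2, Loc.frac]
    refine Eq.trans ?_ (LocalizedModule.mkLinearMap_apply _ _ _).symm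
    congr 1
    exact Subtype.ext (pow_zero t)
  rw [← map_smul, h1]
  exact LinearMap.congr_fun (LocalizedModule.lift_comp (Submonoid.powers t) g h) m

end LocLift

section Level

universe u
variable {p : ℕ} [hp : Fact p.Prime] (z : RootSystem p)
variable {A : Type u} [AddCommGroup A] [Module ℤ_[p] A] (B : BasicSystem p A)

theorem BasicSystem.m_le (a : ℕ) (i : B.I) : B.m a i ≤ a := by
  have := B.m_min a a i
  rw [min_self] at this
  omega

theorem BasicSystem.m_mono {a b : ℕ} (h : a ≤ b) (i : B.I) : B.m a i ≤ B.m b i := by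
  have := B.m_min a b i
  rw [min_eq_left h] at this
  omega

theorem BasicSystem.dvd_sub {k : ℕ} {f g : B.I →₀ ℤ_[p]} {c d : A}
    (h : Finsupp.linearCombination ℤ_[p] B.e f + (p : ℤ_[p]) ^ k • c =
      Finsupp.linearCombination ℤ_[p] B.e g + (p : ℤ_[p]) ^ k • d) (i : B.I) :
    (p : ℤ_[p]) ^ B.m k i ∣ f i - g i := by
  refine (B.mem_iff k (f - g)).1 ⟨d - c, ?_⟩ i
  rw [map_sub, smul_sub]
  rw [sub_eq_sub_iff_add_eq_add, h, add_comm]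

/-- The `i`-th coordinate of the decomposition of `A / p ^ a` given by a basic system. -/
def BasicSystem.coeff (a : ℕ) (i : B.I) :
    A →ₗ[ℤ_[p]] ℤ_[p] ⧸ Ideal.span {(p : ℤ_[p]) ^ B.m a i} where
  toFun x := Ideal.Quotient.mk _ ((B.exists_eq a x).choose i)
  map_add' x y := by
    obtain ⟨c, hc⟩ := (B.exists_eq a x).choose_spec
    obtain ⟨d, hd⟩ := (B.exists_eq a y).choose_spec
    obtain ⟨e, he⟩ := (B.exists_eq a (x + y)).choose_spec
    rw [← map_add, Ideal.Quotient.eq, Ideal.mem_span_singleton, ← Finsupp.add_apply]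
    refine B.dvd_sub (c := e) (d := c + d) ?_ i
    rw [← he, map_add, smul_add, add_add_add_comm, ← hc, ← hd]
  map_smul' s x := by
    obtain ⟨c, hc⟩ := (B.exists_eq a x).choose_spec
    obtain ⟨e, he⟩ := (B.exists_eq a (s • x)).choose_spec
    change _ = Ideal.Quotient.mk _ (s * _)
    rw [Ideal.Quotient.eq, Ideal.mem_span_singleton, ← smul_eq_mul, ← Finsupp.smul_apply]
    refine B.dvd_sub (c := e) (d := s • c) ?_ i
    rw [← he, map_smul, smul_comm _ s c, ← smul_add, ← hc]

theorem BasicSystem.coeff_eq {a : ℕ} {x c : A} {f : B.I →₀ ℤ_[p]}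
    (h : x = Finsupp.linearCombination ℤ_[p] B.e f + (p : ℤ_[p]) ^ a • c) (i : B.I) :
    B.coeff a i x = Ideal.Quotient.mk _ (f i) := by
  obtain ⟨d, hd⟩ := (B.exists_eq a x).choose_spec
  change Ideal.Quotient.mk _ _ = _
  rw [Ideal.Quotient.eq, Ideal.mem_span_singleton]
  exact B.dvd_sub (hd.symm.trans h) i

/-- The projection `W_a(O_C♭) → W_b(O_C♭)` for `b ≤ a`. -/
def waFactor {a b : ℕ} (h : b ≤ a) : Wa p a →ₗ[Lam z] Wa p b :=
  (Submodule.factor (Ideal.span_singleton_le_span_singleton.2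
    (pow_dvd_pow (p : Ainf p) h))).restrictScalars _

theorem waFactor_mk {a b : ℕ} (h : b ≤ a) (u : Ainf p) :
    waFactor z h (waMk z a u) = waMk z b u := rfl

theorem waMk_surjective (a : ℕ) : Function.Surjective (waMk z a) := Ideal.Quotient.mk_surjective

theorem padicInt_pow_smul_waMk (m : ℕ) (u : Ainf p) : (p : ℤ_[p]) ^ m • waMk z m u = 0 := by
  have : (p : ℤ_[p]) ^ m • waMk z m u = waMk z m ((p : ℤ_[p]) ^ m • u) := rfl
  rw [this, padicInt_pow_smul_ainf, waMk_apply, Ideal.Quotient.eq_zero_iff_mem]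
  exact Ideal.mul_mem_right _ _ (Ideal.mem_span_singleton_self _)

/-- The action of `ℤ_p / p ^ b` on the image of `w` in `W_b(O_C♭)`. -/
def waQuotSMul {a b : ℕ} (h : b ≤ a) (w : Wa p a) :
    ℤ_[p] ⧸ Ideal.span {(p : ℤ_[p]) ^ b} →ₗ[ℤ_[p]] Wa p b :=
  Submodule.liftQ _ (LinearMap.toSpanSingleton ℤ_[p] _ (waFactor z h w)) (by
    rw [Ideal.span_singleton_le_iff_mem, LinearMap.mem_ker]
    obtain ⟨u, rfl⟩ := waMk_surjective z a w
    rw [waFactor_mk, LinearMap.toSpanSingleton_apply, padicInt_pow_smul_waMk])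

theorem waQuotSMul_mk {a b : ℕ} (h : b ≤ a) (w : Wa p a) (s : ℤ_[p]) :
    waQuotSMul z h w (Ideal.Quotient.mk _ s) = s • waFactor z h w := rfl

/-- The coordinates of `W_a(O_C♭) ⊗ A = ⨁ W_{m a i}(O_C♭)`. -/
def tensorCoord (a : ℕ) (i : B.I) : Wa p a ⊗[ℤ_[p]] A →ₗ[Lam z] Wa p (B.m a i) :=
  TensorProduct.AlgebraTensorModule.lift
    { toFun := fun w => waQuotSMul z (B.m_le a i) w ∘ₗ B.coeff a i
      map_add' := fun w w' => LinearMap.ext fun x => by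
        obtain ⟨s, hs⟩ := Ideal.Quotient.mk_surjective (B.coeff a i x)
        simp only [LinearMap.comp_apply, LinearMap.add_apply, ← hs, waQuotSMul_mk]
        rw [map_add, smul_add]
      map_smul' := fun c w => LinearMap.ext fun x => by
        obtain ⟨s, hs⟩ := Ideal.Quotient.mk_surjective (B.coeff a i x)
        simp only [LinearMap.comp_apply, LinearMap.smul_apply, ← hs, waQuotSMul_mk]
        rw [(waFactor z (B.m_le a i)).map_smul]
        exact smul_comm s c _ }

theorem tensorCoord_tmul {a : ℕ} {x c : A} {f : B.I →₀ ℤ_[p]}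
    (h : x = Finsupp.linearCombination ℤ_[p] B.e f + (p : ℤ_[p]) ^ a • c) (i : B.I) (u : Ainf p) :
    tensorCoord z B a i (waMk z a u ⊗ₜ x) = f i • waMk z (B.m a i) u := by
  change waQuotSMul z (B.m_le a i) (waMk z a u) (B.coeff a i x) = _
  rw [B.coeff_eq h, waQuotSMul_mk, waFactor_mk]

open Classical in
theorem tensorCoord_tmul_e (a : ℕ) (i j : B.I) (u : Ainf p) :
    tensorCoord z B a i (waMk z a u ⊗ₜ B.e j) = if j = i then waMk z (B.m a i) u else 0 := by
  rw [tensorCoord_tmul z B (f := Finsupp.single j 1) (c := 0) (by simp), Finsupp.single_apply,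
    ite_smul, one_smul, zero_smul]

theorem exists_eq_sum_tmul (a : ℕ) (x : Wa p a ⊗[ℤ_[p]] A) :
    ∃ u : B.I →₀ Ainf p, x = u.sum fun i v => waMk z a v ⊗ₜ B.e i := by
  have hadd : ∀ u v : B.I →₀ Ainf p, ((u + v).sum fun i v => waMk z a v ⊗ₜ[ℤ_[p]] B.e i) =
      (u.sum fun i v => waMk z a v ⊗ₜ B.e i) + v.sum fun i v => waMk z a v ⊗ₜ B.e i := fun u v =>
    Finsupp.sum_add_index' (fun i => by rw [map_zero, TensorProduct.zero_tmul])
      fun i v v' => by rw [map_add, TensorProduct.add_tmul]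
  induction x using TensorProduct.induction_on with
  | zero => exact ⟨0, Finsupp.sum_zero_index.symm⟩
  | add x y hx hy =>
    obtain ⟨u, rfl⟩ := hx
    obtain ⟨v, rfl⟩ := hy
    exact ⟨u + v, (hadd u v).symm⟩
  | tmul w x =>
    obtain ⟨v, rfl⟩ := waMk_surjective z a w
    obtain ⟨f, c, rfl⟩ := B.exists_eq a x
    refine ⟨f.mapRange (fun s => s • v) (zero_smul _ _), ?_⟩
    rw [TensorProduct.tmul_add, ← TensorProduct.smul_tmul, padicInt_pow_smul_waMk,
      TensorProduct.zero_tmul, add_zero, Finsupp.linearCombination_apply, Finsupp.sum,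
      TensorProduct.tmul_sum, Finsupp.sum_mapRange_index fun i => by
        rw [map_zero, TensorProduct.zero_tmul]]
    refine Finset.sum_congr rfl fun i _ => ?_
    rw [← TensorProduct.smul_tmul]
    rfl

theorem tensorCoord_sum (a : ℕ) (i : B.I) (u : B.I →₀ Ainf p) :
    tensorCoord z B a i (u.sum fun i v => waMk z a v ⊗ₜ B.e i) = waMk z (B.m a i) (u i) := by
  classical
  rw [Finsupp.sum, map_sum, Finset.sum_congr rfl fun j _ => tensorCoord_tmul_e z B a i j (u j),
    Finset.sum_ite_eq']
  split_ifs with h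
  · rfl
  · rw [Finsupp.notMem_support_iff.1 h, map_zero]

theorem finite_tensorCoord (a : ℕ) (x : Wa p a ⊗[ℤ_[p]] A) :
    {i | tensorCoord z B a i x ≠ 0}.Finite := by
  obtain ⟨u, rfl⟩ := exists_eq_sum_tmul z B a x
  refine u.support.finite_toSet.subset fun i hi => ?_
  rw [Set.mem_ofPred_eq, tensorCoord_sum] at hi
  refine Finsupp.mem_support_iff.2 fun h => hi ?_
  rw [h, map_zero]

/-- Divisibility by `[ϖ] ^ j` in `W_a(O_C♭) ⊗ A` can be tested on the coordinates. -/
theorem mem_pow_smul_of_tensorCoord (a j : ℕ) (x : Wa p a ⊗[ℤ_[p]] A)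
    (h : ∀ i, tensorCoord z B a i x ∈
      (Ideal.span {lamVarpi z} ^ j • ⊤ : Submodule (Lam z) (Wa p (B.m a i)))) :
    x ∈ (Ideal.span {lamVarpi z} ^ j • ⊤ : Submodule (Lam z) (Wa p a ⊗[ℤ_[p]] A)) := by
  obtain ⟨u, rfl⟩ := exists_eq_sum_tmul z B a x
  refine Submodule.sum_mem _ fun i _ => ?_
  have hi := h i
  rw [tensorCoord_sum, mem_span_pow_smul_top] at hi
  obtain ⟨v, hv⟩ := hi
  obtain ⟨v, rfl⟩ := waMk_surjective z _ v
  rw [← map_smul, ← sub_eq_zero, ← map_sub, waMk_apply, Ideal.Quotient.eq_zero_iff_mem,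
    Ideal.mem_span_singleton] at hv
  obtain ⟨w, hw⟩ := hv
  obtain ⟨c, hc⟩ := (B.mem_iff a (Finsupp.single i ((p : ℤ_[p]) ^ B.m a i))).2 fun j => by
    classical
    rw [Finsupp.single_apply]
    split_ifs with e
    · rw [e]
    · exact dvd_zero _
  rw [Finsupp.linearCombination_single] at hc
  rw [mem_span_pow_smul_top]
  refine ⟨waMk z a v ⊗ₜ B.e i, ?_⟩
  rw [← padicInt_pow_smul_ainf, sub_eq_iff_eq_add] at hw
  change waMk z a (u i) ⊗ₜ[ℤ_[p]] B.e i = _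
  have e1 : waMk z a ((p : ℤ_[p]) ^ B.m a i • w) = (p : ℤ_[p]) ^ B.m a i • waMk z a w := rfl
  rw [hw, map_add, TensorProduct.add_tmul, e1, TensorProduct.smul_tmul, hc,
    ← TensorProduct.smul_tmul, padicInt_pow_smul_waMk, TensorProduct.zero_tmul, zero_add, map_smul]
  rfl

theorem exists_tensorCoord_eq (a : ℕ) (i : B.I) (y : Wa p (B.m a i)) :
    ∃ x, tensorCoord z B a i x = y ∧ ∀ i', i' ≠ i → tensorCoord z B a i' x = 0 := by
  obtain ⟨u, rfl⟩ := waMk_surjective z _ y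
  refine ⟨waMk z a u ⊗ₜ B.e i, ?_, fun i' h => ?_⟩
  · rw [tensorCoord_tmul_e, if_pos rfl]
  · rw [tensorCoord_tmul_e, if_neg h.symm]

/-- The coordinates of the completion `W_a(O_C♭)_A`. -/
def waACoord (a : ℕ) (i : B.I) : WaA z A a →ₗ[Lam z] Wa p (B.m a i) :=
  complExtend (lamVarpi z) (tensorCoord z B a i)

/-- The coordinates of `W_a(O_C♭)_A[1/[ϖ]]`, with values in `W_{m a i}(C♭)`. -/
def coord (a : ℕ) (i : B.I) : LocWaA z A a →ₗ[Lam z] AtildeMod p (B.m a i) :=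
  Loc.lift (waIncl z _ ∘ₗ waACoord z B a i) (isUnit_end_atildeMod z _)

theorem pow_smul_atildeMod_injective (m n : ℕ) :
    Function.Injective fun x : AtildeMod p m => lamVarpi z ^ n • x :=
  ((Module.End.isUnit_iff _).1 (isUnit_end_atildeMod z m ⟨_, n, rfl⟩)).1

theorem pow_smul_coord (a : ℕ) (i : B.I) (n : ℕ) (x : WaA z A a) :
    lamVarpi z ^ n • coord z B a i (Loc.frac (lamVarpi z) n x) = waIncl z _ (waACoord z B a i x) :=
  Loc.pow_smul_lift _ _ n x

theorem exists_eq_smul_of_waACoord {a j : ℕ} {x : WaA z A a}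
    (h : ∀ i, ∃ y, waACoord z B a i x = lamVarpi z ^ j • y) : ∃ y, x = lamVarpi z ^ j • y :=
  ComplTensor.eval_eq_zero_iff.1 (eval_eq_zero_of_complExtend (fun i => tensorCoord z B a i)
    (mem_pow_smul_of_tensorCoord z B a) fun i => (mem_span_pow_smul_top _ _ _).2 (h i))

theorem coord_ext {a : ℕ} {x y : LocWaA z A a} (h : ∀ i, coord z B a i x = coord z B a i y) :
    x = y := by
  rw [← sub_eq_zero]
  have h' : ∀ i, coord z B a i (x - y) = 0 := fun i => by rw [map_sub, h, sub_self]
  obtain ⟨n, w, e⟩ := Loc.exists_frac (lamVarpi z) (x - y)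
  have h0 : ∀ i, waACoord z B a i w = 0 := fun i => waIncl_injective z _ (by
    rw [← pow_smul_coord, ← e, h', smul_zero, map_zero])
  have hw : w = 0 := AdicCompletion.ext fun j =>
    eval_eq_zero_of_complExtend (fun i => tensorCoord z B a i)
      (mem_pow_smul_of_tensorCoord z B a) fun i => by
        have : waACoord z B a i w ∈
            (Ideal.span {lamVarpi z} ^ j • ⊤ : Submodule (Lam z) (Wa p (B.m a i))) := by
          rw [h0 i]
          exact zero_mem _
        exact this
  rw [e, hw, ← Loc.fracLin_apply, map_zero]

/-- The image of `w` in `W_m(C♭)` lies in `[ϖ] ^ j W_m(O_C♭)`. This is expressed by the Teichmüller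
coordinates of `w`; see `dvdMod_iff`. -/
def DvdMod (j m : ℕ) (w : Atilde p) : Prop := ∀ k < m, DvdBy (varpi z ^ j) (teichCoord w k)

theorem dvdMod_iff {j m : ℕ} {w : Atilde p} : DvdMod z j m w ↔
    ∃ u : Ainf p, (Ideal.Quotient.mk _ w : AtildeMod p m) =
      lamVarpi z ^ j • waIncl z m (waMk z m u) := by
  have := exists_truncate_iff m 1 (varpi z ^ j) w
  simp only [map_one, mul_one, one_mul] at this
  rw [DvdMod, ← this]
  refine exists_congr fun u => ?_
  rw [waMk_apply, ← map_smul, lam_smul_mk, waIncl_mk, mk_atilde_eq, teichVarpi, ← map_pow]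

/-- The basic neighbourhoods of `0` in `W_a(O_C♭)_A[1/[ϖ]]` in terms of coordinates. -/
theorem exists_frac_zero_iff {a j : ℕ} {x : LocWaA z A a} {w : B.I → Atilde p}
    (hw : ∀ i, coord z B a i x = Ideal.Quotient.mk _ (w i)) :
    (∃ y, x = Loc.fracLin (lamVarpi z) 0 (lamVarpi z ^ j • y)) ↔
      ∀ i, DvdMod z j (B.m a i) (w i) := by
  simp only [dvdMod_iff, ← hw]
  constructor
  · rintro ⟨y, rfl⟩ i
    obtain ⟨u, hu⟩ := waMk_surjective z _ (waACoord z B a i y)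
    refine ⟨u, ?_⟩
    have := pow_smul_coord z B a i 0 (lamVarpi z ^ j • y)
    rwa [pow_zero, one_smul, map_smul, map_smul, ← hu, ← Loc.fracLin_apply] at this
  · intro h
    obtain ⟨n, ξ, rfl⟩ := Loc.exists_frac (lamVarpi z) x
    obtain ⟨η, rfl⟩ := exists_eq_smul_of_waACoord z B (j := n + j) (x := ξ) fun i => by
      obtain ⟨u, hu⟩ := h i
      refine ⟨waMk z _ u, waIncl_injective z _ ?_⟩
      rw [← pow_smul_coord, hu, map_smul, smul_smul, pow_add]
    refine ⟨η, ?_⟩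
    have := Loc.fracLin_pow_smul (t := lamVarpi z) 0 n (lamVarpi z ^ j • η)
    rw [← this, zero_add, Loc.fracLin_apply, smul_smul, pow_add]

/-- The families of coordinates of the elements of `W_a(O_C♭)_A[1/[ϖ]]`: they have a common
denominator, and tend to zero for the `[ϖ]`-adic topology. -/
def IsNull (a : ℕ) (w : B.I → Atilde p) : Prop :=
  (∃ n, ∀ i, ∀ k < B.m a i, DvdBy 1 (teichCoord (w i) k * algebraMap _ _ (varpi z ^ n))) ∧
    ∀ j, {i | ¬ DvdMod z j (B.m a i) (w i)}.Finite

/-- `[ϖ] ^ n w` lies in `W_m(O_C♭)` if and only if all `w_k ϖ ^ n` with `k < m` are integral, where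
`w = ∑ [w_k] p ^ k`. -/
theorem dvdBy_one_iff {n m : ℕ} {w : Atilde p} :
    (∀ k < m, DvdBy 1 (teichCoord w k * algebraMap _ _ (varpi z ^ n))) ↔
      ∃ u : Ainf p, lamVarpi z ^ n • (Ideal.Quotient.mk _ w : AtildeMod p m) =
        waIncl z m (waMk z m u) := by
  have := exists_truncate_iff m (varpi z ^ n) 1 w
  simp only [map_one, one_mul] at this
  rw [← this]
  refine exists_congr fun u => ?_
  rw [waMk_apply, waIncl_mk, lam_smul_mk_atilde, mk_atilde_eq, teichVarpi, ← map_pow]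

theorem isNull_coord {a : ℕ} {x : LocWaA z A a} {w : B.I → Atilde p}
    (hw : ∀ i, coord z B a i x = Ideal.Quotient.mk _ (w i)) : IsNull z B a w := by
  obtain ⟨n, ξ, rfl⟩ := Loc.exists_frac (lamVarpi z) x
  have e : ∀ i, lamVarpi z ^ n • (Ideal.Quotient.mk _ (w i) : AtildeMod p (B.m a i)) =
      waIncl z _ (waACoord z B a i ξ) := fun i => by rw [← hw, pow_smul_coord]
  refine ⟨⟨n, fun i => (dvdBy_one_iff z).2 ?_⟩, fun j => ?_⟩
  · obtain ⟨u, hu⟩ := waMk_surjective z _ (waACoord z B a i ξ)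
    exact ⟨u, by rw [e, hu]⟩
  · refine (finite_complExtend (fun i => tensorCoord z B a i) (finite_tensorCoord z B a) ξ
      (n + j)).subset fun i hi h => hi ?_
    rw [mem_span_pow_smul_top] at h
    obtain ⟨y, hy⟩ := h
    obtain ⟨u, rfl⟩ := waMk_surjective z _ y
    refine (dvdMod_iff z).2 ⟨u, pow_smul_atildeMod_injective z _ n ?_⟩
    change lamVarpi z ^ n • _ = lamVarpi z ^ n • _
    rw [e, smul_smul, ← pow_add, ← map_smul]
    exact congrArg _ hy

theorem exists_coord_eq {a : ℕ} {w : B.I → Atilde p} (hw : IsNull z B a w) :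
    ∃ x : LocWaA z A a, ∀ i, coord z B a i x = Ideal.Quotient.mk _ (w i) := by
  obtain ⟨⟨n, hn⟩, hf⟩ := hw
  choose u hu using fun i => (dvdBy_one_iff z).1 (hn i)
  obtain ⟨ξ, hξ⟩ : ∃ ξ : WaA z A a, ∀ i, waACoord z B a i ξ = waMk z (B.m a i) (u i) :=
    exists_complExtend_eq (fun i => tensorCoord z B a i)
    (mem_pow_smul_of_tensorCoord z B a) (exists_tensorCoord_eq z B a)
    (fun i => waMk z (B.m a i) (u i)) fun j => (hf j).subset fun i hi h => hi (by
      obtain ⟨v, hv⟩ := (dvdMod_iff z).1 h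
      refine (mem_span_pow_smul_top _ _ _).2 ⟨lamVarpi z ^ n • waMk z _ v, waIncl_injective z _ ?_⟩
      rw [← hu, hv, map_smul, map_smul, smul_comm])
  refine ⟨Loc.frac (lamVarpi z) n ξ, fun i => pow_smul_atildeMod_injective z _ n ?_⟩
  change lamVarpi z ^ n • _ = lamVarpi z ^ n • _
  rw [pow_smul_coord, hu, hξ]

/-- Naturality of the coordinates: if `g ⊗ f` maps the `i`-th coordinate to the `i'`-th one by `h`,
this remains true after completion and inversion of `[ϖ]`. -/
theorem coord_map {A' : Type u} [AddCommGroup A'] [Module ℤ_[p] A'] (B' : BasicSystem p A')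
    {a a' : ℕ} {i : B.I} {i' : B'.I} {g : Wa p a →ₗ[Lam z] Wa p a'} {f : A →ₗ[ℤ_[p]] A'}
    {h : Wa p (B.m a i) →ₗ[Lam z] Wa p (B'.m a' i')}
    (hc : ∀ u x, tensorCoord z B' a' i' (g (waMk z a u) ⊗ₜ f x) =
      h (tensorCoord z B a i (waMk z a u ⊗ₜ x)))
    {w w' : Atilde p} (hw : ∀ n u,
      lamVarpi z ^ n • (Ideal.Quotient.mk _ w : AtildeMod p (B.m a i)) = waIncl z _ (waMk z _ u) →
      lamVarpi z ^ n • (Ideal.Quotient.mk _ w' : AtildeMod p (B'.m a' i')) = waIncl z _ (h (waMk z _ u))) {x : LocWaA z A a}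
    (hx : coord z B a i x = Ideal.Quotient.mk _ w) :
    coord z B' a' i' (Loc.map (lamVarpi z) (ComplTensor.map (lamVarpi z) g f) x) =
      Ideal.Quotient.mk _ w' := by
  obtain ⟨n, ξ, rfl⟩ := Loc.exists_frac (lamVarpi z) x
  obtain ⟨u, hu⟩ := waMk_surjective z _ (waACoord z B a i ξ)
  apply pow_smul_atildeMod_injective z _ n
  change lamVarpi z ^ n • _ = lamVarpi z ^ n • _
  rw [hw n u (by rw [← hx, pow_smul_coord, hu]), Loc.map_frac, pow_smul_coord, hu]
  refine congrArg _ (complExtend_map (LinearMap.ext fun y => ?_) ξ)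
  induction y using TensorProduct.induction_on with
  | zero => simp
  | add x y hx hy => rw [map_add, map_add, hx, hy]
  | tmul v x =>
    obtain ⟨u, rfl⟩ := waMk_surjective z _ v
    exact hc u x

theorem mk_atilde_waFactor {n m m' : ℕ} (hm : m' ≤ m) {w : Atilde p} {u : Ainf p}
    (h : lamVarpi z ^ n • (Ideal.Quotient.mk _ w : AtildeMod p m) = waIncl z _ (waMk z _ u)) :
    lamVarpi z ^ n • (Ideal.Quotient.mk _ w : AtildeMod p m') =
      waIncl z _ (waFactor z hm (waMk z _ u)) := by
  rw [waMk_apply, waIncl_mk, lam_smul_mk_atilde, mk_atilde_eq] at h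
  rw [waFactor_mk, waMk_apply, waIncl_mk, lam_smul_mk_atilde, mk_atilde_eq]
  exact fun k hk => h k (hk.trans_le hm)

theorem coord_tildeTrans {a : ℕ} {i : B.I} {x : LocWaA z A (a + 1)} {w : Atilde p}
    (hx : coord z B (a + 1) i x = Ideal.Quotient.mk _ w) :
    coord z B a i (tildeTrans z A a x) = Ideal.Quotient.mk _ w := by
  refine coord_map z B B (h := waFactor z (B.m_mono a.le_succ i)) (fun u x => ?_)
    (fun n u => mk_atilde_waFactor z _) hx
  obtain ⟨f, c, h⟩ := B.exists_eq (a + 1) x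
  rw [tensorCoord_tmul z B h, LinearMap.id_apply]
  have h' : x = Finsupp.linearCombination ℤ_[p] B.e f + (p : ℤ_[p]) ^ a • (p : ℤ_[p]) • c := by
    rw [smul_smul, ← pow_succ, ← h]
  exact tensorCoord_tmul z B h' i u

theorem coord_reduce {a N : ℕ} {i : B.I} {x : LocWaA z A a} {w : Atilde p}
    (hx : coord z B a i x = Ideal.Quotient.mk _ w) :
    coord z (B.modNat N) a i (Loc.map (lamVarpi z) (ComplTensor.map (lamVarpi z)
      (LinearMap.id : Wa p a →ₗ[Lam z] Wa p a) (Submodule.mkQ _)) x) = Ideal.Quotient.mk _ w := by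
  have hm : (B.modNat N).m a i ≤ B.m a i := B.m_mono (min_le_left _ _) i
  refine coord_map z B (B.modNat N) (h := waFactor z hm) (fun u x => ?_)
    (fun n u => mk_atilde_waFactor z _) hx
  obtain ⟨f, c, h⟩ := B.exists_eq a x
  rw [tensorCoord_tmul z B h, LinearMap.id_apply]
  refine tensorCoord_tmul z (B.modNat N) (f := f) (c := Submodule.mkQ _ c) ?_ i u
  rw [h, map_add, map_smul, Finsupp.apply_linearCombination]
  rfl

variable {K : IntermediateField ℚ_[p] (PadicAlgCl p)}

theorem coord_gal (σ : HK K) {a : ℕ} {i : B.I} {x : LocWaA z A a} {w : Atilde p}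
    (hx : coord z B a i x = Ideal.Quotient.mk _ w) :
    coord z B a i (Loc.map (lamVarpi z) (ComplTensor.map (lamVarpi z) (HK.galWaLin z a σ)
      LinearMap.id) x) = Ideal.Quotient.mk _ (galAtilde σ.1 w) := by
  have hg : ∀ m u, HK.galWaLin z m σ (waMk z m u) = waMk z m (galAinf σ.1 u) := fun m u => rfl
  refine coord_map z B B (h := HK.galWaLin z _ σ) (fun u x => ?_) (fun n u h => ?_) hx
  · obtain ⟨f, c, h⟩ := B.exists_eq a x
    have hz : ∀ (s : ℤ_[p]), HK.galWaLin z _ σ (s • waMk z (B.m a i) u) =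
      s • HK.galWaLin z _ σ (waMk z (B.m a i) u) := fun s =>
        ((HK.galWaLin z (B.m a i) σ).restrictScalars ℤ_[p]).map_smul s _
    rw [LinearMap.id_apply, hg, tensorCoord_tmul z B h, tensorCoord_tmul z B h, hz, hg]
  · rw [waMk_apply, waIncl_mk, lam_smul_mk_atilde, mk_atilde_eq] at h
    rw [hg, waMk_apply, waIncl_mk, lam_smul_mk_atilde, mk_atilde_eq]
    intro k hk
    have h0 : galAinf σ.1 (teichVarpi z) = teichVarpi z := HK.galAinf_lam σ z (lamVarpi z)
    have e : algebraMap (Ainf p) (Atilde p) (teichVarpi z ^ n) * galAtilde σ.1 w =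
        galAtilde σ.1 (algebraMap (Ainf p) (Atilde p) (teichVarpi z ^ n) * w) := by
      rw [map_mul, galAtilde_algebraMap, map_pow (galAinf σ.1), h0]
    rw [e, ← galAtilde_algebraMap]
    exact congrArg (galCflat σ.1) (h k hk)

end Level

/-! ### Coordinates on `Ã_A` -/

section Global

universe u
variable {p : ℕ} [hp : Fact p.Prime] (z : RootSystem p)
variable {A : Type u} [AddCommGroup A] [Module ℤ_[p] A] (B : BasicSystem p A)

theorem Tilde.ext {x y : Tilde z A} (h : ∀ a, Tilde.proj z a x = Tilde.proj z a y) : x = y :=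
  Subtype.ext (funext h)

theorem Tilde.trans_proj (a : ℕ) (x : Tilde z A) :
    tildeTrans z A a (Tilde.proj z (a + 1) x) = Tilde.proj z a x := x.2 a

/-- The family `w` of Witt vectors is the family of coordinates of `x` in a basic system of `A`:
informally, `x = ∑ w_i ⊗ e_i`. The vector `w_i` matters only modulo `p ^ n_i`, where `n_i` is
the limit of the `B.m a i`. -/
def IsCoord (x : Tilde z A) (w : B.I → Atilde p) : Prop :=
  ∀ a i, coord z B a i (Tilde.proj z a x) = Ideal.Quotient.mk _ (w i)

/-- The Witt components of `w_i` of index at least `n_i` vanish. -/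
def IsReduced (w : B.I → Atilde p) : Prop := ∀ i k, B.m (k + 1) i ≤ k → (w i).coeff k = 0

variable {z B}

theorem BasicSystem.lt_m_iff {a k : ℕ} {i : B.I} (h : k < a) :
    k < B.m (k + 1) i ↔ k < B.m a i := by
  have := B.m_min (k + 1) a i
  rw [min_eq_left h] at this
  omega

theorem teichCoord_eq_zero {w : Atilde p} {k : ℕ} (h : w.coeff k = 0) : teichCoord w k = 0 :=
  pow_p_pow_inj k (by rw [teichCoord_pow, h, zero_pow (pow_ne_zero _ hp.out.ne_zero)])

theorem dvdBy_zero (b : OCflat p) : DvdBy b (0 : Cflat p) := ⟨0, by rw [mul_zero, map_zero]⟩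

theorem Tilde.coord_of_le {a b : ℕ} (h : b ≤ a) {i : B.I} {x : Tilde z A} {w : Atilde p}
    (hx : coord z B a i (Tilde.proj z a x) = Ideal.Quotient.mk _ w) :
    coord z B b i (Tilde.proj z b x) = Ideal.Quotient.mk _ w := by
  induction a, h using Nat.le_induction with
  | base => exact hx
  | succ a _ ih =>
    refine ih ?_
    rw [← Tilde.trans_proj]
    exact coord_tildeTrans z B hx

/-- The `k`-th component of the `i`-th coordinate is read off at the level `k + 1`, and set to zero
if `w_i` does not matter there. -/
theorem exists_isCoord (x : Tilde z A) : ∃ w, IsCoord z B x w ∧ IsReduced B w := by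
  classical
  choose v hv using fun a i => Ideal.Quotient.mk_surjective (coord z B a i (Tilde.proj z a x))
  refine ⟨fun i => WittVector.mk p fun k => if k < B.m (k + 1) i then (v (k + 1) i).coeff k else 0,
    fun a i => ?_, fun i k h => ?_⟩
  · rw [← hv, mk_atilde_eq]
    intro k hk
    have hka : k < a := hk.trans_le (B.m_le a i)
    have hk' := (B.lt_m_iff hka).2 hk
    rw [WittVector.coeff_mk, if_pos hk']
    have h2 := Tilde.coord_of_le hka (hv a i).symm
    exact mk_atilde_eq.1 (h2.symm.trans (hv _ i).symm) k hk'
  · rw [WittVector.coeff_mk, if_neg h.not_gt]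

theorem IsCoord.ext {x y : Tilde z A} {w : B.I → Atilde p} (hx : IsCoord z B x w)
    (hy : IsCoord z B y w) : x = y :=
  Tilde.ext z fun a => coord_ext z B fun i => (hx a i).trans (hy a i).symm

theorem IsCoord.unique {x : Tilde z A} {w v : B.I → Atilde p} (hw : IsCoord z B x w)
    (hv : IsCoord z B x v) (hw' : IsReduced B w) (hv' : IsReduced B v) : w = v := by
  funext i
  ext k
  by_cases h : B.m (k + 1) i ≤ k
  · rw [hw' i k h, hv' i k h]
  · exact mk_atilde_eq.1 ((hw (k + 1) i).symm.trans (hv (k + 1) i)) k (not_le.1 h)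

theorem exists_tilde {w : B.I → Atilde p} (hw : ∀ a, IsNull z B a w) :
    ∃ x : Tilde z A, IsCoord z B x w := by
  choose x hx using fun a => exists_coord_eq z B (hw a)
  exact ⟨⟨x, fun a => coord_ext z B fun i =>
    (coord_tildeTrans z B (hx (a + 1) i)).trans (hx a i).symm⟩, hx⟩

theorem IsCoord.isNull {x : Tilde z A} {w : B.I → Atilde p} (h : IsCoord z B x w) (a : ℕ) :
    IsNull z B a w := isNull_coord z B (h a)

theorem IsCoord.nsmul {x : Tilde z A} {w : B.I → Atilde p} (h : IsCoord z B x w) (n : ℕ) :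
    IsCoord z B (n • x) fun i => (n : Atilde p) * w i := fun a i => by
  rw [map_nsmul, map_nsmul, h]
  change n • _ = Ideal.Quotient.mk _ ((n : Atilde p) * w i)
  rw [← nsmul_eq_mul]
  exact (map_nsmul (Ideal.Quotient.mk _) n (w i)).symm

theorem IsCoord.reduce {x : Tilde z A} {w : B.I → Atilde p} (h : IsCoord z B x w) (N : ℕ) :
    IsCoord z (B.modNat N) (Tilde.reduce z (Submodule.mkQ _) x) w :=
  fun a i => coord_reduce z B (h a i)

variable {K : IntermediateField ℚ_[p] (PadicAlgCl p)}

theorem IsCoord.gal {x : Tilde z A} {w : B.I → Atilde p} (h : IsCoord z B x w) (σ : HK K) :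
    IsCoord z B (Tilde.gal z A σ x) fun i => galAtilde σ.1 (w i) :=
  fun a i => coord_gal z B σ (h a i)

/-- The coordinates of an invariant element are invariant. -/
theorem IsCoord.galAtilde_eq {x : Tilde z A} {w : B.I → Atilde p} (h : IsCoord z B x w)
    (hw : IsReduced B w) (σ : HK K) (hx : Tilde.gal z A σ x = x) (i : B.I) :
    galAtilde σ.1 (w i) = w i := by
  have h2 := h.gal σ
  rw [hx] at h2
  refine congrFun (h2.unique h (fun i k hk => ?_) hw) i
  change galCflat σ.1 ((w i).coeff k) = 0
  rw [hw i k hk, map_zero]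

theorem IsCoord.gal_eq {x : Tilde z A} {w : B.I → Atilde p} (h : IsCoord z B x w) (σ : HK K)
    (hw : ∀ i, galAtilde σ.1 (w i) = w i) : Tilde.gal z A σ x = x := by
  have h2 := h.gal σ
  simp only [hw] at h2
  exact h2.ext h

variable (z) in
/-- `x` lies in the basic neighbourhood of `0` of indices `a` and `j`. -/
def Tilde.IsSmall (a j : ℕ) (x : Tilde z A) : Prop :=
  ∃ y, Tilde.proj z a x = Loc.fracLin (lamVarpi z) 0 (lamVarpi z ^ j • y)

theorem IsCoord.isSmall_iff {x : Tilde z A} {w : B.I → Atilde p} (h : IsCoord z B x w) (a j : ℕ) :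
    Tilde.IsSmall z a j x ↔ ∀ i, DvdMod z j (B.m a i) (w i) := exists_frac_zero_iff z B (h a)

theorem IsReduced.coeff_eq_zero {N : ℕ} {w : B.I → Atilde p} (hw : IsReduced (B.modNat N) w)
    {i : B.I} {k : ℕ} (hk : B.m N i ≤ k) : (w i).coeff k = 0 := by
  refine hw i k ?_
  have e : (B.modNat N).m (k + 1) i = min (k + 1) (B.m N i) := B.m_min _ _ _
  rw [e]
  omega

theorem modNat_m_self (N : ℕ) (i : B.I) : (B.modNat N).m N i = B.m N i := by
  change B.m (min N N) i = _
  rw [min_self]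

theorem dvdMod_of_coeff_eq_zero {j m m' : ℕ} {w : Atilde p} (h : DvdMod z j m w)
    (hw : ∀ k, m ≤ k → w.coeff k = 0) : DvdMod z j m' w := fun k _ => by
  rcases lt_or_ge k m with hk | hk
  · exact h k hk
  · rw [teichCoord_eq_zero (hw k hk)]
    exact dvdBy_zero _

/-- An invariant element with coefficients `A / p ^ N` lifts to an invariant element with
coefficients `A`: extend the coordinates by zero. A small element has small lifts. -/
theorem exists_lift (B : BasicSystem p A) {N : ℕ} (y : Tilde z (ModNat (p ^ N) ℤ_[p] A))
    (hy : ∀ σ : HK K, Tilde.gal z _ σ y = y) :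
    ∃ x : Tilde z A, Tilde.reduce z (Submodule.mkQ _) x = y ∧
      (∀ σ : HK K, Tilde.gal z A σ x = x) ∧
      ∀ j, Tilde.IsSmall z N j y → ∀ a, Tilde.IsSmall z a j x := by
  obtain ⟨w, hw, hred⟩ := exists_isCoord (B := B.modNat N) y
  have h0 : ∀ i k, B.m N i ≤ k → (w i).coeff k = 0 := fun i k => hred.coeff_eq_zero
  have hn : ∀ a, IsNull z B a w := fun a => by
    obtain ⟨⟨n, hn⟩, hf⟩ := hw.isNull N
    refine ⟨⟨n, fun i k _ => ?_⟩, fun j => (hf j).subset fun i hi h => hi ?_⟩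
    · rcases lt_or_ge k (B.m N i) with hk | hk
      · exact hn i k (hk.trans_eq (modNat_m_self (B := B) N i).symm)
      · rw [teichCoord_eq_zero (h0 i k hk), zero_mul]
        exact dvdBy_zero _
    · exact dvdMod_of_coeff_eq_zero (modNat_m_self (B := B) N i ▸ h) (h0 i)
  obtain ⟨x, hx⟩ := exists_tilde hn
  refine ⟨x, (hx.reduce N).ext hw, fun σ => hx.gal_eq σ fun i => ?_, fun j hj a => ?_⟩
  · exact hw.galAtilde_eq hred σ (hy σ) i
  · refine (hx.isSmall_iff a j).2 fun i => ?_
    have h := (hw.isSmall_iff N j).1 hj i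
    exact dvdMod_of_coeff_eq_zero (modNat_m_self (B := B) N i ▸ h) (h0 i)

theorem mul_p_pow_cancel {x y : Atilde p} {N : ℕ}
    (h : x * (p : Atilde p) ^ N = y * (p : Atilde p) ^ N) :
    x = y := by
  ext k
  have := congrArg (fun w => w.coeff (k + N)) h
  simp only [WittVector.mul_pow_charP_coeff_succ] at this
  exact pow_p_pow_inj N this

/-- An invariant element with coefficients `A` that vanishes with coefficients `A / p ^ N` is
`p ^ N` times an invariant element: divide its coordinates by `p ^ N`. -/
theorem exists_eq_nsmul (B : BasicSystem p A) {N : ℕ} (x : Tilde z A)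
    (hx : ∀ σ : HK K, Tilde.gal z _ σ x = x)
    (h0 : Tilde.reduce z (Submodule.mkQ (Ideal.span {((p ^ N : ℕ) : ℤ_[p])} • ⊤)) x = 0) :
    ∃ y : Tilde z A, x = p ^ N • y ∧ ∀ σ : HK K, Tilde.gal z A σ y = y := by
  obtain ⟨w, hw, hred⟩ := exists_isCoord (B := B) x
  have hlow : ∀ i, ∀ k < N, (w i).coeff k = 0 := fun i k hk => by
    by_cases h : B.m (k + 1) i ≤ k
    · exact hred i k h
    · have h1 := hw.reduce N N i
      rw [h0, map_zero, map_zero] at h1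
      have h2 := mk_atilde_eq.1 ((map_zero _).trans h1) k (by
        rw [modNat_m_self]
        exact (B.lt_m_iff hk).1 (not_le.1 h))
      rw [← h2, WittVector.zero_coeff]
  have hdiv : ∀ i, ∃ y, w i = y * (p : Atilde p) ^ N := fun i => by
    have := (WittVector.mem_span_p_pow_iff_le_coeff_eq_zero (w i) N).2 (hlow i)
    rw [Ideal.mem_span_singleton] at this
    obtain ⟨y, hy⟩ := this
    exact ⟨y, hy.trans (mul_comm _ _)⟩
  choose v hv using hdiv
  have ht : ∀ i k, teichCoord (v i) k = teichCoord (w i) (k + N) := fun i k => by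
    rw [hv, teichCoord_mul_p_pow]
  -- a component of `v i` that matters is a component of `w i` that matters, or is zero
  have hk : ∀ {a i k}, k < B.m a i → teichCoord (v i) k = 0 ∨ k + N < B.m (a + N) i :=
    fun {a i k} hk => by
      by_cases h : B.m (k + N + 1) i ≤ k + N
      · exact Or.inl (by rw [ht, teichCoord_eq_zero (hred i _ h)])
      · refine Or.inr ((B.lt_m_iff ?_).1 (not_le.1 h))
        have := B.m_le a i
        omega
  have hn : ∀ a, IsNull z B a v := fun a => by
    obtain ⟨⟨n, hn⟩, hf⟩ := hw.isNull (a + N)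
    refine ⟨⟨n, fun i k h => ?_⟩, fun j => (hf j).subset fun i hi h => hi fun k hk' => ?_⟩
    · rcases hk h with h' | h'
      · rw [h', zero_mul]
        exact dvdBy_zero _
      · rw [ht]
        exact hn i _ h'
    · rcases hk hk' with h' | h'
      · rw [h']
        exact dvdBy_zero _
      · rw [ht]
        exact h _ h'
  obtain ⟨y, hy⟩ := exists_tilde hn
  refine ⟨y, ?_, fun σ => hy.gal_eq σ fun i => ?_⟩
  · have := hy.nsmul (p ^ N)
    refine hw.ext (w := w) ?_
    convert this using 2 with i
    rw [hv, mul_comm, Nat.cast_pow]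
  · refine mul_p_pow_cancel (N := N) ?_
    have h1 := hw.galAtilde_eq hred σ (hx σ) i
    rwa [hv, map_mul, map_pow, map_natCast] at h1

theorem nsmul_eq_zero (B : BasicSystem p A) {N : ℕ} (x : Tilde z (ModNat (p ^ N) ℤ_[p] A)) :
    p ^ N • x = 0 := by
  obtain ⟨w, hw, -⟩ := exists_isCoord (B := B.modNat N) x
  refine Tilde.ext z fun a => coord_ext z (B.modNat N) fun i => ?_
  rw [hw.nsmul (p ^ N), map_zero, map_zero, ← map_zero (Ideal.Quotient.mk _), mk_atilde_eq]
  intro k hk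
  have hkN : k < N := hk.trans_le ((B.m_le _ i).trans (min_le_right _ _))
  have e : ((p ^ N : ℕ) : Atilde p) * w i = w i * (p : Atilde p) ^ N := by
    rw [Nat.cast_pow, mul_comm]
  change (((p ^ N : ℕ) : Atilde p) * w i).coeff k = _
  rw [e, WittVector.mul_pow_charP_coeff_zero _ hkN, WittVector.zero_coeff]

theorem Tilde.IsSmall.mono {a b j i : ℕ} (hab : b ≤ a) (hij : i ≤ j) {x : Tilde z A}
    (h : Tilde.IsSmall z a j x) : Tilde.IsSmall z b i x := by
  induction a, hab using Nat.le_induction with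
  | base =>
    obtain ⟨y, hy⟩ := h
    refine ⟨lamVarpi z ^ (j - i) • y, ?_⟩
    rw [hy, smul_smul, ← pow_add, Nat.add_sub_cancel' hij]
  | succ a _ ih =>
    obtain ⟨y, hy⟩ := h
    refine ih ⟨waATrans z A a y, ?_⟩
    rw [← Tilde.trans_proj, hy, tildeTrans, Loc.map_fracLin, map_smul]

theorem Tilde.IsSmall.reduce {A' : Type*} [AddCommGroup A'] [Module ℤ_[p] A'] {a j : ℕ}
    {x : Tilde z A} (h : Tilde.IsSmall z a j x) (f : A →ₗ[ℤ_[p]] A') :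
    Tilde.IsSmall z a j (Tilde.reduce z f x) := by
  obtain ⟨y, hy⟩ := h
  refine ⟨ComplTensor.map (lamVarpi z) LinearMap.id f y, ?_⟩
  change Loc.map (lamVarpi z) (ComplTensor.map (lamVarpi z) LinearMap.id f) (Tilde.proj z a x) = _
  rw [hy, Loc.map_fracLin, map_smul]

/-- The sets `x + {y | Tilde.IsSmall z a j y}` form a basis of neighbourhoods of `x`. -/
theorem TildeK.isOpen_iff {U : Set (TildeK K z A)} : IsOpen U ↔
    ∀ x ∈ U, ∃ a j, ∀ y, Tilde.IsSmall z a j (TildeK.incl K z A y) → x + y ∈ U := by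
  have hι : Topology.IsInducing fun (x : TildeK K z A) a => Tilde.proj z a (TildeK.incl K z A x) :=
    Topology.IsInducing.subtypeVal.comp Topology.IsInducing.subtypeVal
  constructor
  · intro hU x hx
    have hU' := hU.mem_nhds hx
    rw [hι.nhds_eq_comap, Filter.mem_comap, nhds_pi] at hU'
    obtain ⟨V, hV, hVU⟩ := hU'
    obtain ⟨I, hI, t, ht, htV⟩ := Filter.mem_pi.1 hV
    have hj : ∀ a, ∃ j, ∀ m, Tilde.proj z a (TildeK.incl K z A x) +
        Loc.fracLin (lamVarpi z) 0 (lamVarpi z ^ j • m) ∈ t a := fun a => by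
      obtain ⟨s, hst, hs, hxs⟩ := mem_nhds_iff.1 (ht a)
      obtain ⟨j, hj⟩ := (ComplTensor.adicVia.loc s).1 hs _ hxs
      exact ⟨j, fun m => hst (hj m)⟩
    choose j hj using hj
    obtain ⟨b, hb⟩ := hI.bddAbove
    obtain ⟨c, hc⟩ := (hI.image j).bddAbove
    refine ⟨b, c, fun y hy => hVU (htV fun a ha => ?_)⟩
    obtain ⟨m, hm⟩ := hy.mono (hb ha) (hc ⟨a, ha, rfl⟩)
    change Tilde.proj z a (TildeK.incl K z A (x + y)) ∈ t a
    rw [map_add, map_add, hm]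
    exact hj a m
  · intro h
    refine isOpen_iff_mem_nhds.2 fun x hx => ?_
    obtain ⟨a, j, hU⟩ := h x hx
    have hopen : IsOpen {v : LocWaA z A a | ∃ y, v - Tilde.proj z a (TildeK.incl K z A x) =
        Loc.fracLin (lamVarpi z) 0 (lamVarpi z ^ j • y)} := by
      refine (ComplTensor.adicVia.loc _).2 fun v ⟨y, hy⟩ => ⟨j, fun m => ⟨y + m, ?_⟩⟩
      rw [add_sub_right_comm, hy, smul_add, map_add]
    have hc : Continuous fun y : TildeK K z A => Tilde.proj z a (TildeK.incl K z A y) :=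
      (continuous_apply a).comp hι.continuous
    refine Filter.mem_of_superset ((hopen.preimage hc).mem_nhds ⟨0, ?_⟩) fun y hy => ?_
    · rw [sub_self, smul_zero, map_zero]
    · rw [← add_sub_cancel x y]
      refine hU _ ?_
      rw [Tilde.IsSmall, map_sub, map_sub]
      exact hy

end Global

/-! ### Reduction of the coefficients -/

section Reduction

universe u
variable {p : ℕ} [hp : Fact p.Prime] (z : RootSystem p) (A : Type u) [AddCommGroup A]
  [Module ℤ_[p] A] (K : IntermediateField ℚ_[p] (PadicAlgCl p)) (N : ℕ)

theorem Tilde.reduce_gal {A' : Type*} [AddCommGroup A'] [Module ℤ_[p] A'] (f : A →ₗ[ℤ_[p]] A')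
    (σ : HK K) (x : Tilde z A) :
    Tilde.reduce z f (Tilde.gal z A σ x) = Tilde.gal z A' σ (Tilde.reduce z f x) := by
  refine Tilde.ext z fun a => ?_
  refine (Loc.map_map _ _ _ _).trans (Eq.trans ?_ (Loc.map_map _ _ _ _).symm)
  rw [ComplTensor.map_comp_map, ComplTensor.map_comp_map]
  rfl

/-- The map `Ã_{K,A} → Ã_{K,A/p^N}`. -/
def TildeK.reduce : TildeK K z A →ₗ[Lam z] TildeK K z (ModNat (p ^ N) ℤ_[p] A) :=
  ((Tilde.reduce z (Submodule.mkQ _)).comp (TildeK.incl K z A)).codRestrict _ fun x σ => by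
    rw [LinearMap.comp_apply, ← Tilde.reduce_gal]
    exact congrArg _ (x.2 σ)

theorem TildeK.incl_injective : Function.Injective (TildeK.incl K z A) := Subtype.val_injective

theorem TildeK.continuous_reduce : Continuous (TildeK.reduce z A K N) := by
  refine continuous_def.2 fun U hU => TildeK.isOpen_iff.2 fun x hx => ?_
  obtain ⟨a, j, h⟩ := TildeK.isOpen_iff.1 hU _ hx
  refine ⟨a, j, fun y hy => ?_⟩
  rw [Set.mem_preimage, map_add]
  exact h _ (hy.reduce _)

theorem TildeK.exists_lift (y : TildeK K z (ModNat (p ^ N) ℤ_[p] A)) :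
    ∃ x : TildeK K z A, TildeK.reduce z A K N x = y ∧
      ∀ j, Tilde.IsSmall z N j (TildeK.incl K z _ y) →
        ∀ a, Tilde.IsSmall z a j (TildeK.incl K z A x) := by
  obtain ⟨B⟩ := nonempty_basicSystem (p := p) (A := A)
  obtain ⟨x, h1, h2, h3⟩ := PerfectPeriods.exists_lift B y.1 y.2
  exact ⟨⟨x, h2⟩, Subtype.ext h1, h3⟩

theorem TildeK.isOpenMap_reduce : IsOpenMap (TildeK.reduce z A K N) := by
  intro U hU
  refine TildeK.isOpen_iff.2 ?_
  rintro _ ⟨x, hx, rfl⟩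
  obtain ⟨a, j, h⟩ := TildeK.isOpen_iff.1 hU x hx
  refine ⟨N, j, fun y hy => ?_⟩
  obtain ⟨v, rfl, hv⟩ := TildeK.exists_lift z A K N y
  exact ⟨x + v, h v (hv j hy a), map_add _ _ _⟩

theorem TildeK.ker_reduce : LinearMap.ker (TildeK.reduce z A K N) =
    (Ideal.span {((p ^ N : ℕ) : Lam z)} • ⊤ : Submodule (Lam z) (TildeK K z A)) := by
  obtain ⟨B⟩ := nonempty_basicSystem (p := p) (A := A)
  ext x
  have hmem := mem_span_pow_smul_top ((p ^ N : ℕ) : Lam z) 1 x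
  simp only [pow_one, Nat.cast_smul_eq_nsmul] at hmem
  rw [hmem, LinearMap.mem_ker]
  constructor
  · intro h
    obtain ⟨y, hy, hy'⟩ := exists_eq_nsmul B x.1 x.2 (congrArg (TildeK.incl K z _) h)
    exact ⟨⟨y, hy'⟩, Subtype.ext hy⟩
  · rintro ⟨y, rfl⟩
    rw [map_nsmul]
    refine TildeK.incl_injective z _ K ?_
    rw [map_nsmul, map_zero]
    exact nsmul_eq_zero B _

/-- The isomorphism `Ã_{K,A} / p ^ N ≃ Ã_{K,A/p^N}`. -/
def TildeK.reduceEquiv : ModNat (p ^ N) (Lam z) (TildeK K z A) ≃L[Lam z]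
    TildeK K z (ModNat (p ^ N) ℤ_[p] A) :=
  let F := Submodule.liftQ (Ideal.span {((p ^ N : ℕ) : Lam z)} • ⊤) (TildeK.reduce z A K N)
    (TildeK.ker_reduce z A K N).ge
  have hb : Function.Bijective F := by
    refine ⟨LinearMap.ker_eq_bot.1 (Submodule.ker_liftQ_eq_bot _ _ _
      (TildeK.ker_reduce z A K N).le), fun y => ?_⟩
    obtain ⟨x, rfl, -⟩ := TildeK.exists_lift z A K N y
    exact ⟨Submodule.Quotient.mk x, rfl⟩
  have hc : Continuous F := continuous_coinduced_dom.2 (TildeK.continuous_reduce z A K N)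
  have ho : IsOpenMap F := fun U hU => by
    have : F '' U = TildeK.reduce z A K N '' (Submodule.Quotient.mk ⁻¹' U) := by
      rw [← Set.image_preimage_eq U (Submodule.Quotient.mk_surjective _), Set.image_image,
        Set.preimage_image_preimage]
      rfl
    rw [this]
    exact TildeK.isOpenMap_reduce z A K N _ (isOpen_coinduced.1 hU)
  let e := LinearEquiv.ofBijective F hb
  have hs : Continuous e.symm := continuous_def.2 fun U hU => by
    have : e.symm ⁻¹' U = F '' U := (e.toEquiv.image_eq_preimage_symm U).symm
    rw [this]
    exact ho U hU
  { e with
    continuous_toFun := hc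
    continuous_invFun := hs }

theorem pow_smul_modNat (x : ModNat (p ^ N) ℤ_[p] A) : (p : ℤ_[p]) ^ N • x = 0 := by
  obtain ⟨x, rfl⟩ := Submodule.mkQ_surjective _ x
  rw [← map_smul]
  refine (Submodule.Quotient.mk_eq_zero _).2 ?_
  rw [← Nat.cast_pow]
  exact Submodule.smul_mem_smul (Ideal.mem_span_singleton_self _) trivial

end Reduction
end PerfectPeriods
end

open PerfectPeriods
theorem proposition2p17 (p : ℕ) [Fact p.Prime] (z : RootSystem p)
    (K : IntermediateField ℚ_[p] (PadicAlgCl p)) [FiniteDimensional ℚ_[p] K]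
    (A : Type*) [AddCommGroup A] [Module ℤ_[p] A] [IsAdicComplete (Ideal.span {(p : ℤ_[p])}) A]
    (N : ℕ) (r : Radius p) :
    ∃ (e₁ : ModNat (p ^ N) (Lam z) (TildeK K z A) ≃L[Lam z] TildeK K z (ModNat (p ^ N) ℤ_[p] A))
      (e₂ : TildeK K z (ModNat (p ^ N) ℤ_[p] A) ≃L[Lam z] TildeRK K z r (ModNat (p ^ N) ℤ_[p] A))
      (e₃ : TildeRK K z r (ModNat (p ^ N) ℤ_[p] A) ≃L[Lam z]
        TildeInfK K z (ModNat (p ^ N) ℤ_[p] A)),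
      (∀ x : TildeK K z A, TildeK.incl K z _ (e₁ (Submodule.Quotient.mk x)) =
        Tilde.reduce z (Submodule.mkQ _) (TildeK.incl K z _ x)) ∧
      (∀ y, TildeR.toTilde z r _ (TildeRK.incl K z r _ (e₂ y)) = TildeK.incl K z _ y) ∧
      (∀ w, TildeInf.toTilde z _ (TildeInfK.incl K z _ (e₃ w)) =
        TildeR.toTilde z r _ (TildeRK.incl K z r _ w)) := by
  have hA := pow_smul_modNat (p := p) A N
  let eR := tildeRKEquiv z r K hA
  let eI := tildeInfKEquiv z K hA
  refine ⟨TildeK.reduceEquiv z A K N, eR.symm, eR.trans eI.symm, fun x => rfl, fun y => ?_,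
    fun w => ?_⟩
  · rw [← incl_tildeRKEquiv z r K hA]
    exact congrArg _ (eR.apply_symm_apply y)
  · rw [← incl_tildeRKEquiv z r K hA, ← incl_tildeInfKEquiv z K hA]
    exact congrArg _ (eI.apply_symm_apply (eR w))
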